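/- Let $G$ be a directed acyclic graph (dag) with $n$ vertices and $m$ edges. For thresholds $t_1,t_2>0$, a \emph{satisfying assignment} is a map $\alpha:V(G)\to\mathbb{R}$ with $\alpha(v)-\alpha(u)\ge t_1$ whenever $(u,v)$ is an edge and $\alpha(v)-\alpha(u)\le t_2$ whenever $(u,v)$ is not an edge. Let $\lambda(G)$ be the infimum of the ratios $t_2/t_1$, over all $t_1,t_2>0$, for which a satisfying assignment exists. $G$ is \emph{degenerate} if it models a weak order, that is, if for some $\alpha:V(G)\to\mathbb{R}$ the edges are exactly the pairs $(u,v)$ with $\alpha(u)<\alpha(v)$; otherwise it is \emph{nondegenerate}. A \emph{hop} is a pair $(u,v)$ of distinct vertices such that neither $(u,v)$ nor $(v,u)$ is an edge. A \emph{forcing cycle} is a cyclic sequence of distinct vertices in which each consecutive pair is an edge or a hop; its \emph{ratio} is its number of edges divided by its number of hops. The \emph{constraint digraph} $G_d$, weighted according to $(t_1,t_2)$, has the vertices of $G$, an edge $(y,x)$ of weight $-t_1$ for each edge $(x,y)$ of $G$, and an edge $(u,v)$ of weight $t_2$ for each hop $(u,v)$. Its minimum cycle mean is the least value, over its simple directed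 cycles, of the weight of the cycle divided by its length. \textbf{Theorem.} Given a nondegenerate dag $G$, it takes $O(nm/\lambda)$ time to find $\lambda=\lambda(G)$ together with a certificate. Precisely: there are a program for a unit-cost word RAM with words of $O(\log n)$ bits and a constant $C$ such that, for every nondegenerate dag $G$ with vertices $0,\dots,n-1$ that is given by the list of its $m$ edges in any order, the program halts after at most $C\,nm/\lambda(G)$ steps and outputs (a) integers $j$ and $i>0$ with $\lambda(G)=j/i$, where $j/i$ is the least satisfiable ratio (the infimum is attained), and where, for all $t_1,t_2>0$, the minimum cycle mean of $G_d$ weighted according to $(t_1,t_2)$ is $(i\,t_2-j\,t_1)/(i+j)$; (b) an integer-valued satisfying assignment for the thresholds $(i,j)$; (c) a forcing cycle of $G$ of ratio $\lambda(G)$. -/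

import Mathlib

/-! ### Double-threshold digraphs -/

namespace DoubleThreshold

variable {V : Type*}

/-- A digraph is a dag if it has no directed cycle (in particular no loop). -/
def IsDag (G : Digraph V) : Prop :=
  ∀ v, ¬ Relation.TransGen G.Adj v v

/-- The number `m(G)` of edges. -/
noncomputable def numEdges (G : Digraph V) : ℕ :=
  {p : V × V | G.Adj p.1 p.2}.ncard

/-- `α` is a satisfying utility function for the thresholds `(t₁, t₂)`. -/
def IsSatisfying (G : Digraph V) (t₁ t₂ : ℝ) (α : V → ℝ) : Prop :=
  (∀ u v, G.Adj u v → t₁ ≤ α v - α u) ∧ (∀ u v, ¬ G.Adj u v → α v - α u ≤ t₂)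

/-- `G` is a `(t₁, t₂)` double-threshold digraph. -/
def IsDoubleThreshold (G : Digraph V) (t₁ t₂ : ℝ) : Prop :=
  ∃ α : V → ℝ, IsSatisfying G t₁ t₂ α

/-- The satisfiable ratios `t₂ / t₁`, over positive thresholds. -/
def satisfiableRatios (G : Digraph V) : Set ℝ :=
  {r | ∃ t₁ t₂ : ℝ, 0 < t₁ ∧ 0 < t₂ ∧ IsDoubleThreshold G t₁ t₂ ∧ r = t₂ / t₁}

/-- `λ(G)`: the least satisfiable ratio (for a dag that models a weak order it is not attained, and
the infimum is `0`). -/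
noncomputable def lam (G : Digraph V) : ℝ :=
  sInf (satisfiableRatios G)

/-- A dag is degenerate if it models a weak order, that is, if its edges are exactly the pairs with
strictly increasing value for some assignment of values. -/
def IsDegenerate (G : Digraph V) : Prop :=
  ∃ α : V → ℝ, ∀ u v, G.Adj u v ↔ α u < α v

/-- A hop is a pair of distinct vertices, neither of which has an edge to the other. -/
def IsHop (G : Digraph V) (u v : V) : Prop :=
  u ≠ v ∧ ¬ G.Adj u v ∧ ¬ G.Adj v u

/-- The cyclically consecutive pairs `(v₁,v₂), …, (vₖ₋₁,vₖ), (vₖ,v₁)` of `[v₁, …, vₖ]`. -/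
def cyclicPairs (c : List V) : List (V × V) :=
  c.zip (c.rotate 1)

/-- The list `c` of distinct vertices is a simple directed cycle of the digraph `D`. -/
def IsSimpleCycle (D : Digraph V) (c : List V) : Prop :=
  c ≠ [] ∧ c.Nodup ∧ ∀ p ∈ cyclicPairs c, D.Adj p.1 p.2

/-- A forcing cycle of `G`: a simple cycle each of whose steps is an edge of `G` or a hop. -/
def IsForcingCycle (G : Digraph V) (c : List V) : Prop :=
  IsSimpleCycle ⟨fun u v => G.Adj u v ∨ IsHop G u v⟩ c

open Classical in
/-- The number of steps of the cycle that are edges of `G`. -/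
noncomputable def edgeCount (G : Digraph V) (c : List V) : ℕ :=
  (cyclicPairs c).countP fun p => decide (G.Adj p.1 p.2)

open Classical in
/-- The number of steps of the cycle that are hops. -/
noncomputable def hopCount (G : Digraph V) (c : List V) : ℕ :=
  (cyclicPairs c).countP fun p => decide (IsHop G p.1 p.2)

/-- The ratio of edges to hops (a forcing cycle of a dag always has a hop). -/
noncomputable def cycleRatio (G : Digraph V) (c : List V) : ℝ :=
  (edgeCount G c : ℝ) / (hopCount G c : ℝ)

/-- The constraint digraph `G_d`: the reversed edges of `G`, and the hops in both directions. -/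
def constraintDigraph (G : Digraph V) : Digraph V :=
  ⟨fun x y => G.Adj y x ∨ IsHop G x y⟩

open Classical in
/-- The weights on `G_d`: `-t₁` on a reversed edge of `G`, and `t₂` on a hop. -/
noncomputable def constraintWeight (G : Digraph V) (t₁ t₂ : ℝ) (x y : V) : ℝ :=
  if G.Adj y x then -t₁ else t₂

/-- The mean weight of a cycle in `G_d`. -/
noncomputable def meanWeight (G : Digraph V) (t₁ t₂ : ℝ) (c : List V) : ℝ :=
  ((cyclicPairs c).map fun p => constraintWeight G t₁ t₂ p.1 p.2).sum / (c.length : ℝ)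

/-- `μ` is the minimum cycle mean of `G_d` under the weights given by `(t₁, t₂)`. -/
def IsMinCycleMean (G : Digraph V) (t₁ t₂ μ : ℝ) : Prop :=
  IsLeast {x | ∃ c, IsSimpleCycle (constraintDigraph G) c ∧ x = meanWeight G t₁ t₂ c} μ

end DoubleThreshold

/-! ### A word RAM with unit costs

Programs are given in structured form. A program uses finitely many registers and finitely many
arrays; registers and array cells hold integers (signed words), and cells are addressed by words.
Execution is relative to a bound `W` on the absolute value of the words: a program that computes a
larger number has no execution. -/

namespace WordRAM

structure State where
  reg : ℕ → ℤ
  mem : ℕ → ℤ → ℤ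

def State.setReg (s : State) (x : ℕ) (v : ℤ) : State :=
  { s with reg := Function.update s.reg x v }

def State.setMem (s : State) (A : ℕ) (i v : ℤ) : State :=
  { s with mem := Function.update s.mem A (Function.update (s.mem A) i v) }

/-- `get A e` is the content of cell `e` of array `A`. -/
inductive Expr where
  | const (c : ℤ)
  | reg (x : ℕ)
  | get (A : ℕ) (e : Expr)
  | add (e f : Expr)
  | sub (e f : Expr)
  | mul (e f : Expr)
  | div (e f : Expr)

/-- The value of an expression; `div` is integer division, with `a / 0 = 0`. -/
def Expr.eval (s : State) : Expr → ℤ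
  | const c => c
  | reg x => s.reg x
  | get A e => s.mem A (e.eval s)
  | add e f => e.eval s + f.eval s
  | sub e f => e.eval s - f.eval s
  | mul e f => e.eval s * f.eval s
  | div e f => e.eval s / f.eval s

/-- Every number computed in the evaluation is a word. -/
def Expr.Fits (W : ℕ) (s : State) : Expr → Prop
  | const c => |c| ≤ (W : ℤ)
  | reg _ => True
  | get _ e => e.Fits W s
  | add e f => e.Fits W s ∧ f.Fits W s ∧ |e.eval s + f.eval s| ≤ (W : ℤ)
  | sub e f => e.Fits W s ∧ f.Fits W s ∧ |e.eval s - f.eval s| ≤ (W : ℤ)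
  | mul e f => e.Fits W s ∧ f.Fits W s ∧ |e.eval s * f.eval s| ≤ (W : ℤ)
  | div e f => e.Fits W s ∧ f.Fits W s ∧ |e.eval s / f.eval s| ≤ (W : ℤ)

/-- Every constant, register access, memory access and arithmetic operation costs one step. -/
def Expr.cost : Expr → ℕ
  | const _ => 1
  | reg _ => 1
  | get _ e => e.cost + 1
  | add e f => e.cost + f.cost + 1
  | sub e f => e.cost + f.cost + 1
  | mul e f => e.cost + f.cost + 1
  | div e f => e.cost + f.cost + 1

inductive Test where
  | lt (e f : Expr)
  | le (e f : Expr)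
  | eq (e f : Expr)

def Test.Holds (s : State) : Test → Prop
  | lt e f => e.eval s < f.eval s
  | le e f => e.eval s ≤ f.eval s
  | eq e f => e.eval s = f.eval s

def Test.Fits (W : ℕ) (s : State) : Test → Prop
  | lt e f => e.Fits W s ∧ f.Fits W s
  | le e f => e.Fits W s ∧ f.Fits W s
  | eq e f => e.Fits W s ∧ f.Fits W s

def Test.cost : Test → ℕ
  | lt e f => e.cost + f.cost + 1
  | le e f => e.cost + f.cost + 1
  | eq e f => e.cost + f.cost + 1

/-- `set x e` is `x := e`; `store A e f` is `A[e] := f`; `cond b p q` is `if b then p else q`;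
`loop b p` is `while b do p`. -/
inductive Program where
  | skip
  | set (x : ℕ) (e : Expr)
  | store (A : ℕ) (e f : Expr)
  | seq (p q : Program)
  | cond (b : Test) (p q : Program)
  | loop (b : Test) (p : Program)

/-- `Exec W P s s' t`: with words bounded by `W`, the program `P` started in state `s` halts in
state `s'` after `t` steps. -/
inductive Exec (W : ℕ) : Program → State → State → ℕ → Prop where
  | skip (s : State) : Exec W .skip s s 1
  | set (x : ℕ) (e : Expr) (s : State) (he : e.Fits W s) :
      Exec W (.set x e) s (s.setReg x (e.eval s)) (e.cost + 1)
  | store (A : ℕ) (e f : Expr) (s : State) (he : e.Fits W s) (hf : f.Fits W s) :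
      Exec W (.store A e f) s (s.setMem A (e.eval s) (f.eval s)) (e.cost + f.cost + 1)
  | seq (p q : Program) (s₁ s₂ s₃ : State) (t u : ℕ)
      (hp : Exec W p s₁ s₂ t) (hq : Exec W q s₂ s₃ u) : Exec W (.seq p q) s₁ s₃ (t + u)
  | cond_true (b : Test) (p q : Program) (s s' : State) (t : ℕ)
      (hb : b.Fits W s) (hs : b.Holds s) (hp : Exec W p s s' t) :
      Exec W (.cond b p q) s s' (b.cost + t)
  | cond_false (b : Test) (p q : Program) (s s' : State) (t : ℕ)
      (hb : b.Fits W s) (hs : ¬ b.Holds s) (hq : Exec W q s s' t) :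
      Exec W (.cond b p q) s s' (b.cost + t)
  | loop_true (b : Test) (p : Program) (s₁ s₂ s₃ : State) (t u : ℕ)
      (hb : b.Fits W s₁) (hs : b.Holds s₁) (hp : Exec W p s₁ s₂ t)
      (hl : Exec W (.loop b p) s₂ s₃ u) : Exec W (.loop b p) s₁ s₃ (b.cost + t + u)
  | loop_false (b : Test) (p : Program) (s : State)
      (hb : b.Fits W s) (hs : ¬ b.Holds s) : Exec W (.loop b p) s s b.cost

end WordRAM

namespace DoubleThreshold

open WordRAM

/-- `es` lists every edge of `G` exactly once, in any order. -/
def IsEdgeList {V : Type*} (G : Digraph V) (es : List (V × V)) : Prop :=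
  es.Nodup ∧ ∀ p, p ∈ es ↔ G.Adj p.1 p.2

/-- The input: register `0` holds `n`, register `1` holds `m`, and cell `i` of array `0` (array `1`)
holds the tail (the head) of the `i`-th edge, for `0 ≤ i < m`. Everything else is zero. -/
def inputState (n : ℕ) (es : List (Fin n × Fin n)) : State where
  reg x := if x = 0 then (n : ℤ) else if x = 1 then (es.length : ℤ) else 0
  mem A i :=
    if 0 ≤ i then
      match es[i.toNat]? with
      | some p =>
        if A = 0 then ((p.1 : ℕ) : ℤ) else if A = 1 then ((p.2 : ℕ) : ℤ) else 0
      | none => 0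
    else 0

/-- The output: registers `2` and `3` hold a numerator `j` and a denominator `i`, cell `v` of array
`2` holds the utility value of the vertex `v`, register `4` holds the length of a cycle, and array
`3` lists its vertices. The fraction `j / i` is `λ(G)`, which also gives the minimum cycle mean of
`G_d` for every choice of thresholds; the utility function satisfies the thresholds `(i, j)`; and
the cycle is a forcing cycle of ratio `λ(G)`. -/
structure IsCertifiedOutput {n : ℕ} (G : Digraph (Fin n)) (s : State) : Prop where
  den_pos : 0 < s.reg 3
  lam_eq : lam G = (s.reg 2 : ℝ) / (s.reg 3 : ℝ)
  isLeast : IsLeast (satisfiableRatios G) ((s.reg 2 : ℝ) / (s.reg 3 : ℝ))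
  minCycleMean : ∀ t₁ t₂ : ℝ, 0 < t₁ → 0 < t₂ →
    IsMinCycleMean G t₁ t₂
      (((s.reg 3 : ℝ) * t₂ - (s.reg 2 : ℝ) * t₁) / ((s.reg 3 : ℝ) + (s.reg 2 : ℝ)))
  satisfying : IsSatisfying G (s.reg 3 : ℝ) (s.reg 2 : ℝ)
    (fun v : Fin n => (s.mem 2 ((v : ℕ) : ℤ) : ℝ))
  forcing : ∃ cyc : List (Fin n), IsForcingCycle G cyc ∧ cycleRatio G cyc = lam G ∧
    s.reg 4 = (cyc.length : ℤ) ∧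
    ∀ (k : ℕ) (hk : k < cyc.length), s.mem 3 (k : ℤ) = ((cyc[k].val : ℕ) : ℤ)

end DoubleThreshold

/-!
The program computes a table of longest walks. Call a walk any sequence of edges of `G` and hops,
where a hop from `u` to `v` is allowed as soon as `(v, u)` is not an edge; let `D k i` be the largest
number of edges of a walk that ends in `i` and has exactly `k` hops. A satisfying assignment for the
thresholds `(1, r)` is a potential for these walks: it increases by at least `1` along an edge and
decreases by at most `r` along a hop. So every closed walk with `e` edges and `l` hops forces
`e ≤ r * l`, and `lam G` is the maximum of the ratios `e / l`.

As in Karp's algorithm for the minimum cycle mean, this maximum can be read off from the table. For a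
layer `N > 0`, let `p / q` be the maximum over `i` of the minimum over `k < N` of the slopes
`(D N i - D k i) / (N - k)`, attained at `i = v`.

* The assignment `α i = max {q * D k i - p * k | k < N}` is always satisfying for `(q, p)`, since the
  layer `N` adds nothing to these maxima (`IsTable.satisfying`). Hence `lam G ≤ p / q`.
* If the optimal walk to `v` has at least `M` edges and hops, where `M` is the number of vertices, then
  it contains a closed part with `e` edges and `l` hops (`IsTable.exists_repeat`). Without this part,
  the walk shows `D N v - e ≤ D (N - l) v` (`IsTable.cut`), and the choice of `p / q` yields
  `p / q ≤ e / l`. So the closed part is a forcing cycle of ratio `p / q = lam G`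
  (`IsBestSlope.eq_lam`, `IsBestSlope.forcing`).
* The walk is certainly long enough if `M ≤ N * (1 + p / q)` (`IsBestSlope.le_walk`). Therefore it is
  enough to try `N = 1, 2, 4, …`, and the search ends with a layer `N ≤ 2 * M / (1 + lam G)`
  (`runs_findRatio`).

A layer is computed from the previous one in linear time. For the hop into a vertex `i`, the vertices
are listed by decreasing entries, and the list is searched for the first vertex that is not the head of
an edge from `i`; the search skips at most as many vertices as there are edges from `i`. Cutting closed
parts out of a walk gives `D k i ≤ lam G * k + M` (`IsTable.le_mul_add`), so the entries are `O(M)`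
throughout, and they can be sorted by buckets. Then the edges are relaxed in topological order. With
`O(M / lam G)` layers, the total time is `O(n * m / lam G)` once `M = O(m)`. To achieve this, the
vertices are sorted topologically and all but one of the isolated vertices are dropped; the others
receive the value of the one that is kept (`KahnInv.length_le_edges`, `IsLabeling.sat_iff`).

A forcing cycle that is tight for a satisfying assignment is, when reversed, a cycle of least mean in
the constraint digraph for all thresholds, because the assignment is a potential there, too
(`IsForcingCycle.isMinCycleMean`).

For a word bound, it suffices that all stored numbers are at most `B = n ^ 6`; the expressions are so
simple that intermediate results are then at most `B ^ 10` (`Expr.small_spec`). Programs are specified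
by the predicate `Runs`, which combines termination, time, and the word bound.

The state is laid out as follows. Register `0` holds `n`, register `1` holds `m`, the registers `2` and
`3` hold the fraction, register `4` the length of the cycle, register `6` the number `M` of vertices
that are kept, register `8` the number of listed edges, register `9` the number of the last layer,
register `10` the next layer to be evaluated, and register `12` the vertex of the best slope; register
`7` marks the isolated vertex that is kept, register `20` marks the end of the search, and the others
are temporary. The arrays `0` and `1` hold the input, and `2` and `3` the certificates. The arrays `4`
and `5` hold lists of the edges by tails, `6` the numbers of unlisted edges by heads, `7` the vertices
by positions, `10` the positions by vertices, and `19` and `8` the tails and heads of the sorted edges.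
The arrays `11` and `12` hold the entries and the parents of the table, `13` and `14` the buckets, `15`
the vertices by decreasing entries, and `16` the marks of heads; `17` and `18` hold the vertices on the
chain of parents and the times of their visits.
-/

namespace WordRAM

/-! ### Verification rules for word RAM programs -/

/-- All registers and memory cells hold numbers of absolute value at most `B`. -/
def Bounded (B : ℕ) (s : State) : Prop :=
  (∀ x, |s.reg x| ≤ (B : ℤ)) ∧ ∀ A i, |s.mem A i| ≤ (B : ℤ)

/-- An exponent `d` such that the value of the expression is at most `B ^ d` in every state that is
bounded by `B`, provided that `2 ≤ B` and that the constants are at most `2`. -/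
def Expr.deg : Expr → ℕ
  | const _ => 1
  | reg _ => 1
  | get _ _ => 1
  | add e f => max e.deg f.deg + 1
  | sub e f => max e.deg f.deg + 1
  | mul e f => e.deg + f.deg
  | div e _ => e.deg

/-- All constants are at most `2` and all subexpressions have degree at most `10`. -/
def Expr.small : Expr → Bool
  | const c => decide (|c| ≤ 2)
  | reg _ => true
  | get _ e => e.small
  | add e f => e.small && f.small && decide ((add e f).deg ≤ 10)
  | sub e f => e.small && f.small && decide ((sub e f).deg ≤ 10)
  | mul e f => e.small && f.small && decide ((mul e f).deg ≤ 10)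
  | div e f => e.small && f.small

/-- In a state that is bounded by `B`, small expressions are evaluated within words bounded by `B ^ 10`.
Hence only the numbers that a program stores have to be bounded in the proofs below. -/
theorem Expr.small_spec {B : ℕ} (hB : 2 ≤ B) {s : State} (hs : Bounded B s) (e : Expr)
    (he : e.small = true) :
    e.deg ≤ 10 ∧ |e.eval s| ≤ (B : ℤ) ^ e.deg ∧ e.Fits (B ^ 10) s := by
  have hB1 : (1 : ℤ) ≤ B := by exact_mod_cast (by omega : 1 ≤ B)
  have hB2 : (2 : ℤ) ≤ B := by exact_mod_cast hB
  have key : ∀ {x : ℤ} {d : ℕ}, |x| ≤ (B : ℤ) ^ d → d ≤ 10 → |x| ≤ ((B ^ 10 : ℕ) : ℤ) := by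
    intro x d hx hd
    push_cast
    exact hx.trans (pow_le_pow_right₀ hB1 hd)
  have hadd : ∀ {x y : ℤ} {d d' : ℕ}, |x| ≤ (B : ℤ) ^ d → |y| ≤ (B : ℤ) ^ d' →
      |x| + |y| ≤ (B : ℤ) ^ (max d d' + 1) := by
    intro x y d d' hx hy
    have h1 := hx.trans (pow_le_pow_right₀ hB1 (le_max_left d d'))
    have h2 := hy.trans (pow_le_pow_right₀ hB1 (le_max_right d d'))
    rw [pow_succ]
    nlinarith [abs_nonneg x]
  induction e with
  | const c =>
    simp only [Expr.small, decide_eq_true_eq] at he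
    refine ⟨by simp [Expr.deg], by simpa [Expr.deg, Expr.eval] using he.trans hB2, ?_⟩
    exact key (d := 1) (by simpa using he.trans hB2) (by norm_num)
  | reg x => exact ⟨by simp [Expr.deg], by simpa [Expr.deg, Expr.eval] using hs.1 x, trivial⟩
  | get A e ih =>
    exact ⟨by simp [Expr.deg], by simpa [Expr.deg, Expr.eval] using hs.2 A _, (ih he).2.2⟩
  | add e f ihe ihf =>
    simp only [Expr.small, Bool.and_eq_true, decide_eq_true_eq] at he
    obtain ⟨-, he1, he2⟩ := ihe he.1.1
    obtain ⟨-, hf1, hf2⟩ := ihf he.1.2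
    have h := (abs_add_le (e.eval s) (f.eval s)).trans (hadd he1 hf1)
    exact ⟨he.2, h, he2, hf2, key h he.2⟩
  | sub e f ihe ihf =>
    simp only [Expr.small, Bool.and_eq_true, decide_eq_true_eq] at he
    obtain ⟨-, he1, he2⟩ := ihe he.1.1
    obtain ⟨-, hf1, hf2⟩ := ihf he.1.2
    have h := (abs_sub (e.eval s) (f.eval s)).trans (hadd he1 hf1)
    exact ⟨he.2, h, he2, hf2, key h he.2⟩
  | mul e f ihe ihf =>
    simp only [Expr.small, Bool.and_eq_true, decide_eq_true_eq] at he
    obtain ⟨-, he1, he2⟩ := ihe he.1.1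
    obtain ⟨-, hf1, hf2⟩ := ihf he.1.2
    have h : |e.eval s * f.eval s| ≤ (B : ℤ) ^ (e.deg + f.deg) := by
      rw [abs_mul, pow_add]
      gcongr
    exact ⟨he.2, h, he2, hf2, key h he.2⟩
  | div e f ihe ihf =>
    simp only [Expr.small, Bool.and_eq_true] at he
    obtain ⟨hd, he1, he2⟩ := ihe he.1
    obtain ⟨-, -, hf2⟩ := ihf he.2
    have h : |e.eval s / f.eval s| ≤ (B : ℤ) ^ e.deg :=
      (Int.abs_ediv_le_abs _ _).trans he1
    exact ⟨hd, h, he2, hf2, key h hd⟩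

/-- Both sides of the test are small. -/
def Test.small : Test → Bool
  | lt e f => e.small && f.small
  | le e f => e.small && f.small
  | eq e f => e.small && f.small

theorem Test.small_fits {B : ℕ} (hB : 2 ≤ B) {s : State} (hs : Bounded B s) (b : Test)
    (hb : b.small = true) : b.Fits (B ^ 10) s := by
  cases b <;> simp only [Test.small, Bool.and_eq_true] at hb <;>
    exact ⟨(Expr.small_spec hB hs _ hb.1).2.2, (Expr.small_spec hB hs _ hb.2).2.2⟩

/-- All expressions of the program are small. -/
def Program.small : Program → Bool
  | skip => true
  | set _ e => e.small
  | store _ e f => e.small && f.small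
  | seq p q => p.small && q.small
  | cond b p q => b.small && p.small && q.small
  | loop b p => b.small && p.small

/-- The program may assign to the register `x`. -/
def Program.writesReg (x : ℕ) : Program → Bool
  | skip => false
  | set y _ => y == x
  | store _ _ _ => false
  | seq p q => p.writesReg x || q.writesReg x
  | cond _ p q => p.writesReg x || q.writesReg x
  | loop _ p => p.writesReg x

/-- The program may write to the array `A`. -/
def Program.writesMem (A : ℕ) : Program → Bool
  | skip => false
  | set _ _ => false
  | store A' _ _ => A' == A
  | seq p q => p.writesMem A || q.writesMem A
  | cond _ p q => p.writesMem A || q.writesMem A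
  | loop _ p => p.writesMem A

/-- `s'` agrees with `s` on everything that `P` does not write. -/
def Frame (P : Program) (s s' : State) : Prop :=
  (∀ x, P.writesReg x = false → s'.reg x = s.reg x) ∧
    ∀ A, P.writesMem A = false → s'.mem A = s.mem A

/-- A program changes only what it writes, so the unchanged part of a state need not be mentioned in
the specification of a program. -/
theorem Exec.frame {W : ℕ} {P : Program} {s s' : State} {t : ℕ} (h : Exec W P s s' t) :
    Frame P s s' := by
  induction h with
  | skip s => exact ⟨fun _ _ => rfl, fun _ _ => rfl⟩
  | set x e s he =>
    refine ⟨fun y hy => ?_, fun _ _ => rfl⟩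
    simp only [Program.writesReg, beq_eq_false_iff_ne] at hy
    simp [State.setReg, Function.update_of_ne (Ne.symm hy)]
  | store A e f s he hf =>
    refine ⟨fun _ _ => rfl, fun y hy => ?_⟩
    simp only [Program.writesMem, beq_eq_false_iff_ne] at hy
    simp [State.setMem, Function.update_of_ne (Ne.symm hy)]
  | seq p q s₁ s₂ s₃ t u hp hq ihp ihq =>
    refine ⟨fun y hy => ?_, fun y hy => ?_⟩
    · simp only [Program.writesReg, Bool.or_eq_false_iff] at hy
      rw [ihq.1 y hy.2, ihp.1 y hy.1]
    · simp only [Program.writesMem, Bool.or_eq_false_iff] at hy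
      rw [ihq.2 y hy.2, ihp.2 y hy.1]
  | cond_true b p q s s' t hb hs hp ih =>
    refine ⟨fun y hy => ?_, fun y hy => ?_⟩
    · simp only [Program.writesReg, Bool.or_eq_false_iff] at hy
      exact ih.1 y hy.1
    · simp only [Program.writesMem, Bool.or_eq_false_iff] at hy
      exact ih.2 y hy.1
  | cond_false b p q s s' t hb hs hp ih =>
    refine ⟨fun y hy => ?_, fun y hy => ?_⟩
    · simp only [Program.writesReg, Bool.or_eq_false_iff] at hy
      exact ih.1 y hy.2
    · simp only [Program.writesMem, Bool.or_eq_false_iff] at hy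
      exact ih.2 y hy.2
  | loop_true b p s₁ s₂ s₃ t u hb hs hp hl ihp ihl =>
    refine ⟨fun y hy => ?_, fun y hy => ?_⟩
    · rw [ihl.1 y hy]; exact ihp.1 y hy
    · rw [ihl.2 y hy]; exact ihp.2 y hy
  | loop_false b p s hb hs => exact ⟨fun _ _ => rfl, fun _ _ => rfl⟩

/-- Started in `s`, the program `P` halts within `T` steps in a state that satisfies `Q`; all numbers
that it stores are at most `B`, and all numbers that it computes are at most `B ^ 10`. -/
def Runs (B : ℕ) (P : Program) (s : State) (T : ℤ) (Q : State → Prop) : Prop :=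
  Bounded B s → ∃ s' t, Exec (B ^ 10) P s s' t ∧ (t : ℤ) ≤ T ∧ Bounded B s' ∧ Q s'

theorem Runs.mono {B : ℕ} {P : Program} {s : State} {T T' : ℤ} {Q Q' : State → Prop}
    (h : Runs B P s T Q) (hT : T ≤ T') (hQ : ∀ s', Bounded B s' → Frame P s s' → Q s' → Q' s') :
    Runs B P s T' Q' := by
  intro hb
  obtain ⟨s', t, he, ht, hb', hq⟩ := h hb
  exact ⟨s', t, he, ht.trans hT, hb', hQ s' hb' he.frame hq⟩

theorem Runs.of_bounded {B : ℕ} {P : Program} {s : State} {T : ℤ} {Q : State → Prop}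
    (h : Bounded B s → Runs B P s T Q) : Runs B P s T Q := fun hb => h hb hb

theorem Runs.seq {B : ℕ} {p q : Program} {s : State} {T₁ T₂ T : ℤ} {Q R : State → Prop}
    (hp : Runs B p s T₁ Q)
    (hq : ∀ s', Bounded B s' → Frame p s s' → Q s' → Runs B q s' T₂ R) (hT : T₁ + T₂ ≤ T) :
    Runs B (.seq p q) s T R := by
  intro hb
  obtain ⟨s', t, he, ht, hb', hQ⟩ := hp hb
  obtain ⟨s'', u, he', hu, hb'', hR⟩ := hq s' hb' he.frame hQ hb'
  exact ⟨s'', t + u, .seq _ _ _ _ _ _ _ he he', by push_cast; linarith, hb'', hR⟩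

theorem Runs.cond {B : ℕ} (hB : 2 ≤ B) {b : Test} {p q : Program} {s : State} {T T' : ℤ}
    {Q : State → Prop} (hsm : b.small = true) (hp : b.Holds s → Runs B p s T Q)
    (hq : ¬ b.Holds s → Runs B q s T Q) (hT : T + b.cost ≤ T') :
    Runs B (.cond b p q) s T' Q := by
  intro hb
  have hf := Test.small_fits hB hb b hsm
  by_cases h : b.Holds s
  · obtain ⟨s', t, he, ht, hb', hQ⟩ := hp h hb
    exact ⟨s', _, .cond_true _ _ _ _ _ _ hf h he, by push_cast; linarith, hb', hQ⟩
  · obtain ⟨s', t, he, ht, hb', hQ⟩ := hq h hb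
    exact ⟨s', _, .cond_false _ _ _ _ _ _ hf h he, by push_cast; linarith, hb', hQ⟩

theorem Test.cost_pos (b : Test) : 0 < b.cost := by
  cases b <;> simp [Test.cost]

/-- The rule for loops. The invariant `I φ s` carries a bound `φ` on the time that is still needed:
every round pays for its own cost out of `φ`. -/
theorem Runs.loop {B : ℕ} (hB : 2 ≤ B) {b : Test} {p : Program} (I : ℤ → State → Prop)
    (hsm : b.small = true) (hnn : ∀ φ s, I φ s → 0 ≤ φ)
    (hstep : ∀ φ s, Bounded B s → I φ s → b.Holds s →
      ∃ T, Runs B p s T fun s' => ∃ φ', T + b.cost + φ' ≤ φ ∧ I φ' s')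
    {φ T : ℤ} {s : State} (hI : I φ s) (hT : φ + b.cost ≤ T) :
    Runs B (.loop b p) s T fun s' => ∃ φ', I φ' s' ∧ ¬ b.Holds s' := by
  have main : ∀ (N : ℕ) (φ : ℤ) (s : State), φ.toNat ≤ N → I φ s →
      Runs B (.loop b p) s (φ + b.cost) fun s' => ∃ φ', I φ' s' ∧ ¬ b.Holds s' := by
    intro N
    induction N with
    | zero =>
      intro φ s hN hI hb
      have h0 := hnn φ s hI
      by_cases h : b.Holds s
      · obtain ⟨T, hr⟩ := hstep φ s hb hI h
        obtain ⟨s', t, he, ht, hb', φ', hφ', hI'⟩ := hr hb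
        have := hnn φ' s' hI'
        have := b.cost_pos
        omega
      · exact ⟨s, b.cost, .loop_false _ _ _ (Test.small_fits hB hb b hsm) h, by linarith, hb,
          φ, hI, h⟩
    | succ N ih =>
      intro φ s hN hI hb
      have h0 := hnn φ s hI
      have hf := Test.small_fits hB hb b hsm
      by_cases h : b.Holds s
      · obtain ⟨T, hr⟩ := hstep φ s hb hI h
        obtain ⟨s', t, he, ht, hb', φ', hφ', hI'⟩ := hr hb
        have := hnn φ' s' hI'
        have := b.cost_pos
        obtain ⟨s'', u, he', hu, hb'', hQ⟩ := ih φ' s' (by omega) hI' hb'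
        exact ⟨s'', _, .loop_true _ _ _ _ _ _ _ hf h he he', by push_cast; linarith, hb'', hQ⟩
      · exact ⟨s, b.cost, .loop_false _ _ _ hf h, by linarith, hb, φ, hI, h⟩
  exact (main _ φ s le_rfl hI).mono hT fun _ _ _ h => h

/-- A bound on the cost of a program without loops. -/
def Program.maxCost : Program → ℕ
  | skip => 1
  | set _ e => e.cost + 1
  | store _ e f => e.cost + f.cost + 1
  | seq p q => p.maxCost + q.maxCost
  | cond b p q => b.cost + max p.maxCost q.maxCost
  | loop _ _ => 0

/-- The value of `e` is at most `B`; this is automatic if `e` only reads a register or a cell of a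
bounded state. -/
def Expr.ValOk (B : ℕ) (s : State) : Expr → Prop
  | reg _ => True
  | get _ _ => True
  | const c => |c| ≤ 2
  | e => |e.eval s| ≤ (B : ℤ)

theorem Expr.ValOk.abs_le {B : ℕ} (hB : 2 ≤ B) {s : State} (hs : Bounded B s) {e : Expr}
    (h : e.ValOk B s) : |e.eval s| ≤ (B : ℤ) := by
  cases e with
  | const c => exact le_trans h (by exact_mod_cast hB)
  | reg x => exact hs.1 x
  | get A e => exact hs.2 A _
  | _ => exact h

/-- The weakest precondition of a program without loops: it stores only numbers of absolute value at
most `B`, and its final state satisfies `Q`. -/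
def Program.Wp (B : ℕ) : Program → State → (State → Prop) → Prop
  | skip, s, Q => Q s
  | set x e, s, Q => e.ValOk B s ∧ Q (s.setReg x (e.eval s))
  | store A e f, s, Q => f.ValOk B s ∧ Q (s.setMem A (e.eval s) (f.eval s))
  | seq p q, s, Q => p.Wp B s fun s' => q.Wp B s' Q
  | cond b p q, s, Q => (b.Holds s → p.Wp B s Q) ∧ (¬ b.Holds s → q.Wp B s Q)
  | loop _ _, _, _ => False

/-- The rule for programs without loops. -/
theorem Runs.straight {B : ℕ} (hB : 2 ≤ B) {P : Program} {s : State} {T : ℤ} {Q : State → Prop}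
    (hsm : P.small = true) (hT : (P.maxCost : ℤ) ≤ T) (hQ : P.Wp B s Q) : Runs B P s T Q := by
  intro hs
  suffices h : ∃ s' t, Exec (B ^ 10) P s s' t ∧ t ≤ P.maxCost ∧ Bounded B s' ∧ Q s' by
    obtain ⟨s', t, he, ht, h⟩ := h
    exact ⟨s', t, he, le_trans (by exact_mod_cast ht) hT, h⟩
  clear hT
  induction P generalizing s Q with
  | skip => exact ⟨s, 1, .skip s, le_rfl, hs, hQ⟩
  | set x e =>
    refine ⟨_, _, .set x e s (Expr.small_spec hB hs e hsm).2.2, le_rfl,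
      ⟨fun y => ?_, hs.2⟩, hQ.2⟩
    simp only [State.setReg, Function.update_apply]
    split
    · exact Expr.ValOk.abs_le hB hs hQ.1
    · exact hs.1 y
  | store A e f =>
    simp only [Program.small, Bool.and_eq_true] at hsm
    refine ⟨_, _, .store A e f s (Expr.small_spec hB hs e hsm.1).2.2
      (Expr.small_spec hB hs f hsm.2).2.2, le_rfl, ⟨hs.1, fun A' i => ?_⟩, hQ.2⟩
    simp only [State.setMem, Function.update_apply]
    split
    · simp only [Function.update_apply]
      split
      · exact Expr.ValOk.abs_le hB hs hQ.1
      · exact hs.2 _ i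
    · exact hs.2 A' i
  | seq p q ihp ihq =>
    simp only [Program.small, Bool.and_eq_true] at hsm
    obtain ⟨s', t, he, ht, hb, hq⟩ := ihp hsm.1 hQ hs
    obtain ⟨s'', u, he', hu, hb', hq'⟩ := ihq hsm.2 hq hb
    exact ⟨s'', _, .seq _ _ _ _ _ _ _ he he', by simp only [Program.maxCost]; omega, hb', hq'⟩
  | cond b p q ihp ihq =>
    simp only [Program.small, Bool.and_eq_true] at hsm
    have hf := Test.small_fits hB hs b hsm.1.1
    by_cases h : b.Holds s
    · obtain ⟨s', t, he, ht, hb⟩ := ihp hsm.1.2 (hQ.1 h) hs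
      exact ⟨s', _, .cond_true _ _ _ _ _ _ hf h he, by simp only [Program.maxCost]; omega, hb⟩
    · obtain ⟨s', t, he, ht, hb⟩ := ihq hsm.2 (hQ.2 h) hs
      exact ⟨s', _, .cond_false _ _ _ _ _ _ hf h he, by simp only [Program.maxCost]; omega, hb⟩
  | loop b p => exact hQ.elim

@[simp]
theorem State.reg_setReg (s : State) (x y : ℕ) (v : ℤ) :
    (s.setReg x v).reg y = if y = x then v else s.reg y := by
  simp [State.setReg, Function.update_apply]

@[simp]
theorem State.mem_setReg (s : State) (x : ℕ) (v : ℤ) : (s.setReg x v).mem = s.mem := rfl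

@[simp]
theorem State.reg_setMem (s : State) (A : ℕ) (i v : ℤ) : (s.setMem A i v).reg = s.reg := rfl

@[simp]
theorem State.mem_setMem (s : State) (A A' : ℕ) (i v : ℤ) :
    (s.setMem A i v).mem A' = if A' = A then Function.update (s.mem A) i v else s.mem A' := by
  by_cases h : A' = A
  · subst h; simp [State.setMem]
  · simp [State.setMem, h]

attribute [simp] Program.Wp Expr.ValOk Expr.eval Test.Holds Test.cost Expr.cost

end WordRAM

namespace DoubleThreshold

/-! ### Tables of walks by number of hops -/

/-- `E` is a relation on the integers `0, …, M - 1` that increases along every related pair. -/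
def IsTopological (E : ℤ → ℤ → Prop) (M : ℤ) : Prop :=
  ∀ i j, E i j → 0 ≤ i ∧ i < j ∧ j < M

/-- The graph `E` on `0, …, M - 1` has a satisfying assignment for the thresholds `(1, r)`. -/
def Sat (E : ℤ → ℤ → Prop) (M : ℤ) (r : ℝ) : Prop :=
  ∃ α : ℤ → ℝ, (∀ i j, E i j → α i + 1 ≤ α j) ∧
    ∀ i j, 0 ≤ i → i < M → 0 ≤ j → j < M → ¬ E i j → α j - r ≤ α i

/-- `D k i` is the largest number of edges of a walk that ends in `i` and has exactly `k` hops, for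
`0 ≤ k ≤ K`. A hop from `j` to `i` is allowed here as soon as `E i j` fails, so that it may also
stay at a vertex or follow an edge. The parent of the pair `(k, i)`, which is encoded as `k * M + i`,
is the pair that precedes it on an optimal walk; walks without edges and hops have no parent. -/
structure IsTable (E : ℤ → ℤ → Prop) (M K : ℤ) (D : ℤ → ℤ → ℤ) (Q : ℤ → ℤ) : Prop where
  nonneg : ∀ k i, 0 ≤ k → k ≤ K → 0 ≤ i → i < M → 0 ≤ D k i
  edge : ∀ k i j, 0 ≤ k → k ≤ K → E i j → D k i + 1 ≤ D k j
  hop : ∀ k i j, 0 ≤ k → k < K → 0 ≤ i → i < M → 0 ≤ j → j < M → ¬ E i j → D k j ≤ D (k + 1) i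
  parent : ∀ k i, 0 ≤ k → k ≤ K → 0 ≤ i → i < M → 0 < D k i + k → ∃ i', 0 ≤ i' ∧ i' < M ∧
    ((Q (k * M + i) = k * M + i' ∧ E i' i ∧ D k i = D k i' + 1) ∨
      (0 < k ∧ Q (k * M + i) = (k - 1) * M + i' ∧ ¬ E i i' ∧ D k i = D (k - 1) i'))

/-- The pair reached from `(k, i)` after `j` steps from parent to parent. -/
def chain (M : ℤ) (Q : ℤ → ℤ) (k i : ℤ) (j : ℕ) : ℤ × ℤ :=
  (Q^[j] (k * M + i) / M, Q^[j] (k * M + i) % M)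

/-- One step of a chain of parents: `x` is a pair, and `y` is its parent. -/
structure IsStep (E : ℤ → ℤ → Prop) (M K : ℤ) (D : ℤ → ℤ → ℤ) (x y : ℤ × ℤ) : Prop where
  layer : 0 ≤ y.1 ∧ y.1 ≤ K
  vertex : 0 ≤ y.2 ∧ y.2 < M
  step : (x.1 = y.1 ∧ E y.2 x.2 ∧ D x.1 x.2 = D y.1 y.2 + 1) ∨
    (x.1 = y.1 + 1 ∧ ¬ E x.2 y.2 ∧ D x.1 x.2 = D y.1 y.2)

theorem pair_div {M k i : ℤ} (h0 : 0 ≤ i) (h1 : i < M) : (k * M + i) / M = k := by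
  rw [add_comm, Int.add_mul_ediv_right _ _ (by omega), Int.ediv_eq_zero_of_lt h0 h1, zero_add]

theorem pair_mod {M k i : ℤ} (h0 : 0 ≤ i) (h1 : i < M) : (k * M + i) % M = i := by
  rw [add_comm, Int.add_mul_emod_self_right, Int.emod_eq_of_lt h0 h1]

section Chain

variable {E : ℤ → ℤ → Prop} {M K : ℤ} {D : ℤ → ℤ → ℤ} {Q : ℤ → ℤ} {k i : ℤ}

theorem chain_zero (h0 : 0 ≤ i) (h1 : i < M) : chain M Q k i 0 = (k, i) := by
  simp [chain, pair_div h0 h1, pair_mod h0 h1]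

theorem chain_encode (M : ℤ) (Q : ℤ → ℤ) (k i : ℤ) (j : ℕ) :
    (chain M Q k i j).1 * M + (chain M Q k i j).2 = Q^[j] (k * M + i) := by
  simp only [chain]
  linarith [Int.mul_ediv_add_emod (Q^[j] (k * M + i)) M]

/-- The number of edges plus the number of hops drops by exactly one from a pair to its parent, so a
chain of parents can be followed as many steps as the optimal walk has. -/
theorem IsTable.chain_spec (h : IsTable E M K D Q) (hk : 0 ≤ k) (hkK : k ≤ K) (h0 : 0 ≤ i)
    (h1 : i < M) (j : ℕ) (hj : (j : ℤ) ≤ D k i + k) :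
    (0 ≤ (chain M Q k i j).1 ∧ (chain M Q k i j).1 ≤ K) ∧
    (0 ≤ (chain M Q k i j).2 ∧ (chain M Q k i j).2 < M) ∧
    D (chain M Q k i j).1 (chain M Q k i j).2 + (chain M Q k i j).1 = D k i + k - j ∧
    ∀ j' < j, IsStep E M K D (chain M Q k i j') (chain M Q k i (j' + 1)) := by
  induction j with
  | zero => rw [chain_zero h0 h1]; simp [*]
  | succ j ih =>
    obtain ⟨hl, hv, hs, hst⟩ := ih (by push_cast at hj; omega)
    obtain ⟨i', hi0, hi1, hp⟩ := h.parent _ _ hl.1 hl.2 hv.1 hv.2 (by push_cast at hj; omega)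
    rw [chain_encode, ← Function.iterate_succ_apply' Q] at hp
    suffices hstep : IsStep E M K D (chain M Q k i j) (chain M Q k i (j + 1)) by
      refine ⟨hstep.layer, hstep.vertex, ?_, fun j' hj' => ?_⟩
      · rcases hstep.step with h | h <;> push_cast <;> omega
      · rcases Nat.lt_succ_iff_lt_or_eq.mp hj' with h | rfl
        · exact hst j' h
        · exact hstep
    rcases hp with ⟨hq, he, hd⟩ | ⟨hk0, hq, he, hd⟩
    · have : chain M Q k i (j + 1) = ((chain M Q k i j).1, i') := by
        rw [chain, hq, pair_div hi0 hi1, pair_mod hi0 hi1]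
      rw [this]
      exact ⟨hl, ⟨hi0, hi1⟩, Or.inl ⟨rfl, he, hd⟩⟩
    · have : chain M Q k i (j + 1) = ((chain M Q k i j).1 - 1, i') := by
        rw [chain, hq, pair_div hi0 hi1, pair_mod hi0 hi1]
      rw [this]
      exact ⟨⟨by simp only; omega, by simp only; omega⟩, ⟨hi0, hi1⟩,
        Or.inr ⟨by simp, he, hd⟩⟩

/-- A walk with at least `M` edges and hops visits a vertex twice within its last `M` steps. -/
theorem IsTable.exists_repeat (h : IsTable E M K D Q) (hk : 0 ≤ k) (hkK : k ≤ K) (h0 : 0 ≤ i)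
    (h1 : i < M) (hM : M ≤ D k i + k) :
    ∃ a b : ℕ, a < b ∧ (b : ℤ) ≤ M ∧ (chain M Q k i a).2 = (chain M Q k i b).2 := by
  have hmem : ∀ j ∈ Finset.range (M.toNat + 1), (chain M Q k i j).2 ∈ Finset.Ico 0 M := by
    intro j hj
    have := (h.chain_spec hk hkK h0 h1 j (by simp only [Finset.mem_range] at hj; omega)).2.1
    simpa using this
  obtain ⟨a, ha, b, hb, hab, heq⟩ := Finset.exists_ne_map_eq_of_card_lt_of_maps_to
    (by simp) hmem
  simp only [Finset.mem_range] at ha hb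
  rcases lt_or_gt_of_ne hab with hlt | hlt
  · exact ⟨a, b, hlt, by omega, heq⟩
  · exact ⟨b, a, hlt, by omega, heq.symm⟩

/-- The closed part of a chain between two visits of the same vertex has at least one hop, and cutting
it out leaves a walk that the table has to account for. -/
theorem IsTable.cut (h : IsTable E M K D Q) (hk : 0 ≤ k) (hkK : k ≤ K) (h0 : 0 ≤ i) (h1 : i < M)
    {a b : ℕ} (hab : a < b) (hb : (b : ℤ) ≤ D k i + k)
    (heq : (chain M Q k i a).2 = (chain M Q k i b).2) :
    let x := chain M Q k i
    let e := D (x a).1 (x a).2 - D (x b).1 (x b).2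
    let l := (x a).1 - (x b).1
    0 < l ∧ l ≤ k ∧ e + l = (b : ℤ) - a ∧ D k i - e ≤ D (k - l) i := by
  intro x e l
  obtain ⟨hbl, hbv, hbs, hst⟩ := h.chain_spec hk hkK h0 h1 b hb
  obtain ⟨hal, hav, has, -⟩ := h.chain_spec hk hkK h0 h1 a (by omega)
  have hmono : ∀ t : ℕ, a + t ≤ b → (x (a + t)).1 ≤ (x a).1 := by
    intro t
    induction t with
    | zero => intro; exact le_rfl
    | succ t ih =>
      intro ht
      have := ih (by omega)
      have hs := (hst (a + t) (by omega)).step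
      rw [add_assoc] at hs
      simp only [x] at this ⊢
      rcases hs with h | h <;> omega
  have hl0 : 0 ≤ l := by
    have := hmono (b - a) (by omega)
    rw [Nat.add_sub_cancel' hab.le] at this
    simp only [l]; omega
  have hel : e + l = (b : ℤ) - a := by simp only [e, l, x]; omega
  have hl : 0 < l := by
    rcases hl0.lt_or_eq with hl | hl
    · exact hl
    · have h1 : (x a).1 = (x b).1 := by simp only [l] at hl; omega
      have : e = 0 := by simp only [e]; rw [h1, show (x a).2 = (x b).2 from heq]; ring
      omega
  -- Going back from position `a` to position `0`, the walk can be lowered by `l` layers.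
  have hshift : ∀ t : ℕ, t ≤ a → (x a).1 ≤ (x (a - t)).1 ∧ (x (a - t)).1 ≤ K ∧
      D (x (a - t)).1 (x (a - t)).2 - e ≤ D ((x (a - t)).1 - l) (x (a - t)).2 := by
    intro t
    induction t with
    | zero =>
      intro _
      refine ⟨le_rfl, hal.2, ?_⟩
      have : (x a).1 - l = (x b).1 := by simp only [l]; ring
      simp only [Nat.sub_zero]
      rw [this]
      simp only [e]
      rw [show (x a).2 = (x b).2 from heq]
      omega
    | succ t ih =>
      intro ht
      obtain ⟨ih1, ih2, ih3⟩ := ih (by omega)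
      have hs := hst (a - (t + 1)) (by omega)
      have hs0 := (h.chain_spec hk hkK h0 h1 (a - (t + 1)) (by omega)).1
      have hsv := (h.chain_spec hk hkK h0 h1 (a - (t + 1)) (by omega)).2.1
      have hix : a - (t + 1) + 1 = a - t := by omega
      rw [hix] at hs
      change 0 ≤ (x (a - (t + 1))).1 ∧ _ at hs0
      change 0 ≤ (x (a - (t + 1))).2 ∧ _ at hsv
      change IsStep E M K D (x (a - (t + 1))) (x (a - t)) at hs
      have hlb : (x a).1 - l = (x b).1 := by simp only [l]; ring
      have hb0 : 0 ≤ (x b).1 := hbl.1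
      have hsv' := hs.vertex
      rcases hs.step with ⟨s1, s2, s3⟩ | ⟨s1, s2, s3⟩
      · have := h.edge ((x (a - t)).1 - l) _ _ (by omega) (by omega) s2
        rw [s1] at s3 hs0 ⊢
        refine ⟨ih1, ih2, by omega⟩
      · have := h.hop ((x (a - t)).1 - l) _ _ (by omega) (by omega) hsv.1 hsv.2 hsv'.1 hsv'.2 s2
        rw [s1] at s3 hs0 ⊢
        rw [show (x (a - t)).1 + 1 - l = (x (a - t)).1 - l + 1 by ring]
        refine ⟨by omega, by omega, by omega⟩
  have hfin := hshift a le_rfl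
  rw [Nat.sub_self, show x 0 = (k, i) from chain_zero h0 h1] at hfin
  have : (x a).1 - l = (x b).1 := by simp only [l]; ring
  have hb0 : 0 ≤ (x b).1 := hbl.1
  exact ⟨hl, by simp only at hfin; omega, hel, hfin.2.2⟩

/-- Every satisfiable ratio is at least the ratio of the closed part of a chain. -/
theorem IsTable.le_of_sat (h : IsTable E M K D Q) (hk : 0 ≤ k) (hkK : k ≤ K) (h0 : 0 ≤ i)
    (h1 : i < M) {a b : ℕ} (hab : a < b) (hb : (b : ℤ) ≤ D k i + k)
    (heq : (chain M Q k i a).2 = (chain M Q k i b).2) {r : ℝ} (hr : Sat E M r) :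
    let x := chain M Q k i
    ((D (x a).1 (x a).2 - D (x b).1 (x b).2 : ℤ) : ℝ) ≤ r * (((x a).1 - (x b).1 : ℤ) : ℝ) := by
  intro x
  obtain ⟨α, hα1, hα2⟩ := hr
  have key : ∀ t : ℕ, a + t ≤ b →
      ((D (x a).1 (x a).2 - D (x (a + t)).1 (x (a + t)).2 : ℤ) : ℝ)
        - r * (((x a).1 - (x (a + t)).1 : ℤ) : ℝ) ≤ α (x a).2 - α (x (a + t)).2 := by
    intro t
    induction t with
    | zero => intro _; simp
    | succ t ih =>
      intro ht
      have ih := ih (by omega)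
      have hs := (h.chain_spec hk hkK h0 h1 b hb).2.2.2 (a + t) (by omega)
      have hv := (h.chain_spec hk hkK h0 h1 (a + t) (by omega)).2.1
      rw [add_assoc] at hs
      change IsStep E M K D (x (a + t)) (x (a + (t + 1))) at hs
      change 0 ≤ (x (a + t)).2 ∧ _ at hv
      have hv' := hs.vertex
      rcases hs.step with ⟨s1, s2, s3⟩ | ⟨s1, s2, s3⟩
      · have := hα1 _ _ s2
        rw [s3, s1] at ih
        push_cast at ih ⊢
        linarith
      · have := hα2 _ _ hv.1 hv.2 hv'.1 hv'.2 s2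
        rw [s3, s1] at ih
        push_cast at ih ⊢
        linarith
  have := key (b - a) (by omega)
  rw [Nat.add_sub_cancel' hab.le, show (x a).2 = (x b).2 from heq] at this
  rw [show (x a).2 = (x b).2 from heq]
  linarith

/-- The maxima of `q * D k i - p * k` over `0 ≤ k < K` satisfy the thresholds `(q, p)`, if for every
vertex one of the slopes into the last layer `K` is at most `p / q`: the layer `K` then adds nothing
to the maxima. -/
theorem IsTable.satisfying (hE : IsTopological E M) (h : IsTable E M K D Q) {p q : ℤ} (hq : 0 ≤ q)
    (hpq : ∀ i, 0 ≤ i → i < M → ∃ k, 0 ≤ k ∧ k < K ∧ (D K i - D k i) * q ≤ p * (K - k))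
    {α : ℤ → ℤ} (hα : ∀ i, 0 ≤ i → i < M →
      (∃ k, 0 ≤ k ∧ k < K ∧ α i = q * D k i - p * k) ∧
        ∀ k, 0 ≤ k → k < K → q * D k i - p * k ≤ α i) :
    (∀ i j, E i j → α i + q ≤ α j) ∧
      ∀ i j, 0 ≤ i → i < M → 0 ≤ j → j < M → ¬ E i j → α j - p ≤ α i := by
  constructor
  · intro i j hij
    obtain ⟨h0, hlt, h1⟩ := hE i j hij
    obtain ⟨⟨k, hk0, hk1, hk⟩, -⟩ := hα i h0 (by omega)
    have := (hα j (by omega) h1).2 k hk0 hk1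
    have := h.edge k i j hk0 hk1.le hij
    nlinarith
  · intro i j hi0 hi1 hj0 hj1 hij
    obtain ⟨⟨k, hk0, hk1, hk⟩, -⟩ := hα j hj0 hj1
    have hhop := h.hop k i j hk0 hk1 hi0 hi1 hj0 hj1 hij
    suffices q * D (k + 1) i - p * (k + 1) ≤ α i by nlinarith
    rcases (show k + 1 ≤ K by omega).lt_or_eq with hlt | heq
    · exact (hα i hi0 hi1).2 (k + 1) (by omega) hlt
    · obtain ⟨k', hk'0, hk'1, hk'⟩ := hpq i hi0 hi1
      have := (hα i hi0 hi1).2 k' hk'0 hk'1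
      rw [heq]
      nlinarith

/-- A ratio that bounds one of the slopes into the last layer at every vertex is satisfiable. -/
theorem IsTable.sat (hE : IsTopological E M) (h : IsTable E M K D Q) {p q : ℤ} (hq : 0 < q)
    (hpq : ∀ i, 0 ≤ i → i < M → ∃ k, 0 ≤ k ∧ k < K ∧ (D K i - D k i) * q ≤ p * (K - k))
    (hK : 0 < K) : Sat E M ((p : ℝ) / q) := by
  have hne : (Finset.Ico 0 K).Nonempty := ⟨0, by simp [hK]⟩
  obtain ⟨h1, h2⟩ := h.satisfying hE hq.le hpq
    (α := fun i => (Finset.Ico 0 K).sup' hne fun k => q * D k i - p * k) (by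
      intro i _ _
      constructor
      · obtain ⟨k, hk, hk'⟩ := Finset.exists_mem_eq_sup' hne fun k => q * D k i - p * k
        exact ⟨k, by simpa using (Finset.mem_Ico.mp hk).1, (Finset.mem_Ico.mp hk).2, hk'⟩
      · intro k hk0 hk1
        exact Finset.le_sup' (fun k => q * D k i - p * k) (by simp [hk0, hk1]))
  have hq' : (0 : ℝ) < q := by exact_mod_cast hq
  refine ⟨fun i => (((Finset.Ico 0 K).sup' hne fun k => q * D k i - p * k : ℤ) : ℝ) / q, ?_, ?_⟩
  · intro i j hij
    have : (_ : ℝ) ≤ _ := Int.cast_le.mpr (h1 i j hij)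
    rw [Int.cast_add] at this
    rw [div_add_one hq'.ne']
    exact (div_le_div_iff_of_pos_right hq').mpr this
  · intro i j hi0 hi1 hj0 hj1 hij
    have : (_ : ℝ) ≤ _ := Int.cast_le.mpr (h2 i j hi0 hi1 hj0 hj1 hij)
    rw [Int.cast_sub] at this
    rw [← sub_div]
    exact (div_le_div_iff_of_pos_right hq').mpr this

/-- `lam` is the infimum of the satisfiable ratios; that it is the greatest lower bound is only
expressed for the fractions `e / l`. -/
structure IsRatioInf (E : ℤ → ℤ → Prop) (M : ℤ) (lam : ℝ) : Prop where
  nonneg : 0 ≤ lam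
  le : ∀ r, Sat E M r → lam ≤ r
  ge : ∀ e l : ℤ, 0 < l → (∀ r, Sat E M r → (e : ℝ) ≤ r * l) → (e : ℝ) ≤ lam * l

/-- An optimal walk consists of closed parts, of ratio at most `lam`, and of a simple path. -/
theorem IsTable.le_mul_add (h : IsTable E M K D Q) {lam : ℝ} (hlam : IsRatioInf E M lam)
    (hk : 0 ≤ k) (hkK : k ≤ K) (h0 : 0 ≤ i) (h1 : i < M) : (D k i : ℝ) ≤ lam * k + M := by
  obtain ⟨n, rfl⟩ := Int.eq_ofNat_of_zero_le hk
  induction n using Nat.strong_induction_on with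
  | _ n ih =>
    by_cases hM : M ≤ D n i + n
    · obtain ⟨a, b, hab, hb, heq⟩ := h.exists_repeat hk hkK h0 h1 hM
      obtain ⟨hl, hlk, -, hcut⟩ := h.cut hk hkK h0 h1 hab (by omega) heq
      have hle := hlam.ge _ _ hl fun r hr => h.le_of_sat hk hkK h0 h1 hab (by omega) heq hr
      generalize D (chain M Q n i a).1 (chain M Q n i a).2 -
        D (chain M Q n i b).1 (chain M Q n i b).2 = e at *
      generalize (chain M Q n i a).1 - (chain M Q n i b).1 = l at *
      have hn : ((n - l.toNat : ℕ) : ℤ) = n - l := by omega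
      have := ih (n - l.toNat) (by omega) (by omega) (by omega)
      rw [hn] at this
      have hcut' : (D n i : ℝ) - e ≤ D (n - l) i := by exact_mod_cast hcut
      push_cast at this ⊢
      linarith
    · have hD : D n i + n ≤ M := by omega
      have hD' : (D n i : ℝ) + n ≤ M := by exact_mod_cast hD
      have := mul_nonneg hlam.nonneg (Nat.cast_nonneg (α := ℝ) n)
      push_cast
      linarith [(Nat.cast_nonneg n : (0 : ℝ) ≤ n)]

end Chain

open WordRAM

/-! ### Relaxation of a layer along the edges -/

infixr:60 " ;; " => Program.seq

/-- Increment a register. -/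
def incr (x : ℕ) : Program := .set x (.add (.reg x) (.const 1))

/-- The address of the entry for the vertex `e` in the layer given by register `9`. -/
def entry (e : Expr) : Expr := .add (.mul (.reg 9) (.reg 6)) e

/-- The edges of `E`, on the vertices `0, …, M - 1`, are the pairs `(T c, H c)` for `0 ≤ c < mm`, sorted
by their tails and followed by a sentinel. -/
structure IsSortedEdges (E : ℤ → ℤ → Prop) (M mm : ℤ) (T H : ℤ → ℤ) : Prop where
  topo : IsTopological E M
  nonneg : 0 ≤ mm
  iff : ∀ i j, E i j ↔ ∃ c, 0 ≤ c ∧ c < mm ∧ T c = i ∧ H c = j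
  sorted : ∀ c c', 0 ≤ c → c ≤ c' → c' ≤ mm → T c ≤ T c'
  sentinel : T mm = M

/-- The state holds the sorted edges of a graph. -/
structure HasGraph (M mm : ℤ) (T H : ℤ → ℤ) (s : State) : Prop where
  reg6 : s.reg 6 = M
  reg8 : s.reg 8 = mm
  mem8 : s.mem 8 = H
  mem19 : s.mem 19 = T

theorem IsSortedEdges.range {E : ℤ → ℤ → Prop} {M mm : ℤ} {T H : ℤ → ℤ}
    (h : IsSortedEdges E M mm T H) {c : ℤ} (h0 : 0 ≤ c) (h1 : c < mm) :
    0 ≤ T c ∧ T c < H c ∧ H c < M :=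
  h.topo _ _ ((h.iff _ _).mpr ⟨c, h0, h1, rfl, rfl⟩)

@[simp]
theorem hasGraph_setReg {M mm v : ℤ} {T H : ℤ → ℤ} {s : State} {x : ℕ} (h6 : 6 ≠ x) (h8 : 8 ≠ x) :
    HasGraph M mm T H (s.setReg x v) ↔ HasGraph M mm T H s :=
  ⟨fun h => ⟨by simpa [h6] using h.reg6, by simpa [h8] using h.reg8, h.mem8, h.mem19⟩,
    fun h => ⟨by simpa [h6] using h.reg6, by simpa [h8] using h.reg8, h.mem8, h.mem19⟩⟩

@[simp]
theorem hasGraph_setMem {M mm i v : ℤ} {T H : ℤ → ℤ} {s : State} {A : ℕ} (h8 : 8 ≠ A)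
    (h19 : 19 ≠ A) : HasGraph M mm T H (s.setMem A i v) ↔ HasGraph M mm T H s :=
  ⟨fun h => ⟨h.reg6, h.reg8, by simpa [h8] using h.mem8, by simpa [h19] using h.mem19⟩,
    fun h => ⟨h.reg6, h.reg8, by simpa [h8] using h.mem8, by simpa [h19] using h.mem19⟩⟩

theorem HasGraph.frame {M mm : ℤ} {T H : ℤ → ℤ} {s s' : State} {P : Program}
    (h : HasGraph M mm T H s) (hf : Frame P s s')
    (hP : (P.writesReg 6 || P.writesReg 8 || P.writesMem 8 || P.writesMem 19) = false := by rfl) :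
    HasGraph M mm T H s' := by
  simp only [Bool.or_eq_false_iff] at hP
  exact ⟨(hf.1 6 hP.1.1.1).trans h.reg6, (hf.1 8 hP.1.1.2).trans h.reg8,
    (hf.2 8 hP.1.2).trans h.mem8, (hf.2 19 hP.2).trans h.mem19⟩

/-- Process the edges in topological order and raise the entry of the head of each edge above the
entry of its tail. -/
def relax : Program :=
  .set 11 (.const 0) ;;
  .loop (.lt (.reg 11) (.reg 8))
    (.set 13 (entry (.get 19 (.reg 11))) ;;
     .set 14 (entry (.get 8 (.reg 11))) ;;
     .cond (.lt (.get 11 (.reg 14)) (.add (.get 11 (.reg 13)) (.const 1)))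
       (.store 11 (.reg 14) (.add (.get 11 (.reg 13)) (.const 1)) ;;
        .store 12 (.reg 14) (.reg 13))
       .skip ;;
     incr 11)

/-- The entries `D` and parents `Q` of a layer with addresses from `o` on, where the edges with
numbers below `c` have been processed, starting from the entries `D₀` and the parents `Q₀`. -/
structure Relaxed (M o b₀ c : ℤ) (T H D₀ Q₀ D Q : ℤ → ℤ) : Prop where
  outside : ∀ x, x < o ∨ o + M ≤ x → D x = D₀ x ∧ Q x = Q₀ x
  ge : ∀ i, 0 ≤ i → i < M → D₀ (o + i) ≤ D (o + i)
  edge : ∀ c', 0 ≤ c' → c' < c → D (o + T c') + 1 ≤ D (o + H c')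
  parent : ∀ i, 0 ≤ i → i < M → (D (o + i) = D₀ (o + i) ∧ Q (o + i) = Q₀ (o + i)) ∨
    ∃ c', 0 ≤ c' ∧ c' < c ∧ H c' = i ∧ D (o + i) = D (o + T c') + 1 ∧ Q (o + i) = o + T c'
  le : ∀ i, 0 ≤ i → i < M → D (o + i) ≤ b₀ + i

/-- Raising the head of the edge `c` does not affect the entries of the tails of the edges up to `c`:
the tails are sorted, and edges lead upward. Hence one pass over the edges suffices. -/
theorem Relaxed.step {E : ℤ → ℤ → Prop} {M mm o b₀ c : ℤ} {T H D₀ Q₀ D Q : ℤ → ℤ}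
    (hG : IsSortedEdges E M mm T H) (h : Relaxed M o b₀ c T H D₀ Q₀ D Q) (h0 : 0 ≤ c)
    (h1 : c < mm) (hlt : D (o + H c) < D (o + T c) + 1) :
    Relaxed M o b₀ (c + 1) T H D₀ Q₀ (Function.update D (o + H c) (D (o + T c) + 1))
      (Function.update Q (o + H c) (o + T c)) := by
  obtain ⟨hc1, hc2, hc3⟩ := hG.range h0 h1
  have hT : ∀ c', 0 ≤ c' → c' < c + 1 → T c' < H c := fun c' h0' h1' =>
    lt_of_le_of_lt (hG.sorted c' c h0' (by omega) h1.le) hc2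
  constructor
  · intro x hx
    rw [Function.update_of_ne (by omega), Function.update_of_ne (by omega)]
    exact h.outside x hx
  · intro i hi0 hi1
    have := h.ge i hi0 hi1
    by_cases hi : i = H c
    · subst hi; simp; omega
    · rwa [Function.update_of_ne (by omega)]
  · intro c' h0' h1'
    have := hT c' h0' h1'
    rw [Function.update_of_ne (show o + T c' ≠ o + H c by omega)]
    by_cases hi : H c' = H c
    · rw [hi, Function.update_self]
      rcases (show c' ≤ c by omega).lt_or_eq with hlt' | rfl
      · have := h.edge c' h0' hlt'
        rw [hi] at this
        omega
      · omega
    · have hne : c' ≠ c := fun h => hi (by rw [h])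
      rw [Function.update_of_ne (by omega)]
      exact h.edge c' h0' (by omega)
  · intro i hi0 hi1
    by_cases hi : i = H c
    · refine Or.inr ⟨c, h0, by omega, hi.symm, ?_, ?_⟩
      · rw [hi, Function.update_self, Function.update_of_ne (by omega)]
      · rw [hi, Function.update_self]
    · rw [Function.update_of_ne (show o + i ≠ o + H c by omega),
        Function.update_of_ne (show o + i ≠ o + H c by omega)]
      refine (h.parent i hi0 hi1).imp_right ?_
      rintro ⟨c', h0', h1', h⟩
      have := hT c' h0' (by omega)
      refine ⟨c', h0', by omega, ?_⟩
      rwa [Function.update_of_ne (by omega)]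
  · intro i hi0 hi1
    by_cases hi : i = H c
    · rw [hi, Function.update_self]
      have := h.le (T c) hc1 (by omega)
      omega
    · rw [Function.update_of_ne (by omega)]
      exact h.le i hi0 hi1

theorem Relaxed.skip {M o b₀ c : ℤ} {T H D₀ Q₀ D Q : ℤ → ℤ}
    (h : Relaxed M o b₀ c T H D₀ Q₀ D Q) (hle : D (o + T c) + 1 ≤ D (o + H c)) :
    Relaxed M o b₀ (c + 1) T H D₀ Q₀ D Q where
  outside := h.outside
  ge := h.ge
  edge c' h0 h1 := by
    rcases (show c' ≤ c by omega).lt_or_eq with hlt | rfl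
    · exact h.edge c' h0 hlt
    · exact hle
  parent i hi0 hi1 := (h.parent i hi0 hi1).imp_right fun ⟨c', h0, h1, h⟩ =>
    ⟨c', h0, by omega, h⟩
  le := h.le

theorem runs_relax {B : ℕ} {E : ℤ → ℤ → Prop} {M mm K b₀ : ℤ} {T H : ℤ → ℤ} {s : State}
    (hB : 2 ≤ B) (hG : IsSortedEdges E M mm T H) (hs : HasGraph M mm T H s) (hK : s.reg 9 = K)
    (hK0 : 0 ≤ K) (hD : ∀ i, 0 ≤ i → i < M → 0 ≤ s.mem 11 (K * M + i) ∧ s.mem 11 (K * M + i) ≤ b₀)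
    (hB1 : (K + 1) * M ≤ B) (hB2 : b₀ + M ≤ B) (hB3 : mm ≤ B) :
    Runs B relax s (100 * (mm + 1)) fun s' =>
      Relaxed M (K * M) b₀ mm T H (s.mem 11) (s.mem 12) (s'.mem 11) (s'.mem 12) := by
  have hmm := hG.nonneg
  refine Runs.seq (T₁ := 5) (T₂ := 100 * mm + 90) (Q := fun s' => s'.reg 11 = 0 ∧ s'.mem = s.mem)
    (Runs.straight hB rfl (by decide) (by simp)) ?_ (by linarith)
  rintro s₁ - hf₁ ⟨h11, hmem⟩
  refine (Runs.loop hB (φ := 100 * mm) (fun φ u => ∃ c, φ = 100 * (mm - c) ∧ 0 ≤ c ∧ c ≤ mm ∧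
    u.reg 11 = c ∧ HasGraph M mm T H u ∧ u.reg 9 = K ∧
    Relaxed M (K * M) b₀ c T H (s.mem 11) (s.mem 12) (u.mem 11) (u.mem 12)) rfl ?_ ?_ ?_ ?_).mono
    le_rfl ?_
  · rintro φ u ⟨c, rfl, h0, h1, -⟩
    linarith
  · rintro φ u hb ⟨c, rfl, h0, h1, hc, hg, h9, hr⟩ hlt
    simp only [Test.Holds, Expr.eval, hc, hg.reg8] at hlt
    obtain ⟨hc1, hc2, hc3⟩ := hG.range h0 hlt
    refine ⟨80, Runs.straight hB rfl (by decide) ?_⟩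
    have hKM : 0 ≤ K * M := mul_nonneg hK0 (by omega)
    have hle := hr.le _ hc1 (by omega)
    have hge := hr.ge _ hc1 (by omega)
    have hnn := (hD _ hc1 (by omega)).1
    simp [incr, entry, hc, hg.reg6, hg.mem8, hg.mem19, h9]
    simp only [abs_le, hg, true_and]
    refine ⟨by constructor <;> linarith, by constructor <;> linarith, fun hlt' => ?_,
      fun hlt' => ?_⟩
    · exact ⟨by constructor <;> linarith, by constructor <;> linarith, by linarith, by linarith,
        by linarith, hr.step hG h0 hlt (by omega)⟩
    · exact ⟨by constructor <;> linarith, by linarith, by linarith, by linarith,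
        hr.skip (by omega)⟩
  · exact ⟨0, by ring, le_rfl, hmm, h11, hs.frame hf₁, (hf₁.1 9 rfl).trans hK, by
      rw [hmem]
      exact ⟨fun _ _ => ⟨rfl, rfl⟩, fun _ _ _ => le_rfl, by omega, fun _ _ _ => .inl ⟨rfl, rfl⟩,
        fun i h0 h1 => by linarith [(hD i h0 h1).2]⟩⟩
  · simp
  · rintro s' - - ⟨φ, ⟨c, -, h0, h1, hc, hg, -, hr⟩, hnot⟩
    simp only [Test.Holds, Expr.eval, hc, hg.reg8, not_lt] at hnot
    rwa [show c = mm by omega] at hr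

/-! ### Linked lists and bucket sort -/

/-- Following the links `nx` from `h` yields the list; a link is one more than the element it points
to, and the link `0` ends the list. -/
def Linked (nx : ℤ → ℤ) : ℤ → List ℤ → Prop
  | h, [] => h = 0
  | h, i :: l => h = i + 1 ∧ Linked nx (nx i) l

theorem Linked.update {nx : ℤ → ℤ} {h i v : ℤ} {l : List ℤ} (hl : Linked nx h l) (hi : i ∉ l) :
    Linked (Function.update nx i v) h l := by
  induction l generalizing h with
  | nil => exact hl
  | cons j l ih =>
    simp only [List.mem_cons, not_or] at hi
    refine ⟨hl.1, ?_⟩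
    rw [Function.update_of_ne (Ne.symm hi.1)]
    exact ih hl.2 hi.2

theorem Linked.eq_nil {nx : ℤ → ℤ} {l : List ℤ} (hl : Linked nx 0 l) (h0 : ∀ i ∈ l, 0 ≤ i) :
    l = [] := by
  cases l with
  | nil => rfl
  | cons i l =>
    have := h0 i (by simp)
    have := hl.1
    omega

theorem Linked.exists_cons {nx : ℤ → ℤ} {h : ℤ} {l : List ℤ} (hl : Linked nx h l) (h0 : h ≠ 0) :
    ∃ l', l = (h - 1) :: l' ∧ Linked nx (nx (h - 1)) l' := by
  cases l with
  | nil => exact absurd hl h0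
  | cons i l =>
    obtain ⟨rfl, h2⟩ := hl
    exact ⟨l, by simp, by simpa using h2⟩

theorem le_of_injective {S : ℤ → ℤ} {y M : ℤ} (hM : 0 ≤ M)
    (hmem : ∀ t, 0 ≤ t → t < y → 0 ≤ S t ∧ S t < M)
    (hinj : ∀ t t', 0 ≤ t → t < t' → t' < y → S t ≠ S t') : y ≤ M := by
  have h := Finset.card_le_card_of_injOn (s := Finset.Ico 0 y) (t := Finset.Ico 0 M) S
    (fun t ht => by
      simp only [Finset.coe_Ico, Set.mem_Ico] at ht ⊢
      exact hmem t ht.1 ht.2)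
    (fun t ht t' ht' heq => by
      simp only [Finset.coe_Ico, Set.mem_Ico] at ht ht'
      by_contra hne
      rcases lt_or_gt_of_ne hne with h | h
      · exact hinj t t' ht.1 h ht'.2 heq
      · exact hinj t' t ht'.1 h ht.2 heq.symm)
  simp at h
  omega

/-- `S` lists `0, …, M - 1` by decreasing values of `d`. -/
structure IsSorting (M : ℤ) (d S : ℤ → ℤ) : Prop where
  mem : ∀ t, 0 ≤ t → t < M → 0 ≤ S t ∧ S t < M
  inj : ∀ t t', 0 ≤ t → t < t' → t' < M → S t ≠ S t'
  surj : ∀ i, 0 ≤ i → i < M → ∃ t, 0 ≤ t ∧ t < M ∧ S t = i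
  anti : ∀ t t', 0 ≤ t → t < t' → t' < M → d (S t') ≤ d (S t)

/-- The bucket of `x` is the list `L x`; together they hold the vertices below `j`. -/
structure Filled (j : ℤ) (d hd nx : ℤ → ℤ) (L : ℤ → List ℤ) : Prop where
  linked : ∀ x, Linked nx (hd x) (L x)
  nodup : ∀ x, (L x).Nodup
  mem : ∀ x i, i ∈ L x ↔ 0 ≤ i ∧ i < j ∧ d i = x

theorem Filled.step {j : ℤ} {d hd nx : ℤ → ℤ} {L : ℤ → List ℤ} (h : Filled j d hd nx L)
    (hj : 0 ≤ j) : Filled (j + 1) d (Function.update hd (d j) (j + 1))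
      (Function.update nx j (hd (d j))) (Function.update L (d j) (j :: L (d j))) := by
  have hnot : ∀ x, j ∉ L x := fun x hx => by have := ((h.mem x j).mp hx).2.1; omega
  refine ⟨fun x => ?_, fun x => ?_, fun x i => ?_⟩ <;> by_cases hx : x = d j
  · subst hx
    simp only [Function.update_self, Linked, true_and]
    exact (h.linked _).update (hnot _)
  · rw [Function.update_of_ne hx, Function.update_of_ne hx]
    exact (h.linked x).update (hnot x)
  · subst hx
    simpa using ⟨hnot _, h.nodup _⟩
  · rw [Function.update_of_ne hx]
    exact h.nodup x
  · subst hx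
    simp only [Function.update_self, List.mem_cons, h.mem]
    constructor
    · rintro (rfl | h) <;> omega
    · rintro ⟨h0, h1, h2⟩; omega
  · rw [Function.update_of_ne hx, h.mem]
    constructor
    · omega
    · rintro ⟨h0, h1, h2⟩
      have : i ≠ j := fun h => hx (by rw [← h2, h])
      omega

/-- The state of the bucket sort when `y` vertices have been listed and the buckets above `x` are
empty. -/
structure Popped (M x y : ℤ) (d hd nx S : ℤ → ℤ) (L : ℤ → List ℤ) : Prop where
  linked : ∀ x, Linked nx (hd x) (L x)
  nodup : ∀ x, (L x).Nodup
  mem : ∀ x i, i ∈ L x → 0 ≤ i ∧ i < M ∧ d i = x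
  empty : ∀ x', x < x' → L x' = []
  listed : ∀ t, 0 ≤ t → t < y → 0 ≤ S t ∧ S t < M ∧ S t ∉ L (d (S t)) ∧ x ≤ d (S t)
  surj : ∀ i, 0 ≤ i → i < M → i ∈ L (d i) ∨ ∃ t, 0 ≤ t ∧ t < y ∧ S t = i
  inj : ∀ t t', 0 ≤ t → t < t' → t' < y → S t ≠ S t'
  anti : ∀ t t', 0 ≤ t → t < t' → t' < y → d (S t') ≤ d (S t)

theorem Popped.step {M x y : ℤ} {d hd nx S : ℤ → ℤ} {L : ℤ → List ℤ}
    (h : Popped M x y d hd nx S L) (hy : 0 ≤ y) (hx : hd x ≠ 0) :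
    ∃ L', Popped M x (y + 1) d (Function.update hd x (nx (hd x - 1))) nx
      (Function.update S y (hd x - 1)) L' := by
  obtain ⟨l, hl, hlink⟩ := (h.linked x).exists_cons hx
  have hnd := h.nodup x
  rw [hl, List.nodup_cons] at hnd
  obtain ⟨hv0, hv1, hvx⟩ := h.mem x (hd x - 1) (by simp [hl])
  generalize hd x - 1 = v at *
  have hsub : ∀ x' i, i ∈ Function.update L x l x' → i ∈ L x' := by
    intro x' i hi
    by_cases hx' : x' = x
    · subst hx'
      rw [Function.update_self] at hi
      simp [hl, hi]
    · rwa [Function.update_of_ne hx'] at hi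
  have hS : ∀ t, 0 ≤ t → t < y + 1 → t = y ∨ (t < y ∧ Function.update S y v t = S t) := by
    intro t h0 h1
    by_cases ht : t = y
    · exact .inl ht
    · exact .inr ⟨by omega, Function.update_of_ne ht _ _⟩
  have hSy : Function.update S y v y = v := Function.update_self _ _ _
  have hne : ∀ t, 0 ≤ t → t < y → S t ≠ v := by
    rintro t h0 h1 rfl
    have := (h.listed t h0 h1).2.2.1
    rw [hvx, hl] at this
    simp at this
  refine ⟨Function.update L x l, ?_, ?_, fun x' i hi => h.mem x' i (hsub x' i hi), ?_, ?_, ?_, ?_, ?_⟩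
  · intro x'
    by_cases hx' : x' = x
    · subst hx'; simpa using hlink
    · rw [Function.update_of_ne hx', Function.update_of_ne hx']
      exact h.linked x'
  · intro x'
    by_cases hx' : x' = x
    · subst hx'; simpa using hnd.2
    · rw [Function.update_of_ne hx']
      exact h.nodup x'
  · intro x' hx'
    rw [Function.update_of_ne (by omega)]
    exact h.empty x' hx'
  · intro t h0 h1
    rcases hS t h0 h1 with rfl | ⟨h1, ht⟩
    · rw [hSy, hvx, Function.update_self]
      exact ⟨hv0, hv1, hnd.1, le_rfl⟩
    · rw [ht]
      obtain ⟨h2, h3, h4, h5⟩ := h.listed t h0 h1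
      exact ⟨h2, h3, fun h => h4 (hsub _ _ h), h5⟩
  · intro i hi0 hi1
    by_cases hi : i = v
    · subst hi
      exact .inr ⟨y, hy, by omega, hSy⟩
    · rcases h.surj i hi0 hi1 with hi' | ⟨t, h0, h1, ht⟩
      · left
        by_cases hx' : d i = x
        · rw [hx', Function.update_self]
          rw [hx', hl] at hi'
          simpa [hi] using hi'
        · rwa [Function.update_of_ne hx']
      · refine .inr ⟨t, h0, by omega, ?_⟩
        rw [Function.update_of_ne (by omega), ht]
  · intro t t' h0 h1 h2
    rcases hS t h0 (by omega) with rfl | ⟨h3, ht⟩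
    · omega
    rcases hS t' (by omega) h2 with rfl | ⟨h4, ht'⟩
    · rw [ht, hSy]; exact hne t h0 h3
    · rw [ht, ht']; exact h.inj t t' h0 h1 h4
  · intro t t' h0 h1 h2
    rcases hS t h0 (by omega) with rfl | ⟨h3, ht⟩
    · omega
    rcases hS t' (by omega) h2 with rfl | ⟨h4, ht'⟩
    · rw [ht, hSy, hvx]; exact (h.listed t h0 h3).2.2.2
    · rw [ht, ht']; exact h.anti t t' h0 h1 h4

/-- Put every vertex into the bucket of its entry in the layer of register `9`; register `15` receives
the largest entry. -/
def fillBuckets : Program :=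
  .set 11 (.const 0) ;;
  .set 15 (.const 0) ;;
  .loop (.lt (.reg 11) (.reg 6))
    (.set 13 (.get 11 (entry (.reg 11))) ;;
     .store 14 (.reg 11) (.get 13 (.reg 13)) ;;
     .store 13 (.reg 13) (.add (.reg 11) (.const 1)) ;;
     .cond (.lt (.reg 15) (.reg 13)) (.set 15 (.reg 13)) .skip ;;
     incr 11)

/-- List the contents of the buckets from the highest bucket down, and empty them. -/
def popBuckets : Program :=
  .set 16 (.const 0) ;;
  .loop (.le (.const 0) (.reg 15))
    (.cond (.eq (.get 13 (.reg 15)) (.const 0))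
      (.set 15 (.sub (.reg 15) (.const 1)))
      (.set 13 (.sub (.get 13 (.reg 15)) (.const 1)) ;;
       .store 15 (.reg 16) (.reg 13) ;;
       .store 13 (.reg 15) (.get 14 (.reg 13)) ;;
       incr 16))

theorem runs_fillBuckets {B : ℕ} {M K b₀ : ℤ} {s : State} (hB : 2 ≤ B) (h6 : s.reg 6 = M)
    (hM : 0 ≤ M) (hK : s.reg 9 = K) (hbuckets : ∀ x, s.mem 13 x = 0) (hMB : M ≤ B) (hb₀ : 0 ≤ b₀)
    (hD : ∀ i, 0 ≤ i → i < M → 0 ≤ s.mem 11 (K * M + i) ∧ s.mem 11 (K * M + i) ≤ b₀) :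
    Runs B fillBuckets s (100 * (M + 1)) fun s' => 0 ≤ s'.reg 15 ∧ s'.reg 15 ≤ b₀ ∧
      (∀ i, 0 ≤ i → i < M → s.mem 11 (K * M + i) ≤ s'.reg 15) ∧
      ∃ L, Filled M (fun i => s.mem 11 (K * M + i)) (s'.mem 13) (s'.mem 14) L := by
  refine Runs.seq (T₁ := 5) (T₂ := 100 * M + 90) (Q := fun s' => s'.reg 11 = 0 ∧ s'.mem = s.mem)
    (Runs.straight hB rfl (by decide) (by simp)) ?_ (by linarith)
  rintro s₀ - hf₀ ⟨h11, hmem⟩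
  refine Runs.seq (T₁ := 5) (T₂ := 100 * M + 80) (Q := fun s' => s'.reg 15 = 0 ∧ s'.mem = s.mem)
    (Runs.straight hB rfl (by decide) (by simp [hmem])) ?_ (by linarith)
  rintro s₁ - hf₁ ⟨h15, hmem⟩
  refine (Runs.loop hB (φ := 100 * M) (fun φ u => ∃ c, φ = 100 * (M - c) ∧ 0 ≤ c ∧ c ≤ M ∧
    u.reg 11 = c ∧ u.reg 6 = M ∧ u.reg 9 = K ∧ u.mem 11 = s.mem 11 ∧
    0 ≤ u.reg 15 ∧ u.reg 15 ≤ b₀ ∧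
    (∀ i, 0 ≤ i → i < c → s.mem 11 (K * M + i) ≤ u.reg 15) ∧
    ∃ L, Filled c (fun i => s.mem 11 (K * M + i)) (u.mem 13) (u.mem 14) L) rfl ?_ ?_ ?_ ?_).mono
    le_rfl ?_
  · rintro φ u ⟨c, rfl, h0, h1, -⟩
    linarith
  · rintro φ u hb ⟨c, rfl, h0, h1, hc, hM6, h9, hm, hr0, hr1, hr2, L, hL⟩ hlt
    simp only [Test.Holds, Expr.eval, hc, hM6] at hlt
    refine ⟨80, Runs.straight hB rfl (by decide) ?_⟩
    simp [incr, entry, hc, hM6, hm, h9]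
    have hD' := hD c h0 hlt
    have hstep := hL.step h0
    have hsplit : ∀ i, i ≤ c → i < c ∨ i = c := by omega
    have habs : |c + 1| ≤ (B : ℤ) := abs_le.mpr ⟨by linarith, by linarith⟩
    refine ⟨habs, fun hlt' => ⟨habs,
      by linarith, by linarith, hlt, hD'.1, hD'.2, fun i hi0 hi1 => ?_, _, hstep⟩,
      fun hlt' => ⟨habs,
      by linarith, by linarith, hlt, hr0, hr1, fun i hi0 hi1 => ?_, _, hstep⟩⟩
    · rcases hsplit i hi1 with h | rfl
      · linarith [hr2 i hi0 h]
      · exact le_rfl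
    · rcases hsplit i hi1 with h | rfl
      · linarith [hr2 i hi0 h]
      · exact hlt'
  · refine ⟨0, by ring, le_rfl, hM, ?_, ?_, ?_, ?_, h15.ge, by omega, by omega, fun _ => [], ?_⟩
    · rw [hf₁.1 11 rfl, h11]
    · rw [hf₁.1 6 rfl, hf₀.1 6 rfl, h6]
    · rw [hf₁.1 9 rfl, hf₀.1 9 rfl, hK]
    · rw [hmem]
    · rw [hmem]
      exact ⟨fun x => hbuckets x, by simp, by simp; omega⟩
  · simp
  · rintro s' - - ⟨φ, ⟨c, -, h0, h1, hc, hM6, -, -, hr0, hr1, hr2, hL⟩, hnot⟩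
    simp only [Test.Holds, Expr.eval, hc, hM6, not_lt] at hnot
    obtain rfl : c = M := by omega
    exact ⟨hr0, hr1, hr2, hL⟩

theorem runs_popBuckets {B : ℕ} {M b₀ : ℤ} {d : ℤ → ℤ} {L : ℤ → List ℤ} {s : State} (hB : 2 ≤ B)
    (hM : 0 ≤ M) (hMB : M ≤ B) (h15 : 0 ≤ s.reg 15) (h15b : s.reg 15 ≤ b₀)
    (hd : ∀ i, 0 ≤ i → i < M → 0 ≤ d i ∧ d i ≤ s.reg 15)
    (hL : Filled M d (s.mem 13) (s.mem 14) L) :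
    Runs B popBuckets s (100 * (M + b₀ + 2)) fun s' =>
      (∀ x, s'.mem 13 x = 0) ∧ IsSorting M d (s'.mem 15) := by
  refine Runs.seq (T₁ := 5) (T₂ := 100 * (M + b₀ + 1) + 90)
    (Q := fun s' => s'.reg 16 = 0 ∧ s'.mem = s.mem)
    (Runs.straight hB rfl (by decide) (by simp)) ?_ (by linarith)
  rintro s₁ - hf₁ ⟨h16, hmem⟩
  have hr15 := hf₁.1 15 rfl
  refine (Runs.loop hB (φ := 100 * (M + s.reg 15 + 1)) (fun φ u => ∃ y, φ = 100 * (M - y + u.reg 15 + 1) ∧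
    0 ≤ y ∧ -1 ≤ u.reg 15 ∧ u.reg 16 = y ∧
    ∃ L, Popped M (u.reg 15) y d (u.mem 13) (u.mem 14) (u.mem 15) L) rfl ?_ ?_ ?_ ?_).mono
    le_rfl ?_
  · rintro φ u ⟨y, rfl, h0, h1, -, L, hL⟩
    have := le_of_injective hM (fun t h0 h1 => ⟨(hL.listed t h0 h1).1, (hL.listed t h0 h1).2.1⟩) hL.inj
    linarith
  · rintro φ u hb ⟨y, rfl, h0, h1, hy, L, hL⟩ hlt
    simp only [Test.Holds, Expr.eval] at hlt
    have hle := le_of_injective hM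
      (fun t h0 h1 => ⟨(hL.listed t h0 h1).1, (hL.listed t h0 h1).2.1⟩) hL.inj
    have hu := abs_le.mp (hb.1 15)
    have hu' := abs_le.mp (hb.2 13 (u.reg 15))
    refine ⟨80, Runs.straight hB rfl (by decide) ?_⟩
    simp [incr, hy]
    refine ⟨fun hz => ⟨abs_le.mpr ⟨by linarith, by linarith⟩, by linarith, h0, hlt, ?_⟩,
      fun hz => ?_⟩
    · have hnil : L (u.reg 15) = [] :=
        Linked.eq_nil (by simpa [hz] using hL.linked (u.reg 15)) fun i hi => (hL.mem _ i hi).1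
      refine ⟨L, hL.linked, hL.nodup, hL.mem, fun x hx => ?_, fun t h0 h1 => ?_, hL.surj, hL.inj,
        hL.anti⟩
      · rcases (show u.reg 15 ≤ x by omega).lt_or_eq with h | rfl
        · exact hL.empty x h
        · exact hnil
      · obtain ⟨h2, h3, h4, h5⟩ := hL.listed t h0 h1
        exact ⟨h2, h3, h4, by omega⟩
    · obtain ⟨L', hL'⟩ := hL.step h0 hz
      have hle' := le_of_injective hM
        (fun t h0 h1 => ⟨(hL'.listed t h0 h1).1, (hL'.listed t h0 h1).2.1⟩) hL'.inj
      obtain ⟨l, hl, -⟩ := (hL.linked (u.reg 15)).exists_cons hz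
      have hv := hL.mem (u.reg 15) (u.mem 13 (u.reg 15) - 1) (by simp [hl])
      exact ⟨abs_le.mpr ⟨by linarith, by linarith⟩, abs_le.mpr ⟨by linarith, by linarith⟩,
        by linarith, by linarith, by linarith, L', hL'⟩
  · refine ⟨0, by rw [hr15]; ring, le_rfl, by omega, h16, L, ?_⟩
    rw [hmem, hr15]
    refine ⟨hL.linked, hL.nodup, fun x i hi => (hL.mem x i).mp hi, fun x hx => ?_, by omega, ?_,
      by omega, by omega⟩
    · rw [List.eq_nil_iff_forall_not_mem]
      intro i hi
      obtain ⟨h0, h1, rfl⟩ := (hL.mem x i).mp hi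
      have := hd i h0 h1
      omega
    · exact fun i h0 h1 => .inl ((hL.mem _ i).mpr ⟨h0, h1, rfl⟩)
  · simp; linarith
  · rintro s' - - ⟨φ, ⟨y, -, h0, h1, hy, L, hL⟩, hnot⟩
    simp only [Test.Holds, Expr.eval, not_le] at hnot
    have hx : s'.reg 15 = -1 := by omega
    rw [hx] at hL
    have hnil : ∀ x, L x = [] := by
      intro x
      rcases lt_or_ge x 0 with h | h
      · rw [List.eq_nil_iff_forall_not_mem]
        intro i hi
        obtain ⟨h0, h1, rfl⟩ := hL.mem x i hi
        have := hd i h0 h1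
        omega
      · exact hL.empty x (by omega)
    have hsurj : ∀ i, 0 ≤ i → i < M → ∃ t, 0 ≤ t ∧ t < y ∧ s'.mem 15 t = i := by
      intro i h0 h1
      simpa [hnil] using hL.surj i h0 h1
    have hyM : y = M := by
      refine le_antisymm (le_of_injective hM
        (fun t h0 h1 => ⟨(hL.listed t h0 h1).1, (hL.listed t h0 h1).2.1⟩) hL.inj) ?_
      choose! t ht0 ht1 ht2 using hsurj
      refine le_of_injective h0 (S := t) (fun i hi0 hi1 => ⟨ht0 i hi0 hi1, ht1 i hi0 hi1⟩)
        fun i i' hi0 hlt hi1 heq => ?_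
      have := ht2 i hi0 (by omega)
      rw [heq, ht2 i' (by omega) hi1] at this
      omega
    subst hyM
    refine ⟨fun x => by simpa [hnil, Linked] using hL.linked x, fun t h0 h1 => ?_, hL.inj, hsurj,
      hL.anti⟩
    exact ⟨(hL.listed t h0 h1).1, (hL.listed t h0 h1).2.1⟩

/-! ### The hop step between two layers -/

/-- Mark the heads of the edges with tail in register `11`, from the edge in register `17` on. -/
def markHeads : Program :=
  .loop (.eq (.get 19 (.reg 17)) (.reg 11))
    (.store 16 (.get 8 (.reg 17)) (.add (.reg 11) (.const 1)) ;; incr 17)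

/-- Advance register `18` to the first unmarked vertex of the sorted list. -/
def scanMarked : Program :=
  .set 18 (.const 0) ;;
  .loop (.eq (.get 16 (.get 15 (.reg 18))) (.add (.reg 11) (.const 1))) (incr 18)

/-- Set every entry of the next layer to the largest entry of the layer in register `9` over the
vertices from which there is a hop. -/
def hopStep : Program :=
  .set 11 (.const 0) ;;
  .set 17 (.const 0) ;;
  .loop (.lt (.reg 11) (.reg 6))
    (markHeads ;;
     scanMarked ;;
     .set 13 (entry (.get 15 (.reg 18))) ;;
     .set 14 (.add (entry (.reg 11)) (.reg 6)) ;;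
     .store 11 (.reg 14) (.get 11 (.reg 13)) ;;
     .store 12 (.reg 14) (.reg 13) ;;
     incr 11)

/-- A mark `i + 1` at `w` is only left if `w` is the head of an edge from `i`, so marks never have to
be removed. -/
def MarksSound (E : ℤ → ℤ → Prop) (mk : ℤ → ℤ) : Prop :=
  ∀ w i, 0 ≤ i → mk w = i + 1 → E i w

/-- `cut i` is the number of edges whose tail is below `i`. -/
def IsCut (M mm : ℤ) (T cut : ℤ → ℤ) : Prop :=
  ∀ i, 0 ≤ i → i ≤ M → (0 ≤ cut i ∧ cut i ≤ mm) ∧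
    ∀ c, 0 ≤ c → c < mm → (c < cut i ↔ T c < i)

theorem IsSortedEdges.exists_cut {E : ℤ → ℤ → Prop} {M mm : ℤ} {T H : ℤ → ℤ}
    (h : IsSortedEdges E M mm T H) : ∃ cut, IsCut M mm T cut := by
  suffices hc : ∀ i, ∃ c, 0 ≤ i → i ≤ M → (0 ≤ c ∧ c ≤ mm) ∧
      ∀ c', 0 ≤ c' → c' < mm → (c' < c ↔ T c' < i) by
    choose cut hcut using hc
    exact ⟨cut, hcut⟩
  intro i
  by_cases hi : i ≤ M
  · obtain ⟨c, ⟨hc0, hc1⟩, hmin⟩ := Int.exists_least_of_bdd (P := fun c => 0 ≤ c ∧ i ≤ T c)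
      ⟨0, fun z hz => hz.1⟩ ⟨mm, h.nonneg, by rw [h.sentinel]; exact hi⟩
    have hle := hmin mm ⟨h.nonneg, by rw [h.sentinel]; exact hi⟩
    refine ⟨c, fun _ _ => ⟨⟨hc0, hle⟩, fun c' h0 h1 => ⟨fun hlt => ?_, fun hlt => ?_⟩⟩⟩
    · by_contra hge
      have := hmin c' ⟨h0, by omega⟩
      omega
    · by_contra hge
      have := h.sorted c c' hc0 (by omega) h1.le
      omega
  · exact ⟨0, fun _ h => absurd h hi⟩

theorem IsCut.le_succ {M mm i : ℤ} {T cut : ℤ → ℤ} (h : IsCut M mm T cut) (h0 : 0 ≤ i)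
    (h1 : i < M) : cut i ≤ cut (i + 1) := by
  by_contra hlt
  obtain ⟨⟨a0, a1⟩, a2⟩ := h i h0 h1.le
  obtain ⟨⟨b0, b1⟩, b2⟩ := h (i + 1) (by omega) (by omega)
  have h1 := a2 (cut (i + 1)) b0 (by omega)
  have h2 := b2 (cut (i + 1)) b0 (by omega)
  omega

theorem runs_markHeads {B : ℕ} {E : ℤ → ℤ → Prop} {M mm i : ℤ} {T H cut : ℤ → ℤ} {s : State}
    (hB : 2 ≤ B) (hG : IsSortedEdges E M mm T H) (hs : HasGraph M mm T H s)
    (hcut : IsCut M mm T cut) (h0 : 0 ≤ i) (h1 : i < M) (h11 : s.reg 11 = i)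
    (h17 : s.reg 17 = cut i) (hmk : MarksSound E (s.mem 16)) (hMB : M ≤ B) (hmB : mm ≤ B) :
    Runs B markHeads s (50 * (cut (i + 1) - cut i) + 10) fun s' =>
      s'.reg 17 = cut (i + 1) ∧ MarksSound E (s'.mem 16) ∧
      ∀ w, s'.mem 16 w = i + 1 ↔ E i w := by
  obtain ⟨⟨a0, a1⟩, a2⟩ := hcut i h0 h1.le
  obtain ⟨⟨b0, b1⟩, b2⟩ := hcut (i + 1) (by omega) (by omega)
  have hle := hcut.le_succ h0 h1
  refine (Runs.loop hB (φ := 50 * (cut (i + 1) - cut i)) (fun φ u => ∃ c,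
    φ = 50 * (cut (i + 1) - c) ∧ cut i ≤ c ∧ c ≤ cut (i + 1) ∧ u.reg 17 = c ∧ u.reg 11 = i ∧
    HasGraph M mm T H u ∧ MarksSound E (u.mem 16) ∧
    ∀ c', 0 ≤ c' → c' < c → T c' = i → u.mem 16 (H c') = i + 1) rfl ?_ ?_ ?_ ?_).mono le_rfl ?_
  · rintro φ u ⟨c, rfl, -, hc1, -⟩
    linarith
  · rintro φ u hb ⟨c, rfl, hc0, hc1, hc, hi, hg, hm, hmark⟩ hh
    simp only [Test.Holds, Expr.eval, hc, hi, hg.mem19] at hh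
    have hlt : c < mm := by
      rcases (hc1.trans b1).lt_or_eq with h | rfl
      · exact h
      · rw [hG.sentinel] at hh; omega
    have hlt' : c < cut (i + 1) := (b2 c (by omega) hlt).mpr (by omega)
    refine ⟨40, Runs.straight hB rfl (by decide) ?_⟩
    simp [incr, hc, hi, hg.mem8, hg]
    refine ⟨abs_le.mpr ⟨by linarith, by linarith⟩, abs_le.mpr ⟨by linarith, by linarith⟩,
      by linarith, by linarith, by linarith, fun w j hj hw => ?_, fun c' h0' h1' hT => ?_⟩
    · by_cases hwc : w = H c
      · subst hwc
        rw [Function.update_self] at hw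
        rw [hG.iff]
        exact ⟨c, by omega, hlt, by omega, rfl⟩
      · rw [Function.update_of_ne hwc] at hw
        exact hm w j hj hw
    · rw [Function.update_apply]
      split
      · rfl
      · refine hmark c' h0' ?_ hT
        rcases h1'.lt_or_eq with h | rfl
        · exact h
        · contradiction
  · refine ⟨cut i, rfl, le_rfl, hle, h17, h11, hs, hmk, fun c' h0' h1' hT => ?_⟩
    have := (a2 c' h0' (by omega)).mp h1'
    omega
  · simp
  · rintro s' - - ⟨φ, ⟨c, -, hc0, hc1, hc, hi, hg, hm, hmark⟩, hnot⟩
    simp only [Test.Holds, Expr.eval, hc, hi, hg.mem19] at hnot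
    have hceq : c = cut (i + 1) := by
      by_contra hne
      have hcm : c < mm := by omega
      have h1 := (b2 c (by omega) hcm).mp (by omega)
      have h2 := a2 c (by omega) hcm
      omega
    subst hceq
    refine ⟨hc, hm, fun w => ⟨hm w i h0, fun hw => ?_⟩⟩
    obtain ⟨c', h0', h1', hT, rfl⟩ := (hG.iff _ _).mp hw
    exact hmark c' h0' ((b2 c' h0' h1').mpr (by omega)) hT

/-- The scan stops after at most as many steps as there are edges with tail `i`, so that the scans for
all vertices together take linear time. -/
theorem runs_scanMarked {B : ℕ} {E : ℤ → ℤ → Prop} {M mm i : ℤ} {T H cut d : ℤ → ℤ} {s : State}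
    (hB : 2 ≤ B) (hG : IsSortedEdges E M mm T H) (hS : IsSorting M d (s.mem 15))
    (hcut : IsCut M mm T cut) (h0 : 0 ≤ i) (h1 : i < M) (h11 : s.reg 11 = i)
    (hmk : ∀ w, s.mem 16 w = i + 1 ↔ E i w) (hMB : M ≤ B) :
    Runs B scanMarked s (50 * (cut (i + 1) - cut i) + 30) fun s' =>
      0 ≤ s.mem 15 (s'.reg 18) ∧ s.mem 15 (s'.reg 18) < M ∧ ¬ E i (s.mem 15 (s'.reg 18)) ∧
      ∀ j, 0 ≤ j → j < M → ¬ E i j → d j ≤ d (s.mem 15 (s'.reg 18)) := by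
  obtain ⟨⟨a0, a1⟩, a2⟩ := hcut i h0 h1.le
  obtain ⟨⟨b0, b1⟩, b2⟩ := hcut (i + 1) (by omega) (by omega)
  have hle := hcut.le_succ h0 h1
  obtain ⟨t₀, ht0, ht1, ht⟩ := hS.surj i h0 h1
  have hirr : ¬ E i i := fun h => by have := hG.topo _ _ h; omega
  have hxt : ∀ x, (∀ t, 0 ≤ t → t < x → E i (s.mem 15 t)) → x ≤ t₀ := by
    intro x hx
    by_contra hlt
    have := hx t₀ ht0 (by omega)
    rw [ht] at this
    exact hirr this
  -- The vertices that are skipped are heads of different edges with tail `i`.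
  have hbound : ∀ x, (∀ t, 0 ≤ t → t < x → E i (s.mem 15 t)) → x ≤ cut (i + 1) - cut i := by
    intro x hx
    have hxt := hxt x hx
    have : ∀ t, ∃ c, 0 ≤ t → t < x → 0 ≤ c ∧ c < mm ∧ T c = i ∧ H c = s.mem 15 t := by
      intro t
      by_cases h : 0 ≤ t ∧ t < x
      · obtain ⟨c, hc⟩ := (hG.iff _ _).mp (hx t h.1 h.2)
        exact ⟨c, fun _ _ => hc⟩
      · exact ⟨0, fun h1 h2 => absurd ⟨h1, h2⟩ h⟩
    choose f hf using this
    refine le_of_injective (S := fun t => f t - cut i) (by omega) (fun t h0 h1 => ?_)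
      fun t t' h0 hlt h1 heq => ?_
    · obtain ⟨c0, c1, c2, -⟩ := hf t h0 h1
      have h1 := a2 _ c0 c1
      have h2 := b2 _ c0 c1
      constructor <;> omega
    · have e1 := (hf t h0 (by omega)).2.2.2
      have e2 := (hf t' (by omega) h1).2.2.2
      simp only [sub_left_inj] at heq
      rw [heq, e2] at e1
      exact hS.inj t t' h0 hlt (by omega) e1.symm
  refine Runs.seq (T₁ := 5) (T₂ := 50 * (cut (i + 1) - cut i) + 20)
    (Q := fun s' => s'.reg 18 = 0) (Runs.straight hB rfl (by decide) (by simp)) ?_ (by linarith)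
  rintro s₁ - hf₁ h18
  refine (Runs.loop hB (φ := 50 * (cut (i + 1) - cut i)) (fun φ u => ∃ x,
    φ = 50 * (cut (i + 1) - cut i - x) ∧ 0 ≤ x ∧ u.reg 18 = x ∧ u.reg 11 = i ∧
    u.mem = s.mem ∧ ∀ t, 0 ≤ t → t < x → E i (s.mem 15 t)) rfl ?_ ?_ ?_ ?_).mono le_rfl ?_
  · rintro φ u ⟨x, rfl, hx0, -, -, -, hx⟩
    linarith [hbound x hx]
  · rintro φ u hb ⟨x, rfl, hx0, hxu, hi, hmem, hx⟩ hh
    simp only [Test.Holds, Expr.eval, hxu, hi, hmem, hmk] at hh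
    have hx' : ∀ t, 0 ≤ t → t < x + 1 → E i (s.mem 15 t) := by
      intro t h0 h1
      rcases (show t ≤ x by omega).lt_or_eq with h | rfl
      · exact hx t h0 h
      · exact hh
    have := hxt _ hx'
    refine ⟨20, Runs.straight hB rfl (by decide) ?_⟩
    simp only [incr, Program.Wp, Expr.ValOk, Expr.eval, State.reg_setReg, State.mem_setReg, hxu]
    exact ⟨abs_le.mpr ⟨by linarith, by linarith⟩, _, by simp; linarith, x + 1, rfl, by omega,
      by simp, by simpa using hi, hmem, hx'⟩
  · exact ⟨0, by ring, le_rfl, h18, (hf₁.1 11 rfl).trans h11,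
      funext fun A => hf₁.2 A rfl, by omega⟩
  · simp
  · rintro s' - - ⟨φ, ⟨x, -, hx0, hxu, hi, hmem, hx⟩, hnot⟩
    simp only [Test.Holds, Expr.eval, hxu, hi, hmem, hmk] at hnot
    have hxt := hxt x hx
    obtain ⟨m0, m1⟩ := hS.mem x hx0 (by omega)
    rw [hxu]
    refine ⟨m0, m1, hnot, fun j j0 j1 hj => ?_⟩
    obtain ⟨t, t0, t1, rfl⟩ := hS.surj j j0 j1
    rcases lt_trichotomy x t with h | rfl | h
    · exact hS.anti x t hx0 h t1
    · exact le_rfl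
    · exact absurd (hx t t0 h) hj

/-- The entries and parents of the layer with addresses from `o + M` on, for the vertices below `i`,
come from optimal hops out of the layer at `o`. -/
structure Hopped (E : ℤ → ℤ → Prop) (M o i : ℤ) (D₀ Q₀ D Q : ℤ → ℤ) : Prop where
  outside : ∀ x, x < o + M ∨ o + M + M ≤ x → D x = D₀ x ∧ Q x = Q₀ x
  hop : ∀ j, 0 ≤ j → j < i → ∃ w, 0 ≤ w ∧ w < M ∧ ¬ E j w ∧ D (o + M + j) = D₀ (o + w) ∧
    Q (o + M + j) = o + w ∧ ∀ j', 0 ≤ j' → j' < M → ¬ E j j' → D₀ (o + j') ≤ D₀ (o + w)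

theorem Hopped.step {E : ℤ → ℤ → Prop} {M o i w : ℤ} {D₀ Q₀ D Q : ℤ → ℤ}
    (h : Hopped E M o i D₀ Q₀ D Q) (h0 : 0 ≤ i) (h1 : i < M) (hw0 : 0 ≤ w) (hw1 : w < M)
    (hw : ¬ E i w) (hmax : ∀ j', 0 ≤ j' → j' < M → ¬ E i j' → D₀ (o + j') ≤ D₀ (o + w)) :
    Hopped E M o (i + 1) D₀ Q₀ (Function.update D (o + i + M) (D (o + w)))
      (Function.update Q (o + i + M) (o + w)) := by
  constructor
  · intro x hx
    rw [Function.update_of_ne (by omega), Function.update_of_ne (by omega)]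
    exact h.outside x hx
  · intro j hj0 hj1
    rcases (show j ≤ i by omega).lt_or_eq with hj | rfl
    · rw [Function.update_of_ne (by omega), Function.update_of_ne (by omega)]
      exact h.hop j hj0 hj
    · rw [show o + M + j = o + j + M by ring, Function.update_self, Function.update_self]
      exact ⟨w, hw0, hw1, hw, (h.outside _ (by omega)).1, rfl, hmax⟩

theorem runs_hopStep {B : ℕ} {E : ℤ → ℤ → Prop} {M mm K : ℤ} {T H : ℤ → ℤ} {s : State}
    (hB : 2 ≤ B) (hG : IsSortedEdges E M mm T H) (hs : HasGraph M mm T H s) (hK : s.reg 9 = K)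
    (hM : 0 ≤ M) (hK0 : 0 ≤ K) (hS : IsSorting M (fun i => s.mem 11 (K * M + i)) (s.mem 15))
    (hmk : MarksSound E (s.mem 16)) (hKB : (K + 2) * M ≤ B) (hmB : mm ≤ B) :
    Runs B hopStep s (250 * (M + mm + 1)) fun s' => MarksSound E (s'.mem 16) ∧
      Hopped E M (K * M) M (s.mem 11) (s.mem 12) (s'.mem 11) (s'.mem 12) := by
  obtain ⟨cut, hcut⟩ := hG.exists_cut
  have hKM : 0 ≤ K * M := mul_nonneg hK0 hM
  have hMB : M ≤ B := by linarith
  have hc0 : cut 0 = 0 := by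
    obtain ⟨⟨a0, a1⟩, a2⟩ := hcut 0 le_rfl hM
    by_contra hne
    have := (a2 0 le_rfl (by omega)).mp (by omega)
    have := (hG.range le_rfl (c := 0) (by omega)).1
    omega
  have hcM := fun i h0 h1 => (hcut i h0 h1).1
  refine Runs.seq (T₁ := 5) (T₂ := 250 * (M + mm) + 200)
    (Q := fun s' => s'.reg 11 = 0 ∧ s'.mem = s.mem)
    (Runs.straight hB rfl (by decide) (by simp)) ?_ (by linarith)
  rintro s₀ - hf₀ ⟨h11, hmem⟩
  refine Runs.seq (T₁ := 5) (T₂ := 250 * (M + mm) + 190)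
    (Q := fun s' => s'.reg 17 = 0 ∧ s'.mem = s.mem)
    (Runs.straight hB rfl (by decide) (by simp [hmem])) ?_ (by linarith)
  rintro s₁ - hf₁ ⟨h17, hmem⟩
  refine (Runs.loop hB (φ := 250 * (M + mm)) (fun φ u => ∃ i,
    φ = 250 * (M - i + (mm - cut i)) ∧ 0 ≤ i ∧ i ≤ M ∧ u.reg 11 = i ∧ u.reg 17 = cut i ∧
    u.reg 9 = K ∧ HasGraph M mm T H u ∧ MarksSound E (u.mem 16) ∧ u.mem 15 = s.mem 15 ∧
    Hopped E M (K * M) i (s.mem 11) (s.mem 12) (u.mem 11) (u.mem 12)) rfl ?_ ?_ ?_ ?_).mono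
    le_rfl ?_
  · rintro φ u ⟨i, rfl, h0, h1, -⟩
    linarith [(hcM i h0 h1).2]
  · rintro φ u hb ⟨i, rfl, h0, -, hi, hci, h9, hg, hm, h15, hh⟩ h1
    simp only [Test.Holds, Expr.eval, hi, hg.reg6] at h1
    refine ⟨100 * (cut (i + 1) - cut i) + 150, ?_⟩
    have hle := hcut.le_succ h0 h1
    refine Runs.seq (runs_markHeads hB hG hg hcut h0 h1 hi hci hm hMB hmB) ?_
      (T₂ := 50 * (cut (i + 1) - cut i) + 140) (by linarith)
    rintro u₁ - hu₁ ⟨hci', hm', hmk'⟩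
    have h15' : u₁.mem 15 = s.mem 15 := (hu₁.2 15 rfl).trans h15
    refine Runs.seq (runs_scanMarked hB hG (h15' ▸ hS) hcut h0 h1 ((hu₁.1 11 rfl).trans hi) hmk'
      hMB) ?_ (T₂ := 110) (by linarith)
    rintro u₂ - hu₂ ⟨hw0, hw1, hw, hmax⟩
    refine Runs.straight hB rfl (by decide) ?_
    have e11 : u₂.reg 11 = i := by rw [hu₂.1 11 rfl, hu₁.1 11 rfl, hi]
    have e9 : u₂.reg 9 = K := by rw [hu₂.1 9 rfl, hu₁.1 9 rfl, h9]
    have e17 : u₂.reg 17 = cut (i + 1) := by rw [hu₂.1 17 rfl, hci']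
    have eg : HasGraph M mm T H u₂ := (hg.frame hu₁).frame hu₂
    have em11 : u₂.mem 11 = u.mem 11 := by rw [hu₂.2 11 rfl, hu₁.2 11 rfl]
    have em12 : u₂.mem 12 = u.mem 12 := by rw [hu₂.2 12 rfl, hu₁.2 12 rfl]
    have em15 : u₂.mem 15 = s.mem 15 := by rw [hu₂.2 15 rfl, h15']
    have em16 : u₂.mem 16 = u₁.mem 16 := hu₂.2 16 rfl
    rw [h15'] at hw0 hw1 hw hmax
    have hst := hh.step h0 h1 hw0 hw1 hw hmax
    simp [incr, entry, e11, e9, e17, eg.reg6, em11, em12, em15, em16, eg]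
    exact ⟨abs_le.mpr ⟨by linarith, by linarith⟩, abs_le.mpr ⟨by linarith, by linarith⟩,
      abs_le.mpr ⟨by linarith, by linarith⟩, by linarith, by linarith, h1, hm', hst⟩
  · refine ⟨0, by rw [hc0]; ring, le_rfl, hM, ?_, by rw [hc0, h17], ?_,
      (hs.frame hf₀).frame hf₁, by rwa [hmem], by rw [hmem], ?_⟩
    · rw [hf₁.1 11 rfl, h11]
    · rw [hf₁.1 9 rfl, hf₀.1 9 rfl, hK]
    · rw [hmem]
      exact ⟨fun _ _ => ⟨rfl, rfl⟩, by omega⟩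
  · simp
  · rintro s' - - ⟨φ, ⟨i, -, h0, h1, hi, -, -, hg, hm, -, hh⟩, hnot⟩
    simp only [Test.Holds, Expr.eval, hi, hg.reg6, not_lt] at hnot
    obtain rfl : i = M := by omega
    exact ⟨hm, hh⟩

/-! ### Computing the table layer by layer -/

/-- The state holds the sorted edges of a graph and the layers `0, …, K` of its table; the buckets are
empty and the marks are sound. -/
structure HasTable (E : ℤ → ℤ → Prop) (M mm K : ℤ) (T H : ℤ → ℤ) (s : State) : Prop where
  graph : HasGraph M mm T H s
  reg9 : s.reg 9 = K
  table : IsTable E M K (fun k i => s.mem 11 (k * M + i)) (s.mem 12)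
  buckets : ∀ x, s.mem 13 x = 0
  marks : MarksSound E (s.mem 16)

/-- Compute one more layer. -/
def nextLayer : Program :=
  fillBuckets ;; popBuckets ;; hopStep ;; incr 9 ;; relax

theorem pair_lt {M K k i : ℤ} (hk : k ≤ K) (hi0 : 0 ≤ i) (hi : i < M) :
    k * M + i < (K + 1) * M := by
  nlinarith [mul_le_mul_of_nonneg_right hk (by omega : 0 ≤ M)]

theorem Relaxed.isTable_zero {E : ℤ → ℤ → Prop} {M mm b₀ : ℤ} {T H D₀ Q₀ D Q : ℤ → ℤ}
    (hG : IsSortedEdges E M mm T H) (hD₀ : ∀ x, D₀ x = 0)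
    (h : Relaxed M (0 * M) b₀ mm T H D₀ Q₀ D Q) :
    IsTable E M 0 (fun k i => D (k * M + i)) Q where
  nonneg k i hk0 hk1 hi0 hi1 := by
    obtain rfl : k = 0 := by omega
    simpa [hD₀] using h.ge i hi0 hi1
  edge k i j hk0 hk1 hij := by
    obtain rfl : k = 0 := by omega
    obtain ⟨c, h0, h1, rfl, rfl⟩ := (hG.iff _ _).mp hij
    exact h.edge c h0 h1
  hop k i j hk0 hk1 := by omega
  parent k i hk0 hk1 hi0 hi1 hpos := by
    obtain rfl : k = 0 := by omega
    rcases h.parent i hi0 hi1 with ⟨hd, -⟩ | ⟨c, h0, h1, rfl, hd, hq⟩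
    · rw [hD₀] at hd
      simp only [hd] at hpos
      omega
    · obtain ⟨r0, r1, r2⟩ := hG.range h0 h1
      exact ⟨T c, r0, by omega, .inl ⟨hq, (hG.iff _ _).mpr ⟨c, h0, h1, rfl, rfl⟩, hd⟩⟩

/-- A hop step followed by a relaxation extends the table by one layer. -/
theorem IsTable.succ {E : ℤ → ℤ → Prop} {M mm K b₀ : ℤ} {T H D₀ Q₀ D₁ Q₁ D Q : ℤ → ℤ}
    (hG : IsSortedEdges E M mm T H) (hK : 0 ≤ K)
    (h₀ : IsTable E M K (fun k i => D₀ (k * M + i)) Q₀)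
    (h₁ : Hopped E M (K * M) M D₀ Q₀ D₁ Q₁)
    (h : Relaxed M ((K + 1) * M) b₀ mm T H D₁ Q₁ D Q) :
    IsTable E M (K + 1) (fun k i => D (k * M + i)) Q := by
  have hold : ∀ k i, k ≤ K → 0 ≤ i → i < M →
      D (k * M + i) = D₀ (k * M + i) ∧ Q (k * M + i) = Q₀ (k * M + i) := by
    intro k i hk hi0 hi1
    have hlt := pair_lt hk hi0 hi1
    obtain ⟨e1, e2⟩ := h.outside _ (.inl hlt)
    obtain ⟨e3, e4⟩ := h₁.outside (k * M + i) (.inl (by linarith))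
    exact ⟨e1.trans e3, e2.trans e4⟩
  have hsplit : ∀ k, k ≤ K + 1 → k ≤ K ∨ k = K + 1 := by omega
  have hhop := h₁.hop
  simp only [show K * M + M = (K + 1) * M by ring] at hhop
  constructor
  · intro k i hk0 hk1 hi0 hi1
    rcases hsplit k hk1 with hk | rfl
    · rw [(hold k i hk hi0 hi1).1]
      exact h₀.nonneg k i hk0 hk hi0 hi1
    · obtain ⟨w, w0, w1, -, hd, -⟩ := hhop i hi0 hi1
      have := h.ge i hi0 hi1
      have := h₀.nonneg K w hK le_rfl w0 w1
      omega
  · intro k i j hk0 hk1 hij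
    rcases hsplit k hk1 with hk | rfl
    · obtain ⟨r0, r1, r2⟩ := hG.topo _ _ hij
      rw [(hold k i hk r0 (by omega)).1, (hold k j hk (by omega) r2).1]
      exact h₀.edge k i j hk0 hk hij
    · obtain ⟨c, h0, h1, rfl, rfl⟩ := (hG.iff _ _).mp hij
      exact h.edge c h0 h1
  · intro k i j hk0 hk1 hi0 hi1 hj0 hj1 hij
    rcases (show k ≤ K by omega).lt_or_eq with hk | rfl
    · rw [(hold k j hk.le hj0 hj1).1, (hold (k + 1) i (by omega) hi0 hi1).1]
      exact h₀.hop k i j hk0 hk hi0 hi1 hj0 hj1 hij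
    · obtain ⟨w, w0, w1, -, hd, -, hmax⟩ := hhop i hi0 hi1
      have := h.ge i hi0 hi1
      have := hmax j hj0 hj1 hij
      rw [(hold k j le_rfl hj0 hj1).1]
      omega
  · intro k i hk0 hk1 hi0 hi1 hpos
    rcases hsplit k hk1 with hk | rfl
    · rw [(hold k i hk hi0 hi1).1] at hpos
      obtain ⟨i', h0', h1', hp⟩ := h₀.parent k i hk0 hk hi0 hi1 hpos
      refine ⟨i', h0', h1', ?_⟩
      rw [(hold k i hk hi0 hi1).1, (hold k i hk hi0 hi1).2, (hold k i' hk h0' h1').1,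
        (hold (k - 1) i' (by omega) h0' h1').1]
      exact hp
    · rcases h.parent i hi0 hi1 with ⟨hd, hq⟩ | ⟨c, h0, h1, rfl, hd, hq⟩
      · obtain ⟨w, w0, w1, hw, hdw, hqw, -⟩ := hhop i hi0 hi1
        refine ⟨w, w0, w1, .inr ⟨by omega, ?_, hw, ?_⟩⟩
        · rw [hq, hqw, add_sub_cancel_right]
        · rw [hd, hdw, add_sub_cancel_right, (hold K w le_rfl w0 w1).1]
      · obtain ⟨r0, r1, r2⟩ := hG.range h0 h1
        exact ⟨T c, r0, by omega, .inl ⟨hq, (hG.iff _ _).mpr ⟨c, h0, h1, rfl, rfl⟩, hd⟩⟩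

/-- The time for a layer is linear in the size of the graph and in the largest entry `b₀`, because the
entries are sorted by buckets. -/
theorem runs_nextLayer {B : ℕ} {E : ℤ → ℤ → Prop} {M mm K b₀ : ℤ} {T H : ℤ → ℤ} {s : State}
    (hB : 2 ≤ B) (hG : IsSortedEdges E M mm T H) (hs : HasTable E M mm K T H s) (hM : 0 ≤ M)
    (hK0 : 0 ≤ K) (hb₀ : 0 ≤ b₀) (hD : ∀ i, 0 ≤ i → i < M → s.mem 11 (K * M + i) ≤ b₀)
    (hKB : (K + 2) * M ≤ B) (hKB' : K + 1 ≤ B) (hbB : b₀ + M ≤ B) (hmB : mm ≤ B) :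
    Runs B nextLayer s (1000 * (M + mm + b₀ + 1)) (HasTable E M mm (K + 1) T H) := by
  have hmm := hG.nonneg
  have hMB : M ≤ B := by linarith
  have hD' : ∀ i, 0 ≤ i → i < M → 0 ≤ s.mem 11 (K * M + i) ∧ s.mem 11 (K * M + i) ≤ b₀ :=
    fun i h0 h1 => ⟨hs.table.nonneg K i hK0 le_rfl h0 h1, hD i h0 h1⟩
  refine Runs.seq (runs_fillBuckets hB hs.graph.reg6 hM hs.reg9 hs.buckets hMB hb₀ hD')
    (T₂ := 800 * (M + mm + b₀ + 1)) ?_ (by linarith)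
  rintro s₁ - f₁ ⟨hr0, hr1, hr2, L, hL⟩
  refine Runs.seq (runs_popBuckets hB hM hMB hr0 hr1
    (fun i h0 h1 => ⟨(hD' i h0 h1).1, hr2 i h0 h1⟩) hL)
    (T₂ := 600 * (M + mm + b₀ + 1)) ?_ (by linarith)
  rintro s₂ - f₂ ⟨hbk, hS⟩
  have e11 : s₂.mem 11 = s.mem 11 := by rw [f₂.2 11 rfl, f₁.2 11 rfl]
  have e12 : s₂.mem 12 = s.mem 12 := by rw [f₂.2 12 rfl, f₁.2 12 rfl]
  have e16 : s₂.mem 16 = s.mem 16 := by rw [f₂.2 16 rfl, f₁.2 16 rfl]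
  have e9 : s₂.reg 9 = K := by rw [f₂.1 9 rfl, f₁.1 9 rfl, hs.reg9]
  have g₂ := (hs.graph.frame f₁).frame f₂
  refine Runs.seq (runs_hopStep hB hG g₂ e9 hM hK0 (by rw [e11]; exact hS)
    (by rw [e16]; exact hs.marks) hKB hmB)
    (T₂ := 300 * (M + mm + b₀ + 1)) ?_ (by linarith)
  rintro s₃ - f₃ ⟨hmk, hh⟩
  rw [e11, e12] at hh
  have e9' : s₃.reg 9 = K := by rw [f₃.1 9 rfl, e9]
  refine Runs.seq (T₁ := 10) (T₂ := 200 * (M + mm + b₀ + 1))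
    (Q := fun u => u.reg 9 = K + 1 ∧ u.mem = s₃.mem)
    (Runs.straight hB rfl (by decide) ?_) ?_ (by linarith)
  · simp [incr, e9']
    exact abs_le.mpr ⟨by linarith, hKB'⟩
  rintro s₄ - f₄ ⟨h9, e4⟩
  have g₄ := (g₂.frame f₃).frame f₄
  have hrow : ∀ i, 0 ≤ i → i < M →
      0 ≤ s₄.mem 11 ((K + 1) * M + i) ∧ s₄.mem 11 ((K + 1) * M + i) ≤ b₀ := by
    intro i h0 h1
    obtain ⟨w, w0, w1, -, hd, -⟩ := hh.hop i h0 h1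
    rw [e4, show (K + 1) * M + i = K * M + M + i by ring, hd]
    exact hD' w w0 w1
  refine (runs_relax hB hG g₄ h9 (by omega) hrow (by linarith) hbB hmB).mono (by linarith) ?_
  rintro s₅ - f₅ hr
  rw [e4] at hr
  refine ⟨g₄.frame f₅, (f₅.1 9 rfl).trans h9, hs.table.succ hG hK0 hh hr, fun x => ?_, ?_⟩
  · rw [f₅.2 13 rfl, e4, f₃.2 13 rfl]
    exact hbk x
  · rw [f₅.2 16 rfl, e4]
    exact hmk

/-! ### The best slope into the last layer -/

/-- Compute the largest value `p / q`, over all vertices, of the least slope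
`(D K i - D k i) / (K - k)` for `0 ≤ k < K`, together with a vertex for which it is attained. -/
def bestSlope : Program :=
  .set 2 (.const (-1)) ;;
  .set 3 (.const 1) ;;
  .set 11 (.const 0) ;;
  .loop (.lt (.reg 11) (.reg 6))
    (.set 13 (.get 11 (entry (.reg 11))) ;;
     .set 14 (.sub (.reg 13) (.get 11 (.reg 11))) ;;
     .set 15 (.reg 9) ;;
     .set 16 (.const 1) ;;
     .loop (.lt (.reg 16) (.reg 9))
       (.set 17 (.sub (.reg 13) (.get 11 (.add (.mul (.reg 16) (.reg 6)) (.reg 11)))) ;;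
        .set 18 (.sub (.reg 9) (.reg 16)) ;;
        .cond (.lt (.mul (.reg 17) (.reg 15)) (.mul (.reg 14) (.reg 18)))
          (.set 14 (.reg 17) ;; .set 15 (.reg 18))
          .skip ;;
        incr 16) ;;
     .cond (.lt (.mul (.reg 2) (.reg 15)) (.mul (.reg 14) (.reg 3)))
       (.set 2 (.reg 14) ;; .set 3 (.reg 15) ;; .set 12 (.reg 11))
       .skip ;;
     incr 11)

/-- Transitivity for fractions: `a / b ≤ c / d` and `c / d ≤ e / f` imply `a / b ≤ e / f`. -/
theorem mul_le_mul_of_fractions {a b c d e f : ℤ} (hb : 0 ≤ b) (hd : 0 < d) (hf : 0 ≤ f)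
    (h1 : a * d ≤ c * b) (h2 : c * f ≤ e * d) : a * f ≤ e * b := by
  refine le_of_mul_le_mul_right ?_ hd
  nlinarith [mul_le_mul_of_nonneg_right h1 hf, mul_le_mul_of_nonneg_right h2 hb]

/-- `a / b` is the least of the slopes `(x - f k) / (K - k)` for `0 ≤ k < j`. -/
structure IsLeastSlope (K j x a b : ℤ) (f : ℤ → ℤ) : Prop where
  pos : 0 < b
  le : b ≤ K
  attained : ∃ k, 0 ≤ k ∧ k < j ∧ a = x - f k ∧ b = K - k
  least : ∀ k, 0 ≤ k → k < j → a * (K - k) ≤ (x - f k) * b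

theorem IsLeastSlope.succ {K j x a b : ℤ} {f : ℤ → ℤ} (h : IsLeastSlope K j x a b f) (h0 : 0 ≤ j)
    (h1 : j < K) :
    ((x - f j) * b < a * (K - j) → IsLeastSlope K (j + 1) x (x - f j) (K - j) f) ∧
      (a * (K - j) ≤ (x - f j) * b → IsLeastSlope K (j + 1) x a b f) := by
  constructor
  · refine fun hlt => ⟨by omega, by omega, ⟨j, h0, by omega, rfl, rfl⟩, fun k hk0 hk1 => ?_⟩
    rcases (show k ≤ j by omega).lt_or_eq with hk | rfl
    · exact mul_le_mul_of_fractions (by omega) h.pos (by omega) hlt.le (h.least k hk0 hk)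
    · exact le_rfl
  · refine fun hle => ⟨h.pos, h.le, ?_, fun k hk0 hk1 => ?_⟩
    · obtain ⟨k, hk0, hk1, hk⟩ := h.attained
      exact ⟨k, hk0, by omega, hk⟩
    · rcases (show k ≤ j by omega).lt_or_eq with hk | rfl
      · exact h.least k hk0 hk
      · exact hle

/-- `p / q` is the largest value of the least slopes into the layer `K` over the vertices below `i`,
and it is attained at `v`. -/
structure IsBestSlope (K i p q v : ℤ) (D : ℤ → ℤ → ℤ) : Prop where
  pos : 0 < q
  le : q ≤ K
  nonneg : 0 ≤ p
  mem : 0 ≤ v ∧ v < i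
  upper : ∀ i', 0 ≤ i' → i' < i → ∃ k, 0 ≤ k ∧ k < K ∧ (D K i' - D k i') * q ≤ p * (K - k)
  attained : ∃ k, 0 ≤ k ∧ k < K ∧ p = D K v - D k v
  lower : ∀ k, 0 ≤ k → k < K → p * (K - k) ≤ (D K v - D k v) * q

/-- The entries of a vertex increase from layer to layer, because a hop may stay at the vertex. -/
theorem IsTable.le_last {E : ℤ → ℤ → Prop} {M K : ℤ} {D : ℤ → ℤ → ℤ} {Q : ℤ → ℤ}
    (hE : IsTopological E M) (h : IsTable E M K D Q) {k i : ℤ} (hk : 0 ≤ k) (hkK : k ≤ K)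
    (h0 : 0 ≤ i) (h1 : i < M) : D k i ≤ D K i := by
  have hirr : ¬ E i i := fun h => by have := hE _ _ h; omega
  have : ∀ j : ℕ, k + j ≤ K → D k i ≤ D (k + j) i := by
    intro j
    induction j with
    | zero => simp
    | succ j ih =>
      intro hj
      push_cast at hj ⊢
      have := h.hop (k + j) i i (by omega) (by omega) h0 h1 h0 h1 hirr
      rw [add_assoc] at this
      exact (ih (by omega)).trans this
  have := this (K - k).toNat (by omega)
  rwa [Int.toNat_of_nonneg (by omega), add_sub_cancel] at this

theorem runs_bestSlope {B : ℕ} {E : ℤ → ℤ → Prop} {M K b₀ : ℤ} {Q : ℤ → ℤ} {s : State}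
    (hB : 2 ≤ B) (hE : IsTopological E M) (h6 : s.reg 6 = M) (h9 : s.reg 9 = K) (hM : 0 < M)
    (hK : 0 < K) (hT : IsTable E M K (fun k i => s.mem 11 (k * M + i)) Q)
    (hD : ∀ i, 0 ≤ i → i < M → s.mem 11 (K * M + i) ≤ b₀)
    (hMB : M ≤ B) (hKB : K ≤ B) (hbB : b₀ ≤ B) :
    Runs B bestSlope s (300 * (M * K)) fun s' =>
      IsBestSlope K M (s'.reg 2) (s'.reg 3) (s'.reg 12) (fun k i => s.mem 11 (k * M + i)) := by
  have hlast : ∀ k i, 0 ≤ k → k ≤ K → 0 ≤ i → i < M →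
      s.mem 11 (k * M + i) ≤ s.mem 11 (K * M + i) :=
    fun k i h0 h1 hi0 hi1 => hT.le_last hE h0 h1 hi0 hi1
  have hnn : ∀ k i, 0 ≤ k → k ≤ K → 0 ≤ i → i < M → 0 ≤ s.mem 11 (k * M + i) := hT.nonneg
  have hMK : 1 ≤ M * K := by nlinarith
  refine Runs.seq (T₁ := 5) (T₂ := 300 * (M * K) - 5)
    (Q := fun u => u.reg 2 = -1 ∧ u.mem = s.mem)
    (Runs.straight hB rfl (by decide) (by simp)) ?_ (by linarith)
  rintro s₁ - f₁ ⟨h2, m₁⟩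
  refine Runs.seq (T₁ := 5) (T₂ := 300 * (M * K) - 10)
    (Q := fun u => u.reg 3 = 1 ∧ u.mem = s.mem)
    (Runs.straight hB rfl (by decide) (by simp [m₁])) ?_ (by linarith)
  rintro s₂ - f₂ ⟨h3, m₂⟩
  refine Runs.seq (T₁ := 5) (T₂ := 300 * (M * K) - 15)
    (Q := fun u => u.reg 11 = 0 ∧ u.mem = s.mem)
    (Runs.straight hB rfl (by decide) (by simp [m₂])) ?_ (by linarith)
  rintro s₃ - f₃ ⟨h11, m₃⟩
  refine (Runs.loop hB (φ := 250 * (M * K)) (fun φ u => ∃ i,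
    φ = 250 * ((M - i) * K) ∧ 0 ≤ i ∧ i ≤ M ∧ u.reg 11 = i ∧ u.reg 6 = M ∧
    u.reg 9 = K ∧ u.mem = s.mem ∧
    ((i = 0 ∧ u.reg 2 = -1 ∧ u.reg 3 = 1) ∨
      IsBestSlope K i (u.reg 2) (u.reg 3) (u.reg 12) (fun k i => s.mem 11 (k * M + i)))) rfl
    ?_ ?_ ?_ ?_).mono le_rfl ?_
  · rintro φ u ⟨i, rfl, h0, h1, -⟩
    have := mul_nonneg (sub_nonneg.mpr h1) hK.le
    linarith
  · rintro φ u hb ⟨i, rfl, h0, -, hi, hu6, hu9, hm, hp⟩ h1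
    simp only [Test.Holds, Expr.eval, hi, hu6] at h1
    refine ⟨200 * K + 30, ?_⟩
    refine Runs.seq (T₁ := 10) (T₂ := 200 * K + 20)
      (Q := fun v => v.reg 13 = s.mem 11 (K * M + i) ∧ v.mem = s.mem)
      (Runs.straight hB rfl (by decide) (by simp [entry, hu9, hu6, hi, hm])) ?_ (by linarith)
    rintro u₁ - g₁ ⟨k13, n₁⟩
    have k11 : u₁.reg 11 = i := (g₁.1 11 rfl).trans hi
    refine Runs.seq (T₁ := 10) (T₂ := 200 * K + 10)
      (Q := fun v => v.reg 14 = s.mem 11 (K * M + i) - s.mem 11 i ∧ v.mem = s.mem)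
      (Runs.straight hB rfl (by decide) ?_) ?_ (by linarith)
    · have e1 := hlast 0 i le_rfl hK.le h0 h1
      have e2 := hnn 0 i le_rfl hK.le h0 h1
      have e3 := hD i h0 h1
      rw [zero_mul, zero_add] at e1 e2
      simp [k13, k11, n₁]
      exact abs_le.mpr ⟨by linarith, by linarith⟩
    rintro u₂ - g₂ ⟨k14, n₂⟩
    refine Runs.seq (T₁ := 3) (T₂ := 200 * K + 7)
      (Q := fun v => v.reg 15 = K ∧ v.mem = s.mem)
      (Runs.straight hB rfl (by decide) (by simp [n₂, g₂.1 9 rfl, g₁.1 9 rfl, hu9])) ?_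
      (by linarith)
    rintro u₃ - g₃ ⟨k15, n₃⟩
    refine Runs.seq (T₁ := 3) (T₂ := 200 * K + 4)
      (Q := fun v => v.reg 16 = 1 ∧ v.mem = s.mem)
      (Runs.straight hB rfl (by decide) (by simp [n₃])) ?_ (by linarith)
    rintro u₄ - g₄ ⟨k16, n₄⟩
    refine Runs.seq (T₁ := 100 * K) (T₂ := 60) (Q := fun v =>
      IsLeastSlope K K (s.mem 11 (K * M + i)) (v.reg 14) (v.reg 15)
        (fun k => s.mem 11 (k * M + i)) ∧ v.mem = s.mem)
      ((Runs.loop hB (φ := 100 * (K - 1)) (fun φ v => ∃ k,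
        φ = 100 * (K - k) ∧ 0 ≤ k ∧ k ≤ K ∧ v.reg 16 = k ∧ v.reg 11 = i ∧ v.reg 6 = M ∧
        v.reg 9 = K ∧ v.reg 13 = s.mem 11 (K * M + i) ∧ v.mem = s.mem ∧
        IsLeastSlope K k (s.mem 11 (K * M + i)) (v.reg 14) (v.reg 15)
          (fun k => s.mem 11 (k * M + i))) rfl ?_ ?_ ?_ ?_).mono le_rfl ?_) ?_ (by linarith)
    · rintro φ u ⟨k, rfl, h0, h1, -⟩
      linarith
    · rintro φ v hb ⟨k, rfl, hk0, -, hk, hv11, hv6, hv9, hv13, hvm, hl⟩ hk1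
      simp only [Test.Holds, Expr.eval, hk, hv9] at hk1
      obtain ⟨hlt, hle⟩ := hl.succ hk0 hk1
      have e1 := hlast k i hk0 hk1.le h0 h1
      have e2 := hnn k i hk0 hk1.le h0 h1
      have e3 := hD i h0 h1
      refine ⟨80, Runs.straight hB rfl (by decide) ?_⟩
      simp [incr, hk, hv11, hv6, hv9, hv13, hvm]
      have a1 : |s.mem 11 (K * M + i) - s.mem 11 (k * M + i)| ≤ (B : ℤ) :=
        abs_le.mpr ⟨by linarith, by linarith⟩
      have a2 : |K - k| ≤ (B : ℤ) := abs_le.mpr ⟨by linarith, by linarith⟩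
      have a3 : |k + 1| ≤ (B : ℤ) := abs_le.mpr ⟨by linarith, by linarith⟩
      exact ⟨a1, a2, fun h => ⟨a3, by linarith, by linarith, by linarith, hlt h⟩,
        fun h => ⟨a3, by linarith, by linarith, by linarith, hle h⟩⟩
    · refine ⟨1, rfl, by norm_num, hK, k16, ?_, ?_, ?_, ?_, n₄, ?_⟩
      · rw [g₄.1 11 rfl, g₃.1 11 rfl, g₂.1 11 rfl, k11]
      · rw [g₄.1 6 rfl, g₃.1 6 rfl, g₂.1 6 rfl, g₁.1 6 rfl, hu6]
      · rw [g₄.1 9 rfl, g₃.1 9 rfl, g₂.1 9 rfl, g₁.1 9 rfl, hu9]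
      · rw [g₄.1 13 rfl, g₃.1 13 rfl, g₂.1 13 rfl, k13]
      · rw [g₄.1 14 rfl, g₃.1 14 rfl, k14, g₄.1 15 rfl, k15]
        refine ⟨hK, le_rfl, ⟨0, le_rfl, one_pos, by simp, by simp⟩, fun k h0 h1 => ?_⟩
        obtain rfl : k = 0 := by omega
        simp
    · simp; linarith
    · rintro v - - ⟨φ, ⟨k, -, hk0, hk1, hk, hv11, hv6, hv9, hv13, hvm, hl⟩, hnot⟩
      simp only [Test.Holds, Expr.eval, hk, hv9, not_lt] at hnot
      obtain rfl : k = K := by omega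
      exact ⟨hl, hvm⟩
    rintro u₅ - g₅ ⟨hl, n₅⟩
    have r2 : u₅.reg 2 = u.reg 2 := by
      rw [g₅.1 2 rfl, g₄.1 2 rfl, g₃.1 2 rfl, g₂.1 2 rfl, g₁.1 2 rfl]
    have r3 : u₅.reg 3 = u.reg 3 := by
      rw [g₅.1 3 rfl, g₄.1 3 rfl, g₃.1 3 rfl, g₂.1 3 rfl, g₁.1 3 rfl]
    have r12 : u₅.reg 12 = u.reg 12 := by
      rw [g₅.1 12 rfl, g₄.1 12 rfl, g₃.1 12 rfl, g₂.1 12 rfl, g₁.1 12 rfl]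
    have r11 : u₅.reg 11 = i := by
      rw [g₅.1 11 rfl, g₄.1 11 rfl, g₃.1 11 rfl, g₂.1 11 rfl, g₁.1 11 rfl, hi]
    have r6 : u₅.reg 6 = M := by
      rw [g₅.1 6 rfl, g₄.1 6 rfl, g₃.1 6 rfl, g₂.1 6 rfl, g₁.1 6 rfl, hu6]
    have r9 : u₅.reg 9 = K := by
      rw [g₅.1 9 rfl, g₄.1 9 rfl, g₃.1 9 rfl, g₂.1 9 rfl, g₁.1 9 rfl, hu9]
    obtain ⟨k₀, hk0, hk1, ha, hb'⟩ := hl.attained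
    have ha0 : 0 ≤ u₅.reg 14 := by
      have := hlast k₀ i hk0 hk1.le h0 h1
      rw [ha]; linarith
    refine Runs.straight hB rfl (by decide) ?_
    simp [incr, r2, r3, r11, r6, r9, n₅]
    have a1 : |i + 1| ≤ (B : ℤ) := abs_le.mpr ⟨by linarith, by linarith⟩
    have hsplit : ∀ i', i' < i + 1 → i' < i ∨ i' = i := by omega
    refine ⟨fun hlt => ⟨a1, by linarith, by linarith, by linarith,
      .inr ⟨hl.pos, hl.le, ha0, ⟨h0, by omega⟩, fun i' hi0 hi1 => ?_, ⟨k₀, hk0, hk1, ha⟩,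
        hl.least⟩⟩,
      fun hle => ⟨a1, by linarith, by linarith, by linarith, .inr ?_⟩⟩
    · rcases hsplit i' hi1 with hi' | rfl
      · rcases hp with ⟨rfl, -⟩ | hp
        · omega
        · obtain ⟨k, h0, h1, hk⟩ := hp.upper i' hi0 hi'
          exact ⟨k, h0, h1, mul_le_mul_of_fractions (by omega) hp.pos hl.pos.le hk hlt.le⟩
      · refine ⟨k₀, hk0, hk1, ?_⟩
        rw [← ha, ← hb']
    · rcases hp with ⟨rfl, hp2, hp3⟩ | hp
      · rw [hp2, hp3] at hle
        have := hl.pos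
        linarith
      · rw [r12]
        refine ⟨hp.pos, hp.le, hp.nonneg, ⟨hp.mem.1, by have := hp.mem.2; omega⟩,
          fun i' hi0 hi1 => ?_, hp.attained, hp.lower⟩
        rcases hsplit i' hi1 with hi' | rfl
        · exact hp.upper i' hi0 hi'
        · refine ⟨k₀, hk0, hk1, ?_⟩
          rw [← ha, ← hb']
          exact hle
  · refine ⟨0, by ring, le_rfl, hM.le, h11, ?_, ?_, m₃, .inl ⟨rfl, ?_, ?_⟩⟩
    · rw [f₃.1 6 rfl, f₂.1 6 rfl, f₁.1 6 rfl, h6]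
    · rw [f₃.1 9 rfl, f₂.1 9 rfl, f₁.1 9 rfl, h9]
    · rw [f₃.1 2 rfl, f₂.1 2 rfl, h2]
    · rw [f₃.1 3 rfl, h3]
  · simp; linarith
  · rintro s' - - ⟨φ, ⟨i, -, h0, h1, hi, hu6, hu9, -, hp⟩, hnot⟩
    simp only [Test.Holds, Expr.eval, hi, hu6, not_lt] at hnot
    obtain rfl : i = M := by omega
    rcases hp with ⟨h, -⟩ | hp
    · omega
    · exact hp

/-! ### The search for the ratio -/

/-- Extend the table until its last layer yields a slope that is certainly optimal. The slope is
evaluated in the layers `1, 2, 4, …` only; register `10` holds the next one. -/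
def findRatio : Program :=
  relax ;;
  .set 10 (.const 1) ;;
  .set 20 (.const 0) ;;
  .loop (.eq (.reg 20) (.const 0))
    (nextLayer ;;
     .cond (.eq (.reg 9) (.reg 10))
       (bestSlope ;;
        .cond (.le (.mul (.reg 6) (.reg 3)) (.mul (.reg 9) (.add (.reg 3) (.reg 2))))
          (.set 20 (.const 1))
          (.set 10 (.add (.reg 10) (.reg 10))))
       .skip)

/-- The state holds a table whose last layer `K` has the best slope `p / q`, in the registers `2` and
`3`; it is attained at the vertex in register `12`, and the walk of this vertex has at least `M` edges
and hops. -/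
structure IsOptimal (E : ℤ → ℤ → Prop) (M mm K : ℤ) (T H : ℤ → ℤ) (s : State) : Prop where
  table : HasTable E M mm K T H s
  pos : 0 < K
  slope : IsBestSlope K M (s.reg 2) (s.reg 3) (s.reg 12) (fun k i => s.mem 11 (k * M + i))
  test : M * s.reg 3 ≤ K * (s.reg 3 + s.reg 2)

/-- The best slope is a satisfiable ratio. -/
theorem IsBestSlope.lam_le {E : ℤ → ℤ → Prop} {M K p q v : ℤ} {D : ℤ → ℤ → ℤ} {Q : ℤ → ℤ} {lam : ℝ}
    (h : IsBestSlope K M p q v D) (hT : IsTable E M K D Q) (hE : IsTopological E M) (hK : 0 < K)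
    (hlam : IsRatioInf E M lam) : lam ≤ (p : ℝ) / q :=
  hlam.le _ (hT.sat hE h.pos h.upper hK)

theorem HasTable.of_frame {E : ℤ → ℤ → Prop} {M mm K : ℤ} {T H : ℤ → ℤ} {s s' : State} {P : Program}
    (h : HasTable E M mm K T H s) (hf : Frame P s s')
    (hP : (P.writesReg 6 || P.writesReg 8 || P.writesMem 8 || P.writesMem 19) = false := by rfl)
    (hP' : (P.writesReg 9 || P.writesMem 11 || P.writesMem 12 || P.writesMem 13 ||
      P.writesMem 16) = false := by rfl) : HasTable E M mm K T H s' := by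
  simp only [Bool.or_eq_false_iff] at hP'
  obtain ⟨⟨⟨⟨h1, h2⟩, h3⟩, h4⟩, h5⟩ := hP'
  refine ⟨h.graph.frame hf hP, (hf.1 9 h1).trans h.reg9, ?_, ?_, ?_⟩
  · rw [hf.2 11 h2, hf.2 12 h3]; exact h.table
  · rw [hf.2 13 h4]; exact h.buckets
  · rw [hf.2 16 h5]; exact h.marks

/-- As long as the test fails in a layer `N`, the slope there is at least `lam`, and
`N * (1 + lam) < M`. The next layer that is evaluated, `2 * N`, is then at most `N₀`, and the entries
up to it are at most `lam * (2 * N) + M ≤ 3 * M`. The evaluations take time proportional to `M * N` for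
`N = 1, 2, 4, …`, so the last one dominates. -/
theorem runs_findRatio {B : ℕ} {E : ℤ → ℤ → Prop} {M mm N₀ : ℤ} {T H : ℤ → ℤ} {lam : ℝ} {s : State}
    (hB : 2 ≤ B) (hG : IsSortedEdges E M mm T H) (hs : HasGraph M mm T H s) (hM : 0 < M)
    (h9 : s.reg 9 = 0) (h11 : ∀ x, s.mem 11 x = 0) (h13 : ∀ x, s.mem 13 x = 0)
    (h16 : ∀ x, s.mem 16 x = 0) (hlam : IsRatioInf E M lam) (hN1 : 1 ≤ N₀)
    (hN₀ : ∀ N : ℤ, (N : ℝ) * (1 + lam) < 2 * M → N ≤ N₀) (hN₀M : N₀ ≤ 2 * M)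
    (hMB : (2 * M + 1) * M ≤ B) (hMB' : 4 * M ≤ B) (hmB : mm ≤ B) :
    Runs B findRatio s (3000 * (N₀ * (4 * M + mm + 1))) fun s' =>
      ∃ K, K ≤ N₀ ∧ IsOptimal E M mm K T H s' := by
  have hmm := hG.nonneg
  have hX : 4 * M + mm + 1 ≤ N₀ * (4 * M + mm + 1) := by nlinarith
  refine Runs.seq (runs_relax (b₀ := 0) hB hG hs h9 le_rfl (fun i _ _ => by simp [h11]) (by linarith)
    (by linarith) hmB) (T₂ := 2800 * (N₀ * (4 * M + mm + 1))) ?_ (by linarith)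
  rintro s₁ - f₁ hr
  have ht₀ : HasTable E M mm 0 T H s₁ := by
    refine ⟨hs.frame f₁, (f₁.1 9 rfl).trans h9, hr.isTable_zero hG h11, fun x => ?_,
      fun w i hi hw => ?_⟩
    · rw [f₁.2 13 rfl, h13]
    · rw [f₁.2 16 rfl, h16] at hw
      omega
  refine Runs.seq (T₁ := 5) (T₂ := 2790 * (N₀ * (4 * M + mm + 1)))
    (Q := fun u => u.reg 10 = 1) (Runs.straight hB rfl (by decide) (by simp)) ?_ (by linarith)
  rintro s₂ - f₂ h10
  refine Runs.seq (T₁ := 5) (T₂ := 2780 * (N₀ * (4 * M + mm + 1)))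
    (Q := fun u => u.reg 20 = 0) (Runs.straight hB rfl (by decide) (by simp)) ?_ (by linarith)
  rintro s₃ - f₃ h20
  refine (Runs.loop hB (φ := 1100 * (N₀ * (4 * M + mm + 1)) + 300 * (M * (2 * N₀ - 1))) (fun φ u =>
    (u.reg 20 = 0 ∧ ∃ K N : ℤ, φ = 1100 * ((N₀ - K) * (4 * M + mm + 1)) + 300 * (M * (2 * N₀ - N)) ∧
      0 ≤ K ∧ K < N ∧ N ≤ N₀ ∧ u.reg 10 = N ∧ (N = 1 ∨ (N : ℝ) * (1 + lam) < 2 * M) ∧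
      HasTable E M mm K T H u) ∨
    (u.reg 20 = 1 ∧ φ = 0 ∧ ∃ K, K ≤ N₀ ∧ IsOptimal E M mm K T H u)) rfl
    ?_ ?_ ?_ ?_).mono le_rfl ?_
  · rintro φ u (⟨-, K, N, rfl, hK0, hKN, hN, -⟩ | ⟨-, rfl, -⟩)
    · have h1 : 0 ≤ (N₀ - K) * (4 * M + mm + 1) := mul_nonneg (by omega) (by omega)
      have h2 : 0 ≤ M * (2 * N₀ - N) := mul_nonneg (by omega) (by omega)
      linarith
    · exact le_rfl
  · rintro φ u hb hI hh
    simp only [Test.Holds, Expr.eval] at hh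
    obtain ⟨-, K, N, rfl, hK0, hKN, hN, h10, hNl, ht⟩ | ⟨h, -⟩ := hI
    swap
    · omega
    have hKM : (K + 2) * M ≤ (2 * M + 1) * M := mul_le_mul_of_nonneg_right (by omega) hM.le
    have hK0' : (0 : ℝ) ≤ K := by exact_mod_cast hK0
    have hD : ∀ i, 0 ≤ i → i < M → u.mem 11 (K * M + i) ≤ 3 * M := by
      intro i h0 h1
      have h := ht.table.le_mul_add hlam hK0 le_rfl h0 h1
      suffices hle : (u.mem 11 (K * M + i) : ℝ) ≤ (3 * M : ℤ) by exact_mod_cast hle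
      have hM' : (0 : ℝ) < M := by exact_mod_cast hM
      push_cast
      rcases hNl with rfl | hNl
      · obtain rfl : K = 0 := by omega
        push_cast at h
        linarith
      · have hKN' : (K : ℝ) ≤ N := by exact_mod_cast hKN.le
        have := mul_le_mul_of_nonneg_left hKN' hlam.nonneg
        nlinarith
    refine ⟨1100 * (4 * M + mm + 1) - 10 + if K + 1 = N then 300 * (M * N) else 0, ?_⟩
    refine Runs.seq (runs_nextLayer hB hG ht hM.le hK0 (b₀ := 3 * M) (by linarith) hD (by linarith)
      (by linarith) (by linarith) hmB)
      (T₂ := 90 + if K + 1 = N then 300 * (M * N) else 0) ?_ (by linarith)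
    rintro u₁ - g₁ ht₁
    have r10 : u₁.reg 10 = N := (g₁.1 10 rfl).trans h10
    have r20 : u₁.reg 20 = 0 := (g₁.1 20 rfl).trans hh
    refine Runs.cond hB rfl (T := 80 + if K + 1 = N then 300 * (M * N) else 0) (fun hb => ?_)
      (fun hb => ?_) (by simp only [Test.cost, Expr.cost]; push_cast; linarith)
    · simp only [Test.Holds, Expr.eval, ht₁.reg9, r10] at hb
      subst hb
      rw [if_pos rfl]
      refine Runs.of_bounded fun hbd => ?_
      refine Runs.seq (T₂ := 80) (runs_bestSlope hB hG.topo ht₁.graph.reg6 ht₁.reg9 hM (by omega)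
        ht₁.table (b₀ := B) (fun i _ _ => (abs_le.mp (hbd.2 _ _)).2) (by linarith) (by linarith)
        le_rfl) ?_ (by linarith)
      rintro u₂ - g₂ hbest
      have ht₂ := ht₁.of_frame g₂
      have r10' : u₂.reg 10 = K + 1 := (g₂.1 10 rfl).trans r10
      have r20' : u₂.reg 20 = 0 := (g₂.1 20 rfl).trans r20
      rw [← g₂.2 11 rfl] at hbest
      have hq := hbest.pos
      refine Runs.cond hB rfl (T := 60) (fun hb => ?_) (fun hb => ?_) (by simp)
      · simp only [Test.Holds, Expr.eval, ht₂.graph.reg6, ht₂.reg9] at hb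
        refine (Runs.straight (Q := fun u' => u'.reg 20 = 1 ∧ u'.reg 2 = u₂.reg 2 ∧
          u'.reg 3 = u₂.reg 3 ∧ u'.reg 12 = u₂.reg 12 ∧ u'.mem = u₂.mem) hB rfl (by decide)
          (by simp)).mono le_rfl ?_
        rintro u₃ - g₃ ⟨e20, e2, e3, e12, em⟩
        refine ⟨0, ?_, .inr ⟨e20, rfl, K + 1, by omega, ht₂.of_frame g₃, by omega, ?_, ?_⟩⟩
        · have h1 : 0 ≤ (N₀ - (K + 1)) * (4 * M + mm + 1) := mul_nonneg (by omega) (by omega)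
          have h2 : 0 ≤ M * (N₀ - (K + 1)) := mul_nonneg (by omega) (by omega)
          simp
          linarith
        · rw [e2, e3, e12, em]; exact hbest
        · rw [e2, e3]; exact hb
      · simp only [Test.Holds, Expr.eval, ht₂.graph.reg6, ht₂.reg9, not_le] at hb
        have hle := hbest.lam_le ht₂.table hG.topo (by omega) hlam
        have hq' : (0 : ℝ) < u₂.reg 3 := by exact_mod_cast hq
        have hlt : ((K + 1 + (K + 1) : ℤ) : ℝ) * (1 + lam) < 2 * M := by
          have hb' : ((K : ℝ) + 1) * (u₂.reg 3 + u₂.reg 2) < M * u₂.reg 3 := by exact_mod_cast hb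
          have h1 : lam * u₂.reg 3 ≤ u₂.reg 2 := (le_div_iff₀ hq').mp hle
          have h2 : ((K : ℝ) + 1) * (1 + lam) * u₂.reg 3 < M * u₂.reg 3 := by nlinarith
          have h3 := lt_of_mul_lt_mul_right h2 hq'.le
          push_cast
          linarith
        have hN' := hN₀ _ hlt
        refine (Runs.straight (Q := fun u' => u'.reg 20 = 0 ∧ u'.reg 10 = K + 1 + (K + 1)) hB rfl
          (by decide) ?_).mono le_rfl ?_
        · simp [r10', r20']
          exact abs_le.mpr ⟨by linarith, by linarith⟩
        rintro u₃ - g₃ ⟨e20, e10⟩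
        refine ⟨_, ?_, .inl ⟨e20, K + 1, K + 1 + (K + 1), rfl, by omega, by omega, hN', e10,
          .inr hlt, ht₂.of_frame g₃⟩⟩
        simp
        linarith
    · simp only [Test.Holds, Expr.eval, ht₁.reg9, r10] at hb
      rw [if_neg hb]
      refine Runs.straight hB rfl (by decide) ?_
      refine ⟨_, ?_, .inl ⟨r20, K + 1, N, rfl, by omega, by omega, hN, r10, hNl, ht₁⟩⟩
      simp
      linarith
  · refine .inl ⟨h20, 0, 1, by ring, le_rfl, one_pos, hN1, (f₃.1 10 rfl).trans h10, .inl rfl,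
      (ht₀.of_frame f₂).of_frame f₃⟩
  · have : M * N₀ ≤ N₀ * (4 * M + mm + 1) := by nlinarith
    simp
    linarith
  · rintro s' - - ⟨φ, hI, hnot⟩
    simp only [Test.Holds, Expr.eval] at hnot
    rcases hI with ⟨h, -⟩ | ⟨-, -, h⟩
    · exact absurd h hnot
    · exact h

/-! ### Writing the certificate -/

/-- Write the satisfying assignment: the vertex `v`, which stands at position `i` of the topological
order, receives the largest value of `q * D k i - p * k` over `0 ≤ k < K`. -/
def writeAssignment : Program :=
  .set 11 (.const 0) ;;
  .loop (.lt (.reg 11) (.reg 0))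
    (.set 13 (.get 10 (.reg 11)) ;;
     .set 14 (.mul (.reg 3) (.get 11 (.reg 13))) ;;
     .set 16 (.const 1) ;;
     .loop (.lt (.reg 16) (.reg 9))
       (.set 17 (.sub (.mul (.reg 3) (.get 11 (.add (.mul (.reg 16) (.reg 6)) (.reg 13))))
         (.mul (.reg 2) (.reg 16))) ;;
        .cond (.lt (.reg 14) (.reg 17)) (.set 14 (.reg 17)) .skip ;;
        incr 16) ;;
     .store 2 (.reg 11) (.reg 14) ;;
     incr 11)

/-- Follow the parents from the vertex in register `12` of the last layer until a vertex is visited for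
the second time. -/
def followParents : Program :=
  .set 13 (entry (.reg 12)) ;;
  .set 14 (.reg 12) ;;
  .set 16 (.const 0) ;;
  .loop (.eq (.get 18 (.reg 14)) (.const 0))
    (.store 18 (.reg 14) (.add (.reg 16) (.const 1)) ;;
     .store 17 (.reg 16) (.reg 14) ;;
     .set 13 (.get 12 (.reg 13)) ;;
     .set 14 (.sub (.reg 13) (.mul (.div (.reg 13) (.reg 6)) (.reg 6))) ;;
     incr 16)

/-- Write the vertices between the two visits, from parents to children. -/
def writeCycle : Program :=
  followParents ;;
  .store 17 (.reg 16) (.reg 14) ;;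
  .set 4 (.sub (.add (.reg 16) (.const 1)) (.get 18 (.reg 14))) ;;
  .set 11 (.const 0) ;;
  .loop (.lt (.reg 11) (.reg 4))
    (.store 3 (.reg 11) (.get 7 (.get 17 (.sub (.reg 16) (.reg 11)))) ;;
     incr 11)

/-- `x` is the largest value of `f` on `0, …, j - 1`. -/
def IsMaxBelow (f : ℤ → ℤ) (j x : ℤ) : Prop :=
  (∃ k, 0 ≤ k ∧ k < j ∧ x = f k) ∧ ∀ k, 0 ≤ k → k < j → f k ≤ x

theorem IsMaxBelow.succ {f : ℤ → ℤ} {j x : ℤ} (h : IsMaxBelow f j x) (h0 : 0 ≤ j) :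
    (x < f j → IsMaxBelow f (j + 1) (f j)) ∧ (f j ≤ x → IsMaxBelow f (j + 1) x) := by
  have hsplit : ∀ k, k < j + 1 → k < j ∨ k = j := by omega
  refine ⟨fun hlt => ⟨⟨j, h0, by omega, rfl⟩, fun k hk0 hk1 => ?_⟩,
    fun hle => ⟨?_, fun k hk0 hk1 => ?_⟩⟩
  · rcases hsplit k hk1 with hk | rfl
    · exact (h.2 k hk0 hk).trans hlt.le
    · exact le_rfl
  · obtain ⟨k, hk0, hk1, hk⟩ := h.1
    exact ⟨k, hk0, by omega, hk⟩
  · rcases hsplit k hk1 with hk | rfl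
    · exact h.2 k hk0 hk
    · exact hle

theorem runs_writeAssignment {B : ℕ} {n M K p q b₀ : ℤ} {s : State} (hB : 2 ≤ B)
    (h0 : s.reg 0 = n) (h6 : s.reg 6 = M) (h9 : s.reg 9 = K) (h2 : s.reg 2 = p) (h3 : s.reg 3 = q)
    (hn : 0 ≤ n) (hK : 0 < K) (hp0 : 0 ≤ p) (hpb : p ≤ b₀) (hq0 : 0 ≤ q) (hqK : q ≤ K)
    (hpos : ∀ v, 0 ≤ v → v < n → 0 ≤ s.mem 10 v ∧ s.mem 10 v < M)
    (hD : ∀ k i, 0 ≤ k → k < K → 0 ≤ i → i < M →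
      0 ≤ s.mem 11 (k * M + i) ∧ s.mem 11 (k * M + i) ≤ b₀)
    (hnB : n ≤ B) (hKB : K ≤ B) (hbB : K * b₀ ≤ B) :
    Runs B writeAssignment s (300 * (n * K + 1)) fun s' => ∀ v, 0 ≤ v → v < n →
      IsMaxBelow (fun k => q * s.mem 11 (k * M + s.mem 10 v) - p * k) K (s'.mem 2 v) := by
  have hb₀ : 0 ≤ b₀ := hp0.trans hpb
  have hnK : 0 ≤ n * K := mul_nonneg hn hK.le
  refine Runs.seq (T₁ := 5) (T₂ := 300 * (n * K + 1) - 5)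
    (Q := fun u => u.reg 11 = 0 ∧ u.mem = s.mem)
    (Runs.straight hB rfl (by decide) (by simp)) ?_ (by linarith)
  rintro s₁ - f₁ ⟨h11, m₁⟩
  refine (Runs.loop hB (φ := 300 * (n * K)) (fun φ u => ∃ v,
    φ = 300 * ((n - v) * K) ∧ 0 ≤ v ∧ v ≤ n ∧ u.reg 11 = v ∧ u.reg 0 = n ∧ u.reg 6 = M ∧
    u.reg 9 = K ∧ u.reg 2 = p ∧ u.reg 3 = q ∧ u.mem 10 = s.mem 10 ∧ u.mem 11 = s.mem 11 ∧
    ∀ v', 0 ≤ v' → v' < v → IsMaxBelow (fun k => q * s.mem 11 (k * M + s.mem 10 v') - p * k) K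
      (u.mem 2 v')) rfl ?_ ?_ ?_ ?_).mono le_rfl ?_
  · rintro φ u ⟨v, rfl, hv0, hv1, -⟩
    have := mul_nonneg (sub_nonneg.mpr hv1) hK.le
    linarith
  · rintro φ u hb ⟨v, rfl, hv0, -, u11, u0, u6, u9, u2, u3, m10, m11, hmax⟩ hv1
    simp only [Test.Holds, Expr.eval, u11, u0] at hv1
    obtain ⟨i0, i1⟩ := hpos v hv0 hv1
    generalize hi : s.mem 10 v = i at *
    refine ⟨200 * K + 50, ?_⟩
    refine Runs.seq (T₁ := 5) (T₂ := 200 * K + 45)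
      (Q := fun w => w.reg 13 = i ∧ w.mem = u.mem)
      (Runs.straight hB rfl (by decide) (by simp [u11, m10, hi])) ?_ (by linarith)
    rintro u₁ - g₁ ⟨k13, n₁⟩
    refine Runs.seq (T₁ := 10) (T₂ := 200 * K + 35)
      (Q := fun w => w.reg 14 = q * s.mem 11 i ∧ w.mem = u.mem)
      (Runs.straight hB rfl (by decide) ?_) ?_ (by linarith)
    · obtain ⟨e1, e2⟩ := hD 0 i le_rfl hK i0 i1
      rw [zero_mul, zero_add] at e1 e2
      simp [k13, n₁, m11, g₁.1 3 rfl, u3]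
      have h1 := mul_nonneg hq0 e1
      have h2 := mul_le_mul hqK e2 e1 hK.le
      rw [← abs_mul]
      exact abs_le.mpr ⟨by linarith, by linarith⟩
    rintro u₂ - g₂ ⟨k14, n₂⟩
    refine Runs.seq (T₁ := 5) (T₂ := 200 * K + 30)
      (Q := fun w => w.reg 16 = 1 ∧ w.mem = u.mem)
      (Runs.straight hB rfl (by decide) (by simp [n₂])) ?_ (by linarith)
    rintro u₃ - g₃ ⟨k16, n₃⟩
    refine Runs.seq (T₁ := 200 * K) (T₂ := 30) (Q := fun w =>
      IsMaxBelow (fun k => q * s.mem 11 (k * M + i) - p * k) K (w.reg 14) ∧ w.mem = u.mem)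
      ((Runs.loop hB (φ := 200 * (K - 1)) (fun φ w => ∃ k,
        φ = 200 * (K - k) ∧ 0 ≤ k ∧ k ≤ K ∧ w.reg 16 = k ∧ w.reg 13 = i ∧ w.reg 6 = M ∧
        w.reg 9 = K ∧ w.reg 2 = p ∧ w.reg 3 = q ∧ w.mem = u.mem ∧
        IsMaxBelow (fun k => q * s.mem 11 (k * M + i) - p * k) k (w.reg 14)) rfl
        ?_ ?_ ?_ ?_).mono le_rfl ?_) ?_ (by linarith)
    · rintro φ w ⟨k, rfl, h0, h1, -⟩
      linarith
    · rintro φ w hb ⟨k, rfl, hk0, -, w16, w13, w6, w9, w2, w3, wm, hl⟩ hk1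
      simp only [Test.Holds, Expr.eval, w16, w9] at hk1
      obtain ⟨hlt, hle⟩ := hl.succ hk0
      obtain ⟨e1, e2⟩ := hD k i hk0 hk1 i0 i1
      have a1 := mul_nonneg hq0 e1
      have a2 := mul_le_mul hqK e2 e1 hK.le
      have a3 := mul_nonneg hp0 hk0
      have a4 := mul_le_mul hpb hk1.le hk0 hb₀
      have a5 : |q * s.mem 11 (k * M + i) - p * k| ≤ (B : ℤ) :=
        abs_le.mpr ⟨by linarith, by linarith⟩
      have a6 : |k + 1| ≤ (B : ℤ) := abs_le.mpr ⟨by linarith, by linarith⟩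
      refine ⟨80, Runs.straight hB rfl (by decide) ?_⟩
      simp [incr, w16, w13, w6, w9, w2, w3, wm, m11]
      exact ⟨a5, fun h => ⟨a6, by linarith, by linarith, by linarith, hlt (by linarith)⟩,
        fun h => ⟨a6, by linarith, by linarith, by linarith, hle (by linarith)⟩⟩
    · refine ⟨1, rfl, by norm_num, hK, k16, ?_, ?_, ?_, ?_, ?_, n₃, ?_⟩
      · rw [g₃.1 13 rfl, g₂.1 13 rfl, k13]
      · rw [g₃.1 6 rfl, g₂.1 6 rfl, g₁.1 6 rfl, u6]
      · rw [g₃.1 9 rfl, g₂.1 9 rfl, g₁.1 9 rfl, u9]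
      · rw [g₃.1 2 rfl, g₂.1 2 rfl, g₁.1 2 rfl, u2]
      · rw [g₃.1 3 rfl, g₂.1 3 rfl, g₁.1 3 rfl, u3]
      · rw [g₃.1 14 rfl, k14]
        refine ⟨⟨0, le_rfl, one_pos, by simp⟩, fun k h0 h1 => ?_⟩
        obtain rfl : k = 0 := by omega
        simp
    · simp; linarith
    · rintro w - - ⟨φ, ⟨k, -, hk0, hk1, w16, w13, w6, w9, w2, w3, wm, hl⟩, hnot⟩
      simp only [Test.Holds, Expr.eval, w16, w9, not_lt] at hnot
      obtain rfl : k = K := by omega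
      exact ⟨hl, wm⟩
    rintro u₄ - g₄ ⟨hl, n₄⟩
    have r11 : u₄.reg 11 = v := by
      rw [g₄.1 11 rfl, g₃.1 11 rfl, g₂.1 11 rfl, g₁.1 11 rfl, u11]
    have r0 : u₄.reg 0 = n := by
      rw [g₄.1 0 rfl, g₃.1 0 rfl, g₂.1 0 rfl, g₁.1 0 rfl, u0]
    have r6 : u₄.reg 6 = M := by
      rw [g₄.1 6 rfl, g₃.1 6 rfl, g₂.1 6 rfl, g₁.1 6 rfl, u6]
    have r9 : u₄.reg 9 = K := by
      rw [g₄.1 9 rfl, g₃.1 9 rfl, g₂.1 9 rfl, g₁.1 9 rfl, u9]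
    have r2 : u₄.reg 2 = p := by
      rw [g₄.1 2 rfl, g₃.1 2 rfl, g₂.1 2 rfl, g₁.1 2 rfl, u2]
    have r3 : u₄.reg 3 = q := by
      rw [g₄.1 3 rfl, g₃.1 3 rfl, g₂.1 3 rfl, g₁.1 3 rfl, u3]
    refine Runs.straight hB rfl (by decide) ?_
    simp [incr, r11, r0, r6, r9, r2, r3, n₄, m10, m11]
    refine ⟨abs_le.mpr ⟨by linarith, by linarith⟩, by linarith, by linarith, hv1,
      fun v' hv'0 hv'1 => ?_⟩
    rcases (show v' ≤ v by omega).lt_or_eq with hv' | rfl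
    · rw [Function.update_of_ne hv'.ne]
      exact hmax v' hv'0 hv'
    · rw [Function.update_self, hi]
      exact hl
  · refine ⟨0, by ring, le_rfl, hn, h11, ?_, ?_, ?_, ?_, ?_, by rw [m₁], by rw [m₁], by omega⟩
    · rw [f₁.1 0 rfl, h0]
    · rw [f₁.1 6 rfl, h6]
    · rw [f₁.1 9 rfl, h9]
    · rw [f₁.1 2 rfl, h2]
    · rw [f₁.1 3 rfl, h3]
  · simp; linarith
  · rintro s' - - ⟨φ, ⟨v, -, hv0, hv1, u11, u0, -, -, -, -, -, -, hmax⟩, hnot⟩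
    simp only [Test.Holds, Expr.eval, u11, u0, not_lt] at hnot
    obtain rfl : v = n := by omega
    exact hmax

/-- Array `18` holds, for every visited vertex, one more than the number of the step in which it was
visited, and array `17` holds the sequence of the visited vertices. -/
theorem runs_followParents {B : ℕ} {E : ℤ → ℤ → Prop} {M K i : ℤ} {D : ℤ → ℤ → ℤ} {Q : ℤ → ℤ}
    {s : State} (hB : 2 ≤ B) (h6 : s.reg 6 = M) (h9 : s.reg 9 = K) (h12 : s.reg 12 = i)
    (hQ : s.mem 12 = Q) (h18 : ∀ x, s.mem 18 x = 0) (hK : 0 ≤ K) (hi0 : 0 ≤ i) (hi1 : i < M)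
    (hT : IsTable E M K D Q) (hD : M ≤ D K i + K) (hMB : (K + 1) * M ≤ B) :
    Runs B followParents s (200 * (M + 1)) fun s' => ∃ a b : ℕ, a < b ∧ (b : ℤ) ≤ M ∧
      (chain M Q K i a).2 = (chain M Q K i b).2 ∧
      (∀ t t', t < t' → t' < b → (chain M Q K i t).2 ≠ (chain M Q K i t').2) ∧
      s'.reg 16 = b ∧ s'.reg 14 = (chain M Q K i b).2 ∧ s'.mem 18 (chain M Q K i b).2 = a + 1 ∧
      ∀ t, t < b → s'.mem 17 (t : ℤ) = (chain M Q K i t).2 := by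
  have hKM : 0 ≤ K * M := mul_nonneg hK (by omega)
  refine Runs.seq (T₁ := 10) (T₂ := 200 * M + 190)
    (Q := fun u => u.reg 13 = K * M + i ∧ u.mem = s.mem)
    (Runs.straight hB rfl (by decide) ?_) ?_ (by linarith)
  · simp [entry, h9, h6, h12]
    exact abs_le.mpr ⟨by linarith, by linarith⟩
  rintro s₁ - f₁ ⟨h13, m₁⟩
  refine Runs.seq (T₁ := 5) (T₂ := 200 * M + 180)
    (Q := fun u => u.reg 14 = i ∧ u.mem = s.mem)
    (Runs.straight hB rfl (by decide) (by simp [f₁.1 12 rfl, h12, m₁])) ?_ (by linarith)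
  rintro s₂ - f₂ ⟨h14, m₂⟩
  refine Runs.seq (T₁ := 5) (T₂ := 200 * M + 170)
    (Q := fun u => u.reg 16 = 0 ∧ u.mem = s.mem)
    (Runs.straight hB rfl (by decide) (by simp [m₂])) ?_ (by linarith)
  rintro s₃ - f₃ ⟨h16, m₃⟩
  have hv : ∀ j : ℕ, (j : ℤ) ≤ M → 0 ≤ (chain M Q K i j).2 ∧ (chain M Q K i j).2 < M :=
    fun j hj => (hT.chain_spec hK le_rfl hi0 hi1 j (by omega)).2.1
  refine (Runs.loop hB (φ := 200 * M) (fun φ u => ∃ j : ℕ,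
    φ = 200 * (M - j) ∧ (j : ℤ) ≤ M ∧ u.reg 16 = j ∧ u.reg 6 = M ∧ u.mem 12 = Q ∧
    u.reg 13 = Q^[j] (K * M + i) ∧ u.reg 14 = (chain M Q K i j).2 ∧
    (∀ t, t < j → u.mem 17 (t : ℤ) = (chain M Q K i t).2) ∧
    (∀ t, t < j → u.mem 18 (chain M Q K i t).2 = t + 1) ∧
    (∀ w, u.mem 18 w = 0 ∨ ∃ t, t < j ∧ w = (chain M Q K i t).2)) rfl
    ?_ ?_ ?_ ?_).mono le_rfl ?_
  · rintro φ u ⟨j, rfl, hj, -⟩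
    linarith
  · rintro φ u hb ⟨j, rfl, hj, u16, u6, u12, u13, u14, hseq, hvis, hvis'⟩ hh
    simp only [Test.Holds, Expr.eval, u14] at hh
    have hne : ∀ t t', t < t' → t' < j + 1 → (chain M Q K i t).2 ≠ (chain M Q K i t').2 := by
      intro t t' hlt hlt' heq
      have h1 := hvis t (by omega)
      rcases Nat.lt_succ_iff_lt_or_eq.mp hlt' with h | rfl
      · have h2 := hvis t' h
        rw [heq] at h1
        omega
      · rw [heq] at h1
        omega
    have hj1 : ((j + 1 : ℕ) : ℤ) ≤ M := by
      refine le_of_injective (S := fun t => (chain M Q K i t.toNat).2) (by omega)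
        (fun t h0 h1 => hv _ (by omega)) fun t t' h0 hlt h1 => hne _ _ (by omega) (by omega)
    have hQj : u.mem 12 (u.reg 13) = Q^[j + 1] (K * M + i) := by
      rw [u12, u13, ← Function.iterate_succ_apply' Q]
    have hnext : Q^[j + 1] (K * M + i) - Q^[j + 1] (K * M + i) / M * M
        = (chain M Q K i (j + 1)).2 := by
      rw [chain, Int.emod_def]
      ring
    have hvj := hv (j + 1) hj1
    have hsucc : ∀ t, t < j + 1 → t < j ∨ t = j := by omega
    generalize hy : Q^[j + 1] (K * M + i) = y at *
    refine ⟨150, Runs.straight hB rfl (by decide) ?_⟩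
    push_cast at hj1
    simp [incr, u16, u6, u14, hQj, hnext]
    refine ⟨abs_le.mpr ⟨by linarith, by linarith⟩, abs_le.mpr ⟨by linarith, by linarith⟩,
      abs_le.mpr ⟨by linarith, by linarith⟩, j + 1, by push_cast; linarith,
      by push_cast; linarith, by push_cast; ring, u12, hy.symm, rfl, fun t ht => ?_, fun t ht => ?_,
      fun w => ?_⟩
    · rcases hsucc t ht with h | rfl
      · rw [Function.update_of_ne (by omega)]
        exact hseq t h
      · exact Function.update_self _ _ _
    · rcases hsucc t ht with h | rfl
      · rw [Function.update_of_ne (hne t j h (by omega))]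
        exact hvis t h
      · exact Function.update_self _ _ _
    · by_cases hw : w = (chain M Q K i j).2
      · exact .inr ⟨j, by omega, hw⟩
      · rw [Function.update_of_ne hw]
        exact (hvis' w).imp_right fun ⟨t, ht, h⟩ => ⟨t, by omega, h⟩
  · refine ⟨0, by simp, by simp; omega, by simpa using h16, ?_, ?_, ?_, ?_, by simp, by simp, ?_⟩
    · rw [f₃.1 6 rfl, f₂.1 6 rfl, f₁.1 6 rfl, h6]
    · rw [m₃, hQ]
    · rw [f₃.1 13 rfl, f₂.1 13 rfl, h13]; rfl
    · rw [f₃.1 14 rfl, h14, chain_zero hi0 hi1]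
    · exact fun w => .inl (by rw [m₃, h18])
  · simp
  · rintro s' - - ⟨φ, ⟨j, -, hj, u16, u6, u12, u13, u14, hseq, hvis, hvis'⟩, hnot⟩
    simp only [Test.Holds, Expr.eval, u14] at hnot
    obtain ⟨a, ha, heq⟩ := (hvis' (chain M Q K i j).2).resolve_left hnot
    refine ⟨a, j, ha, hj, heq.symm, fun t t' hlt hlt' heq => ?_, u16, u14, ?_, hseq⟩
    · have h1 := hvis t (by omega)
      have h2 := hvis t' hlt'
      rw [heq] at h1
      omega
    · rw [heq]; exact hvis a ha

theorem runs_writeCycle {B : ℕ} {E : ℤ → ℤ → Prop} {M K i : ℤ} {D : ℤ → ℤ → ℤ} {Q : ℤ → ℤ}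
    {s : State} (hB : 2 ≤ B) (h6 : s.reg 6 = M) (h9 : s.reg 9 = K) (h12 : s.reg 12 = i)
    (hQ : s.mem 12 = Q) (h18 : ∀ x, s.mem 18 x = 0) (hK : 0 ≤ K) (hi0 : 0 ≤ i) (hi1 : i < M)
    (hT : IsTable E M K D Q) (hD : M ≤ D K i + K) (hMB : (K + 1) * M ≤ B) :
    Runs B writeCycle s (400 * (M + 1)) fun s' => ∃ a b : ℕ, a < b ∧ (b : ℤ) ≤ M ∧
      (chain M Q K i a).2 = (chain M Q K i b).2 ∧
      (∀ t t', t < t' → t' < b → (chain M Q K i t).2 ≠ (chain M Q K i t').2) ∧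
      s'.reg 4 = (b : ℤ) - a ∧
      ∀ t, t < b - a → s'.mem 3 (t : ℤ) = s.mem 7 (chain M Q K i (b - t)).2 := by
  have hMB' : M ≤ B := by nlinarith
  refine Runs.seq (runs_followParents hB h6 h9 h12 hQ h18 hK hi0 hi1 hT hD hMB)
    (T₂ := 200 * (M + 1)) ?_ (by linarith)
  rintro s₁ - f₁ ⟨a, b, hab, hbM, heq, hinj, h16, h14, hvis, hseq⟩
  have hab' : (a : ℤ) < b := by exact_mod_cast hab
  have ha0 : (0 : ℤ) ≤ a := by positivity
  refine Runs.seq (T₁ := 5) (T₂ := 200 * M + 190)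
    (Q := fun u => (∀ t, t ≤ b → u.mem 17 (t : ℤ) = (chain M Q K i t).2) ∧ u.mem 18 = s₁.mem 18)
    (Runs.straight hB rfl (by decide) ?_) ?_ (by linarith)
  · simp [h16, h14]
    intro t ht
    rcases ht.lt_or_eq with h | rfl
    · rw [Function.update_of_ne (by omega)]
      exact hseq t h
    · exact Function.update_self _ _ _
  rintro s₂ - f₂ ⟨hseq', m18⟩
  have h16' : s₂.reg 16 = b := (f₂.1 16 rfl).trans h16
  refine Runs.seq (T₁ := 20) (T₂ := 200 * M + 170)
    (Q := fun u => u.reg 4 = (b : ℤ) - a ∧ u.mem = s₂.mem)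
    (Runs.straight hB rfl (by decide) ?_) ?_ (by linarith)
  · simp [h16', f₂.1 14 rfl, h14, m18, hvis]
    exact abs_le.mpr ⟨by linarith, by linarith⟩
  rintro s₃ - f₃ ⟨h4, m₃⟩
  refine Runs.seq (T₁ := 5) (T₂ := 200 * M + 160)
    (Q := fun u => u.reg 11 = 0 ∧ u.mem = s₂.mem)
    (Runs.straight hB rfl (by decide) (by simp [m₃])) ?_ (by linarith)
  rintro s₄ - f₄ ⟨h11, m₄⟩
  refine (Runs.loop hB (φ := 100 * ((b : ℤ) - a)) (fun φ u => ∃ j : ℕ,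
    φ = 100 * ((b : ℤ) - a - j) ∧ (j : ℤ) ≤ b - a ∧ u.reg 11 = j ∧ u.reg 4 = (b : ℤ) - a ∧
    u.reg 16 = b ∧ u.mem 7 = s.mem 7 ∧ u.mem 17 = s₂.mem 17 ∧
    ∀ t, t < j → u.mem 3 (t : ℤ) = s.mem 7 (chain M Q K i (b - t)).2) rfl ?_ ?_ ?_ ?_).mono
    le_rfl ?_
  · rintro φ u ⟨j, rfl, hj, -⟩
    linarith
  · rintro φ u hb ⟨j, rfl, hj, u11, u4, u16, m7, m17, hout⟩ hlt
    simp only [Test.Holds, Expr.eval, u11, u4] at hlt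
    have hcell := hseq' (b - j) (by omega)
    rw [Nat.cast_sub (by omega)] at hcell
    refine ⟨80, Runs.straight hB rfl (by decide) ?_⟩
    simp [incr, u11, u4, u16, m7, m17, hcell]
    refine ⟨abs_le.mpr ⟨by linarith, by linarith⟩, j + 1, by push_cast; linarith,
      by push_cast; linarith, by push_cast; ring, fun t ht => ?_⟩
    rcases Nat.lt_succ_iff_lt_or_eq.mp ht with h | rfl
    · rw [Function.update_of_ne (by omega)]
      exact hout t h
    · exact Function.update_self _ _ _
  · refine ⟨0, by simp, by simp; omega, by simpa using h11, (f₄.1 4 rfl).trans h4, ?_, ?_, ?_, by simp⟩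
    · rw [f₄.1 16 rfl, f₃.1 16 rfl, h16']
    · rw [m₄, f₂.2 7 rfl, f₁.2 7 rfl]
    · rw [m₄]
  · simp; linarith
  · rintro s' - - ⟨φ, ⟨j, -, hj, u11, u4, -, -, -, hout⟩, hnot⟩
    simp only [Test.Holds, Expr.eval, u11, u4, not_lt] at hnot
    exact ⟨a, b, hab, hbM, heq, hinj, u4, fun t ht => hout t (by omega)⟩

/-! ### Topological sorting of the input -/

/-- The edges of the graph with the vertices `0, …, n - 1` that is given by the tails `t` and the
heads `h` of its `m` edges. -/
def InputEdge (m : ℤ) (t h : ℤ → ℤ) (u v : ℤ) : Prop :=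
  ∃ e, 0 ≤ e ∧ e < m ∧ t e = u ∧ h e = v

/-- The vertex `w` is isolated. -/
def Isolated (m : ℤ) (t h : ℤ → ℤ) (w : ℤ) : Prop :=
  ∀ u, ¬ InputEdge m t h u w ∧ ¬ InputEdge m t h w u

/-- Build linked lists of the edges by their tails and count the edges by their heads. -/
def buildLists : Program :=
  .set 11 (.const 0) ;;
  .loop (.lt (.reg 11) (.reg 1))
    (.set 13 (.get 0 (.reg 11)) ;;
     .set 14 (.get 1 (.reg 11)) ;;
     .store 5 (.reg 11) (.get 4 (.reg 13)) ;;
     .store 4 (.reg 13) (.add (.reg 11) (.const 1)) ;;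
     .store 6 (.reg 14) (.add (.get 6 (.reg 14)) (.const 1)) ;;
     incr 11)

/-- Put the vertices without incoming edges into the queue, but only one of the isolated vertices; the
position of that one is shared by all of them. -/
def initQueue : Program :=
  .set 11 (.const 0) ;;
  .set 6 (.const 0) ;;
  .set 7 (.const 0) ;;
  .loop (.lt (.reg 11) (.reg 0))
    (.cond (.eq (.get 6 (.reg 11)) (.const 0))
      (.cond (.eq (.get 4 (.reg 11)) (.const 0))
        (.cond (.eq (.reg 7) (.const 0))
          (.store 7 (.reg 6) (.reg 11) ;; incr 6 ;; .set 7 (.reg 6))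
          .skip ;;
         .store 10 (.reg 11) (.sub (.reg 7) (.const 1)))
        (.store 7 (.reg 6) (.reg 11) ;; .store 10 (.reg 11) (.reg 6) ;; incr 6))
      .skip ;;
     incr 11)

/-- List the edge of register `13`, and put its head into the queue if that was its last incoming
edge. -/
def processEdge : Program :=
  .set 14 (.get 1 (.sub (.reg 13) (.const 1))) ;;
  .store 8 (.reg 8) (.reg 14) ;;
  .store 19 (.reg 8) (.reg 11) ;;
  incr 8 ;;
  .store 6 (.reg 14) (.sub (.get 6 (.reg 14)) (.const 1)) ;;
  .cond (.eq (.get 6 (.reg 14)) (.const 0))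
    (.store 7 (.reg 6) (.reg 14) ;; .store 10 (.reg 14) (.reg 6) ;; incr 6)
    .skip ;;
  .set 13 (.get 5 (.sub (.reg 13) (.const 1)))

/-- Process the queue; the edges are listed by the positions of their tails. -/
def processQueue : Program :=
  .set 11 (.const 0) ;;
  .set 8 (.const 0) ;;
  .loop (.lt (.reg 11) (.reg 6))
    (.set 13 (.get 4 (.get 7 (.reg 11))) ;;
     .loop (.lt (.const 0) (.reg 13)) processEdge ;;
     incr 11) ;;
  .store 19 (.reg 8) (.reg 6)

/-- Replace the heads of the listed edges by their positions. -/
def relabelHeads : Program :=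
  .set 11 (.const 0) ;;
  .loop (.lt (.reg 11) (.reg 8))
    (.store 8 (.reg 11) (.get 10 (.get 8 (.reg 11))) ;;
     incr 11)

theorem runs_buildLists {B : ℕ} {m : ℤ} {s : State} (hB : 2 ≤ B) (h1 : s.reg 1 = m) (hm : 0 ≤ m)
    (h4 : ∀ x, s.mem 4 x = 0) (h6 : ∀ x, s.mem 6 x = 0) (hmB : m ≤ B) :
    Runs B buildLists s (100 * (m + 1)) fun s' =>
      (∃ L, Filled m (s.mem 0) (s'.mem 4) (s'.mem 5) L) ∧
      ∀ w, s'.mem 6 w = ((Finset.Ico 0 m).filter fun e => s.mem 1 e = w).card := by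
  refine Runs.seq (T₁ := 5) (T₂ := 100 * m + 90) (Q := fun u => u.reg 11 = 0 ∧ u.mem = s.mem)
    (Runs.straight hB rfl (by decide) (by simp)) ?_ (by linarith)
  rintro s₁ - f₁ ⟨h11, m₁⟩
  refine (Runs.loop hB (φ := 100 * m) (fun φ u => ∃ j, φ = 100 * (m - j) ∧ 0 ≤ j ∧ j ≤ m ∧
    u.reg 11 = j ∧ u.reg 1 = m ∧ u.mem 0 = s.mem 0 ∧ u.mem 1 = s.mem 1 ∧
    (∃ L, Filled j (s.mem 0) (u.mem 4) (u.mem 5) L) ∧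
    ∀ w, u.mem 6 w = ((Finset.Ico 0 j).filter fun e => s.mem 1 e = w).card) rfl ?_ ?_ ?_ ?_).mono
    le_rfl ?_
  · rintro φ u ⟨j, rfl, h0, h1, -⟩
    linarith
  · rintro φ u hb ⟨j, rfl, j0, -, u11, u1, m0, m1, ⟨L, hL⟩, hdeg⟩ hlt
    simp only [Test.Holds, Expr.eval, u11, u1] at hlt
    have hins : insert j (Finset.Ico 0 j) = Finset.Ico 0 (j + 1) := by ext; simp; omega
    have hstep : ∀ w, Function.update (u.mem 6) (s.mem 1 j) (u.mem 6 (s.mem 1 j) + 1) w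
        = ((Finset.Ico 0 (j + 1)).filter fun e => s.mem 1 e = w).card := by
      intro w
      rw [← hins, Finset.filter_insert]
      by_cases hw : s.mem 1 j = w
      · rw [← hw, Function.update_self, if_pos rfl, Finset.card_insert_of_notMem (by simp), hdeg]
        push_cast
        rfl
      · rw [Function.update_of_ne (Ne.symm hw), if_neg hw, hdeg]
    have hle : u.mem 6 (s.mem 1 j) ≤ j := by
      rw [hdeg]
      refine le_trans (Int.ofNat_le.mpr (Finset.card_filter_le _ _)) ?_
      simp [j0]
    have hnn : 0 ≤ u.mem 6 (s.mem 1 j) := by rw [hdeg]; positivity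
    refine ⟨90, Runs.straight hB rfl (by decide) ?_⟩
    simp [incr, u11, u1, m0, m1]
    exact ⟨abs_le.mpr ⟨by linarith, by linarith⟩, abs_le.mpr ⟨by linarith, by linarith⟩,
      abs_le.mpr ⟨by linarith, by linarith⟩, by linarith, by linarith, by linarith,
      ⟨_, hL.step j0⟩, hstep⟩
  · refine ⟨0, by ring, le_rfl, hm, h11, (f₁.1 1 rfl).trans h1, by rw [m₁], by rw [m₁],
      ⟨fun _ => [], ?_⟩, ?_⟩
    · rw [m₁]
      exact ⟨fun x => h4 x, by simp, by simp; omega⟩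
    · simp [m₁, h6]
  · simp
  · rintro s' - - ⟨φ, ⟨j, -, j0, j1, u11, u1, -, -, hL, hdeg⟩, hnot⟩
    simp only [Test.Holds, Expr.eval, u11, u1, not_lt] at hnot
    obtain rfl : j = m := by omega
    exact ⟨hL, hdeg⟩

/-- The invariant of Kahn's algorithm. The vertices at the positions below `f` of the queue `O` of
length `b` have been processed, and the edges in `P` have been listed; their tails stand at positions
below `g`. The vertex `z` may still have to be put into the queue. -/
structure KahnInv (n m : ℤ) (t h : ℤ → ℤ) (z f g b c ρ : ℤ) (O p deg T H : ℤ → ℤ) (P : Finset ℤ) :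
    Prop where
  queue : ∀ i, 0 ≤ i → i < b → 0 ≤ O i ∧ O i < n ∧ p (O i) = i ∧ deg (O i) = 0
  isolated : ∀ i, 0 ≤ i → i < b → Isolated m t h (O i) → i = ρ
  sub : ∀ e ∈ P, 0 ≤ e ∧ e < m
  card : c = P.card
  tail : ∀ e ∈ P, ∃ i, 0 ≤ i ∧ i < g ∧ t e = O i
  processed : ∀ e i, 0 ≤ e → e < m → 0 ≤ i → i < f → t e = O i → e ∈ P
  deg_eq : ∀ w, deg w = ((Finset.Ico 0 m \ P).filter fun e => h e = w).card
  pos : ∀ w, 0 ≤ w → w < n → w ≠ z → deg w = 0 → 0 ≤ p w ∧ p w < b ∧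
    (O (p w) = w ∨ (Isolated m t h w ∧ Isolated m t h (O (p w))))
  topo : ∀ e j, 0 ≤ e → e < m → 0 ≤ j → j < b → h e = O j → ∃ i, 0 ≤ i ∧ i < j ∧ t e = O i
  list : ∀ x, 0 ≤ x → x < c → 0 ≤ T x ∧ T x < g ∧ ∃ e ∈ P, t e = O (T x) ∧ h e = H x
  listed : ∀ e ∈ P, ∃ x, 0 ≤ x ∧ x < c ∧ t e = O (T x) ∧ H x = h e
  sorted : ∀ x y, 0 ≤ x → x ≤ y → y < c → T x ≤ T y

section Kahn

variable {n m z f g b c ρ : ℤ} {t h O p deg T H : ℤ → ℤ} {P : Finset ℤ}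

theorem KahnInv.deg_nonneg (hI : KahnInv n m t h z f g b c ρ O p deg T H P) (w : ℤ) : 0 ≤ deg w := by
  rw [hI.deg_eq]; positivity

theorem KahnInv.deg_le (hI : KahnInv n m t h z f g b c ρ O p deg T H P) (hm : 0 ≤ m) (w : ℤ) :
    deg w ≤ m := by
  rw [hI.deg_eq]
  have := (Finset.card_filter_le (Finset.Ico 0 m \ P) fun e => h e = w).trans
    (Finset.card_le_card Finset.sdiff_subset)
  simp at this
  omega

theorem KahnInv.card_le (hI : KahnInv n m t h z f g b c ρ O p deg T H P) (hm : 0 ≤ m) : c ≤ m := by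
  have : P ⊆ Finset.Ico 0 m := fun e he => by simpa using hI.sub e he
  have := Finset.card_le_card this
  rw [hI.card]
  simp at this
  omega

theorem KahnInv.injective (hI : KahnInv n m t h z f g b c ρ O p deg T H P) {i j : ℤ} (hi0 : 0 ≤ i)
    (hi : i < b) (hj0 : 0 ≤ j) (hj : j < b) (hij : O i = O j) : i = j := by
  rw [← (hI.queue i hi0 hi).2.2.1, hij, (hI.queue j hj0 hj).2.2.1]

theorem KahnInv.length_le (hI : KahnInv n m t h z f g b c ρ O p deg T H P) (hn : 0 ≤ n) : b ≤ n :=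
  le_of_injective hn (fun i h0 h1 => ⟨(hI.queue i h0 h1).1, (hI.queue i h0 h1).2.1⟩)
    fun i j h0 hlt h1 heq => hlt.ne (hI.injective h0 (by omega) (by omega) h1 heq)

theorem KahnInv.mem_of_deg_eq_zero (hI : KahnInv n m t h z f g b c ρ O p deg T H P) {e : ℤ}
    (h0 : 0 ≤ e) (h1 : e < m) (hd : deg (h e) = 0) : e ∈ P := by
  rw [hI.deg_eq, Nat.cast_eq_zero, Finset.card_eq_zero] at hd
  by_contra he
  have : e ∈ (Finset.Ico 0 m \ P).filter fun e' => h e' = h e := by simp [h0, h1, he]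
  rw [hd] at this
  simp at this

/-- Listing an edge. -/
theorem KahnInv.process (hI : KahnInv n m t h z f (f + 1) b c ρ O p deg T H P) {e : ℤ}
    (h0 : 0 ≤ e) (h1 : e < m) (he : e ∉ P) (hf0 : 0 ≤ f) (hte : t e = O f)
    (hz : z < 0) :
    KahnInv n m t h (h e) f (f + 1) b (c + 1) ρ O p
      (Function.update deg (h e) (deg (h e) - 1)) (Function.update T c f)
      (Function.update H c (h e)) (insert e P) ∧ ∀ i, 0 ≤ i → i < b → O i ≠ h e := by
  have hnot : ∀ i, 0 ≤ i → i < b → O i ≠ h e := by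
    intro i hi0 hi1 heq
    have hd := (hI.queue i hi0 hi1).2.2.2
    rw [heq] at hd
    exact he (hI.mem_of_deg_eq_zero h0 h1 hd)
  have hc0 : 0 ≤ c := by rw [hI.card]; positivity
  have hsplit : ∀ x, x < c + 1 → x < c ∨ x = c := by omega
  refine ⟨?_, hnot⟩
  constructor
  · intro i hi0 hi1
    rw [Function.update_of_ne (hnot i hi0 hi1)]
    exact hI.queue i hi0 hi1
  · exact hI.isolated
  · intro e' he'
    rcases Finset.mem_insert.mp he' with rfl | he'
    · exact ⟨h0, h1⟩
    · exact hI.sub e' he'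
  · rw [Finset.card_insert_of_notMem he, hI.card]
    push_cast; rfl
  · intro e' he'
    rcases Finset.mem_insert.mp he' with rfl | he'
    · exact ⟨f, hf0, by omega, hte⟩
    · exact hI.tail e' he'
  · intro e' i h0' h1' hi0 hi1 ht
    exact Finset.mem_insert_of_mem (hI.processed e' i h0' h1' hi0 hi1 ht)
  · intro w
    by_cases hw : w = h e
    · subst hw
      have hmem : e ∈ (Finset.Ico 0 m \ P).filter fun e' => h e' = h e := by simp [*]
      have heq : (Finset.Ico 0 m \ insert e P).filter (fun e' => h e' = h e)
          = ((Finset.Ico 0 m \ P).filter fun e' => h e' = h e).erase e := by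
        ext x; simp; tauto
      rw [Function.update_self, heq, Finset.card_erase_of_mem hmem, hI.deg_eq,
        Nat.cast_sub (Finset.card_pos.mpr ⟨e, hmem⟩)]
      rfl
    · have heq : (Finset.Ico 0 m \ insert e P).filter (fun e' => h e' = w)
          = (Finset.Ico 0 m \ P).filter fun e' => h e' = w := by
        ext x
        simp only [Finset.mem_filter, Finset.mem_sdiff, Finset.mem_insert, not_or]
        constructor
        · tauto
        · rintro ⟨⟨hx1, hx2⟩, rfl⟩
          exact ⟨⟨hx1, fun hx => hw (by rw [hx]), hx2⟩, rfl⟩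
      rw [Function.update_of_ne hw, heq, hI.deg_eq]
  · intro w hw0 hw1 hwz hd
    rw [Function.update_of_ne hwz] at hd
    exact hI.pos w hw0 hw1 (by omega) hd
  · exact hI.topo
  · intro x hx0 hx1
    rcases hsplit x hx1 with hx | rfl
    · rw [Function.update_of_ne hx.ne, Function.update_of_ne hx.ne]
      obtain ⟨k0, k1, e', he', k2⟩ := hI.list x hx0 hx
      exact ⟨k0, k1, e', Finset.mem_insert_of_mem he', k2⟩
    · rw [Function.update_self, Function.update_self]
      exact ⟨hf0, by omega, e, Finset.mem_insert_self _ _, hte, rfl⟩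
  · intro e' he'
    rcases Finset.mem_insert.mp he' with rfl | he'
    · exact ⟨c, hc0, by omega, by rw [Function.update_self, hte], Function.update_self _ _ _⟩
    · obtain ⟨x, x0, x1, x2⟩ := hI.listed e' he'
      refine ⟨x, x0, by omega, ?_⟩
      rwa [Function.update_of_ne x1.ne, Function.update_of_ne x1.ne]
  · intro x y hx0 hxy hy
    rcases hsplit y hy with hy | rfl
    · rw [Function.update_of_ne (by omega), Function.update_of_ne (by omega)]
      exact hI.sorted x y hx0 hxy hy
    · rw [Function.update_self]
      rcases hsplit x (by omega) with hx | rfl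
      · rw [Function.update_of_ne hx.ne]
        have := (hI.list x hx0 hx).2.1
        omega
      · rw [Function.update_self]

theorem KahnInv.keep (hI : KahnInv n m t h z f g b c ρ O p deg T H P) (hz : deg z ≠ 0) :
    KahnInv n m t h (-1) f g b c ρ O p deg T H P :=
  { hI with pos := fun w h0 h1 _ hd => hI.pos w h0 h1 (fun hw => hz (hw ▸ hd)) hd }

/-- Putting a vertex into the queue whose incoming edges have all been listed. -/
theorem KahnInv.push (hI : KahnInv n m t h z f g b c ρ O p deg T H P) (hb0 : 0 ≤ b) (hfb : f ≤ b)
    (hgb : g ≤ b) (hz0 : 0 ≤ z) (hz1 : z < n) (hd : deg z = 0) (hz : ∀ i, 0 ≤ i → i < b → O i ≠ z)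
    (hiso : ¬ Isolated m t h z) :
    KahnInv n m t h (-1) f g (b + 1) c ρ (Function.update O b z) (Function.update p z b) deg T H P := by
  have hO : ∀ i, i < b → Function.update O b z i = O i := fun i hi => Function.update_of_ne hi.ne _ _
  have hOb : Function.update O b z b = z := Function.update_self _ _ _
  have hsplit : ∀ i, i < b + 1 → i < b ∨ i = b := by omega
  constructor
  · intro i hi0 hi1
    rcases hsplit i hi1 with hi | rfl
    · rw [hO i hi, Function.update_of_ne (hz i hi0 hi)]
      exact hI.queue i hi0 hi
    · rw [hOb, Function.update_self]
      exact ⟨hz0, hz1, rfl, hd⟩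
  · intro i hi0 hi1
    rcases hsplit i hi1 with hi | rfl
    · rw [hO i hi]
      exact hI.isolated i hi0 hi
    · rw [hOb]
      exact fun h => absurd h hiso
  · exact hI.sub
  · exact hI.card
  · intro e he
    obtain ⟨i, i0, i1, hi⟩ := hI.tail e he
    exact ⟨i, i0, i1, by rw [hO i (by omega), hi]⟩
  · intro e i h0 h1 hi0 hi1 ht
    rw [hO i (by omega)] at ht
    exact hI.processed e i h0 h1 hi0 hi1 ht
  · exact hI.deg_eq
  · intro w hw0 hw1 _ hdw
    by_cases hw : w = z
    · rw [hw, Function.update_self, hOb]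
      exact ⟨hb0, by omega, .inl rfl⟩
    · rw [Function.update_of_ne hw]
      obtain ⟨h1, h2, h3⟩ := hI.pos w hw0 hw1 hw hdw
      rw [hO _ h2]
      exact ⟨h1, by omega, h3⟩
  · intro e j h0 h1 hj0 hj1 hj
    rcases hsplit j hj1 with hj' | rfl
    · rw [hO j hj'] at hj
      obtain ⟨i, i0, i1, hi⟩ := hI.topo e j h0 h1 hj0 hj' hj
      exact ⟨i, i0, i1, by rw [hO i (by omega), hi]⟩
    · rw [hOb] at hj
      obtain ⟨i, i0, i1, hi⟩ := hI.tail e (hI.mem_of_deg_eq_zero h0 h1 (by rw [hj, hd]))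
      exact ⟨i, i0, by omega, by rw [hO i (by omega), hi]⟩
  · intro x hx0 hx1
    obtain ⟨k0, k1, k2⟩ := hI.list x hx0 hx1
    rw [hO _ (by omega)]
    exact ⟨k0, k1, k2⟩
  · intro e he
    obtain ⟨x, x0, x1, x2, x3⟩ := hI.listed e he
    have := (hI.list x x0 x1).2.1
    exact ⟨x, x0, x1, by rw [hO _ (by omega), x2], x3⟩
  · exact hI.sorted

/-- When the queue has been processed in an acyclic graph, no vertex has an unlisted incoming edge. -/
theorem KahnInv.deg_eq_zero (hI : KahnInv n m t h z b g b c ρ O p deg T H P) (hz : z < 0)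
    (hwf : WellFounded (InputEdge m t h)) (ht : ∀ e, 0 ≤ e → e < m → 0 ≤ t e ∧ t e < n) (w : ℤ) :
    deg w = 0 := by
  induction w using hwf.induction with
  | _ w ih =>
    rw [hI.deg_eq, Nat.cast_eq_zero, Finset.card_eq_zero, Finset.filter_eq_empty_iff]
    intro e he hw
    simp only [Finset.mem_sdiff, Finset.mem_Ico] at he
    obtain ⟨⟨h0, h1⟩, hnot⟩ := he
    obtain ⟨t0, t1⟩ := ht e h0 h1
    have hE : InputEdge m t h (t e) w := ⟨e, h0, h1, rfl, hw⟩
    obtain ⟨p0, p1, hp⟩ := hI.pos (t e) t0 t1 (by omega) (ih _ hE)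
    rcases hp with hp | hp
    · exact hnot (hI.processed e _ h0 h1 p0 p1 hp.symm)
    · exact (hp.1 w).2 hE

end Kahn

/-- The queue after the vertices below `v` have been considered; the isolated vertex in the queue
stands at position `r - 1`, if `r` is positive. -/
structure InitInv (m v b r : ℤ) (t h O p deg : ℤ → ℤ) : Prop where
  queue : ∀ i, 0 ≤ i → i < b → 0 ≤ O i ∧ O i < v ∧ p (O i) = i ∧ deg (O i) = 0
  isolated : ∀ i, 0 ≤ i → i < b → Isolated m t h (O i) → i = r - 1
  rep : r = 0 ∨ (0 < r ∧ r ≤ b ∧ Isolated m t h (O (r - 1)))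
  pos : ∀ w, 0 ≤ w → w < v → deg w = 0 → 0 ≤ p w ∧ p w < b ∧
    (O (p w) = w ∨ (Isolated m t h w ∧ Isolated m t h (O (p w))))

section Init

variable {m v b r : ℤ} {t h O p deg : ℤ → ℤ}

theorem InitInv.skip (hI : InitInv m v b r t h O p deg) (hd : deg v ≠ 0) :
    InitInv m (v + 1) b r t h O p deg where
  queue i h0 h1 := by
    obtain ⟨a1, a2, a3⟩ := hI.queue i h0 h1
    exact ⟨a1, by omega, a3⟩
  isolated := hI.isolated
  rep := hI.rep
  pos w h0 h1 hw := by
    rcases (show w ≤ v by omega).lt_or_eq with h | rfl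
    · exact hI.pos w h0 h hw
    · exact absurd hw hd

theorem InitInv.share (hI : InitInv m v b r t h O p deg) (hr : r ≠ 0) (hiso : Isolated m t h v) :
    InitInv m (v + 1) b r t h O (Function.update p v (r - 1)) deg where
  queue i h0 h1 := by
    obtain ⟨a1, a2, a3⟩ := hI.queue i h0 h1
    rw [Function.update_of_ne (by omega)]
    exact ⟨a1, by omega, a3⟩
  isolated := hI.isolated
  rep := hI.rep
  pos w h0 h1 hw := by
    by_cases hwv : w = v
    · obtain ⟨r1, r2, r3⟩ := hI.rep.resolve_left hr
      rw [hwv, Function.update_self]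
      exact ⟨by omega, by omega, .inr ⟨hiso, r3⟩⟩
    · rw [Function.update_of_ne hwv]
      exact hI.pos w h0 (by omega) hw

theorem InitInv.push (hI : InitInv m v b r t h O p deg) (hb : 0 ≤ b) (hv : 0 ≤ v) (hd : deg v = 0)
    {r' : ℤ} (hr' : (Isolated m t h v ∧ r = 0 ∧ r' = b + 1) ∨ (¬ Isolated m t h v ∧ r' = r)) :
    InitInv m (v + 1) (b + 1) r' t h (Function.update O b v) (Function.update p v b) deg := by
  have hO : ∀ i, i < b → Function.update O b v i = O i := fun i hi => Function.update_of_ne hi.ne _ _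
  have hOb : Function.update O b v b = v := Function.update_self _ _ _
  have hsplit : ∀ i, i < b + 1 → i < b ∨ i = b := by omega
  constructor
  · intro i h0 h1
    rcases hsplit i h1 with hi | rfl
    · obtain ⟨a1, a2, a3⟩ := hI.queue i h0 hi
      rw [hO i hi, Function.update_of_ne (by omega)]
      exact ⟨a1, by omega, a3⟩
    · rw [hOb, Function.update_self]
      exact ⟨hv, by omega, rfl, hd⟩
  · intro i h0 h1 hi'
    rcases hsplit i h1 with hi | rfl
    · rw [hO i hi] at hi'
      have := hI.isolated i h0 hi hi'
      rcases hr' with ⟨-, h2, -⟩ | ⟨-, h2⟩ <;> omega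
    · rw [hOb] at hi'
      rcases hr' with ⟨-, -, h2⟩ | ⟨h2, -⟩
      · omega
      · exact absurd hi' h2
  · rcases hr' with ⟨h1, h2, h3⟩ | ⟨h1, h2⟩
    · exact .inr ⟨by omega, by omega, by rw [h3, add_sub_cancel_right, hOb]; exact h1⟩
    · rw [h2]
      refine hI.rep.imp_right fun ⟨r1, r2, r3⟩ => ⟨r1, by omega, ?_⟩
      rwa [hO _ (by omega)]
  · intro w h0 h1 hw
    by_cases hwv : w = v
    · rw [hwv, Function.update_self, hOb]
      exact ⟨hb, by omega, .inl rfl⟩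
    · obtain ⟨a1, a2, a3⟩ := hI.pos w h0 (by omega) hw
      rw [Function.update_of_ne hwv, hO _ a2]
      exact ⟨a1, by omega, a3⟩

end Init

theorem runs_initQueue {B : ℕ} {n m : ℤ} {t h : ℤ → ℤ} {L : ℤ → List ℤ} {s : State} (hB : 2 ≤ B)
    (h0 : s.reg 0 = n) (hn : 0 ≤ n) (hL : Filled m t (s.mem 4) (s.mem 5) L)
    (hdeg : ∀ w, s.mem 6 w = ((Finset.Ico 0 m).filter fun e => h e = w).card) (hnB : n ≤ B) :
    Runs B initQueue s (100 * (n + 1)) fun s' => 0 ≤ s'.reg 6 ∧ ∃ ρ, ∀ T H,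
      KahnInv n m t h (-1) 0 0 (s'.reg 6) 0 ρ (s'.mem 7) (s'.mem 10) (s.mem 6) T H ∅ := by
  have hin : ∀ w, s.mem 6 w = 0 ↔ ∀ e, 0 ≤ e → e < m → h e ≠ w := by
    intro w
    rw [hdeg, Nat.cast_eq_zero, Finset.card_eq_zero, Finset.filter_eq_empty_iff]
    simp
  have hiso : ∀ w, s.mem 6 w = 0 → (s.mem 4 w = 0 ↔ Isolated m t h w) := by
    intro w hw
    rw [hin] at hw
    constructor
    · intro h4 u
      refine ⟨fun ⟨e, e0, e1, _, e2⟩ => hw e e0 e1 e2, fun ⟨e, e0, e1, e2, _⟩ => ?_⟩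
      have hl := hL.linked w
      rw [h4] at hl
      have hmem := (hL.mem w e).mpr ⟨e0, e1, e2⟩
      rw [hl.eq_nil fun i hi => ((hL.mem w i).mp hi).1] at hmem
      simp at hmem
    · intro hi
      by_contra h4
      obtain ⟨l, hl, -⟩ := (hL.linked w).exists_cons h4
      obtain ⟨e0, e1, e2⟩ := (hL.mem w (s.mem 4 w - 1)).mp (by simp [hl])
      exact (hi _).2 ⟨_, e0, e1, e2, rfl⟩
  refine Runs.seq (T₁ := 5) (T₂ := 100 * n + 90) (Q := fun u => u.reg 11 = 0 ∧ u.mem = s.mem)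
    (Runs.straight hB rfl (by decide) (by simp)) ?_ (by linarith)
  rintro s₁ - f₁ ⟨h11, m₁⟩
  refine Runs.seq (T₁ := 5) (T₂ := 100 * n + 80) (Q := fun u => u.reg 6 = 0 ∧ u.mem = s.mem)
    (Runs.straight hB rfl (by decide) (by simp [m₁])) ?_ (by linarith)
  rintro s₂ - f₂ ⟨h6, m₂⟩
  refine Runs.seq (T₁ := 5) (T₂ := 100 * n + 70) (Q := fun u => u.reg 7 = 0 ∧ u.mem = s.mem)
    (Runs.straight hB rfl (by decide) (by simp [m₂])) ?_ (by linarith)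
  rintro s₃ - f₃ ⟨h7, m₃⟩
  refine (Runs.loop hB (φ := 100 * n) (fun φ u => ∃ v b r, φ = 100 * (n - v) ∧ 0 ≤ v ∧ v ≤ n ∧
    0 ≤ b ∧ b ≤ v ∧ u.reg 11 = v ∧ u.reg 0 = n ∧ u.reg 6 = b ∧ u.reg 7 = r ∧
    u.mem 4 = s.mem 4 ∧ u.mem 6 = s.mem 6 ∧
    InitInv m v b r t h (u.mem 7) (u.mem 10) (s.mem 6)) rfl ?_ ?_ ?_ ?_).mono le_rfl ?_
  · rintro φ u ⟨v, b, r, rfl, v0, v1, -⟩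
    linarith
  · rintro φ u hb ⟨v, b, r, rfl, v0, -, b0, hbv, u11, u0, u6, u7, m4, m6, hI⟩ hlt
    simp only [Test.Holds, Expr.eval, u11, u0] at hlt
    have a1 : |v + 1| ≤ (B : ℤ) := abs_le.mpr ⟨by linarith, by linarith⟩
    have a2 : |b + 1| ≤ (B : ℤ) := abs_le.mpr ⟨by linarith, by linarith⟩
    refine ⟨90, Runs.straight hB rfl (by decide) ?_⟩
    simp [incr, u11, u0, u6, u7, m4, m6]
    refine ⟨fun hd => ⟨fun h4 => ⟨fun hr => ?_, fun hr => ?_⟩, fun h4 => ?_⟩, fun hd => ?_⟩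
    · have hI' := hI.push b0 v0 hd (.inl ⟨(hiso v hd).mp h4, hr, rfl⟩)
      exact ⟨a2, abs_le.mpr ⟨by linarith, by linarith⟩, a1, by linarith, by linarith, by linarith,
        by linarith, hbv, hI'⟩
    · obtain ⟨r1, r2, -⟩ := hI.rep.resolve_left hr
      exact ⟨abs_le.mpr ⟨by linarith, by linarith⟩, a1, by linarith, by linarith, by linarith,
        b0, by linarith, hI.share hr ((hiso v hd).mp h4)⟩
    · have hI' := hI.push b0 v0 hd (.inr ⟨fun hi => h4 ((hiso v hd).mpr hi), rfl⟩)
      exact ⟨a2, a1, by linarith, by linarith, by linarith, by linarith, hbv, hI'⟩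
    · exact ⟨a1, by linarith, by linarith, by linarith, b0, by linarith, hI.skip hd⟩
  · refine ⟨0, 0, 0, by ring, le_rfl, hn, le_rfl, le_rfl, ?_, ?_, ?_, h7, ?_, ?_, ?_⟩
    · rw [f₃.1 11 rfl, f₂.1 11 rfl, h11]
    · rw [f₃.1 0 rfl, f₂.1 0 rfl, f₁.1 0 rfl, h0]
    · rw [f₃.1 6 rfl, h6]
    · rw [m₃]
    · rw [m₃]
    · exact ⟨by omega, by omega, .inl rfl, by omega⟩
  · simp
  · rintro s' - - ⟨φ, ⟨v, b, r, -, v0, v1, b0, hbv, u11, u0, u6, u7, m4, m6, hI⟩, hnot⟩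
    simp only [Test.Holds, Expr.eval, u11, u0, not_lt] at hnot
    obtain rfl : v = n := by omega
    rw [u6]
    refine ⟨b0, r - 1, fun T H => ⟨hI.queue, hI.isolated, by simp, by simp, by simp, by omega,
      by simpa using hdeg, fun w w0 w1 _ hw => hI.pos w w0 w1 hw, fun e j e0 e1 j0 j1 he => ?_,
      by omega, by simp, by omega⟩⟩
    exact absurd he ((hin _).mp (hI.queue j j0 j1).2.2.2 e e0 e1)

/-- The state in Kahn's algorithm, before the remaining edges `l` with tail at position `f` are
processed. -/
def KahnState (n m : ℤ) (t h : ℤ → ℤ) (f g ρ : ℤ) (L : ℤ → List ℤ) (nx : ℤ → ℤ) (P : Finset ℤ)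
    (s : State) : Prop :=
  KahnInv n m t h (-1) f g (s.reg 6) (s.reg 8) ρ (s.mem 7) (s.mem 10) (s.mem 6) (s.mem 19) (s.mem 8) P ∧
    s.reg 11 = f ∧ 0 ≤ s.reg 6 ∧ s.mem 1 = h ∧ s.mem 5 = nx ∧ Filled m t (s.mem 4) nx L

theorem runs_processEdge {B : ℕ} {n m f ρ e : ℤ} {t h nx : ℤ → ℤ} {L : ℤ → List ℤ} {P : Finset ℤ}
    {s : State} (hB : 2 ≤ B) (hs : KahnState n m t h f (f + 1) ρ L nx P s) (hn : 0 ≤ n) (hm : 0 ≤ m)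
    (hf0 : 0 ≤ f) (hfb : f < s.reg 6) (h13 : s.reg 13 = e + 1) (e0 : 0 ≤ e) (e1 : e < m)
    (he : e ∉ P) (hte : t e = s.mem 7 f) (hh : 0 ≤ h e ∧ h e < n) (hnB : n ≤ B) (hmB : m ≤ B) :
    Runs B processEdge s 90 fun s' => KahnState n m t h f (f + 1) ρ L nx (insert e P) s' ∧
      s'.reg 8 = s.reg 8 + 1 ∧ s'.reg 13 = nx e ∧ s'.mem 7 f = s.mem 7 f ∧ f < s'.reg 6 := by
  obtain ⟨hI, h11, b0, m1, m5, hL⟩ := hs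
  have hc := hI.card_le hm
  have hc0 : 0 ≤ s.reg 8 := by rw [hI.card]; positivity
  have hbn := hI.length_le hn
  have hdeg0 := hI.deg_nonneg (h e)
  have hdeg1 := hI.deg_le hm (h e)
  obtain ⟨hI', hne⟩ := hI.process e0 e1 he hf0 hte (by norm_num)
  have hc' := hI'.card_le hm
  have hd0' := hI'.deg_nonneg (h e)
  rw [Function.update_self] at hd0'
  have hiso : ¬ Isolated m t h (h e) := fun hi => (hi (t e)).1 ⟨e, e0, e1, rfl, rfl⟩
  have a1 : |s.reg 8 + 1| ≤ (B : ℤ) := abs_le.mpr ⟨by linarith, by linarith⟩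
  have a2 : |s.mem 6 (h e) - 1| ≤ (B : ℤ) := abs_le.mpr ⟨by linarith, by linarith⟩
  refine Runs.straight hB rfl (by decide) ?_
  simp [processEdge, incr, KahnState, h11, h13, m1, m5, hL]
  refine ⟨a1, a2, fun hd => ?_, fun hd => ?_⟩
  · have hI'' := hI'.push b0 hfb.le hfb hh.1 hh.2 (by rw [Function.update_self]; exact hd) hne hiso
    have hbn' := hI''.length_le hn
    exact ⟨abs_le.mpr ⟨by linarith, by linarith⟩, ⟨hI'', by linarith⟩,
      Function.update_of_ne hfb.ne _ _, by linarith⟩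
  · exact ⟨⟨hI'.keep (by rw [Function.update_self]; exact hd), b0⟩, hfb⟩

theorem KahnInv.next {n m f b c ρ : ℤ} {t h O p deg T H : ℤ → ℤ} {P : Finset ℤ}
    (hI : KahnInv n m t h (-1) f (f + 1) b c ρ O p deg T H P)
    (hf : ∀ e, 0 ≤ e → e < m → t e = O f → e ∈ P) :
    KahnInv n m t h (-1) (f + 1) (f + 1) b c ρ O p deg T H P :=
  { hI with
    processed := fun e i e0 e1 i0 i1 ht => by
      rcases (show i ≤ f by omega).lt_or_eq with hi | rfl
      · exact hI.processed e i e0 e1 i0 hi ht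
      · exact hf e e0 e1 ht }

theorem KahnInv.widen {n m f b c ρ : ℤ} {t h O p deg T H : ℤ → ℤ} {P : Finset ℤ}
    (hI : KahnInv n m t h (-1) f f b c ρ O p deg T H P) :
    KahnInv n m t h (-1) f (f + 1) b c ρ O p deg T H P :=
  { hI with
    tail := fun e he => (hI.tail e he).imp fun i hi => ⟨hi.1, by omega, hi.2.2⟩
    list := fun x x0 x1 => by
      obtain ⟨k0, k1, k2⟩ := hI.list x x0 x1
      exact ⟨k0, by omega, k2⟩ }

theorem runs_processQueue {B : ℕ} {n m ρ : ℤ} {t h : ℤ → ℤ} {L : ℤ → List ℤ} {s : State} (hB : 2 ≤ B)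
    (hn : 0 ≤ n) (hm : 0 ≤ m) (hb0 : 0 ≤ s.reg 6) (hh : s.mem 1 = h)
    (hL : Filled m t (s.mem 4) (s.mem 5) L)
    (hI : ∀ T H, KahnInv n m t h (-1) 0 0 (s.reg 6) 0 ρ (s.mem 7) (s.mem 10) (s.mem 6) T H ∅)
    (hhn : ∀ e, 0 ≤ e → e < m → 0 ≤ h e ∧ h e < n) (hnB : n ≤ B) (hmB : m ≤ B) :
    Runs B processQueue s (200 * (n + m + 1)) fun s' => ∃ T P, 0 ≤ s'.reg 6 ∧
      KahnInv n m t h (-1) (s'.reg 6) (s'.reg 6) (s'.reg 6) (s'.reg 8) ρ (s'.mem 7) (s'.mem 10)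
        (s'.mem 6) T (s'.mem 8) P ∧ s'.mem 19 = Function.update T (s'.reg 8) (s'.reg 6) := by
  refine Runs.seq (T₁ := 5) (T₂ := 200 * (n + m) + 190)
    (Q := fun u => u.reg 11 = 0 ∧ u.mem = s.mem)
    (Runs.straight hB rfl (by decide) (by simp)) ?_ (by linarith)
  rintro s₁ - f₁ ⟨h11, m₁⟩
  refine Runs.seq (T₁ := 5) (T₂ := 200 * (n + m) + 180)
    (Q := fun u => u.reg 8 = 0 ∧ u.mem = s.mem)
    (Runs.straight hB rfl (by decide) (by simp [m₁])) ?_ (by linarith)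
  rintro s₂ - f₂ ⟨h8, m₂⟩
  refine Runs.seq (T₁ := 200 * (n + m) + 10) (T₂ := 10) (Q := fun u => ∃ P,
    KahnState n m t h (u.reg 6) (u.reg 6) ρ L (s.mem 5) P u) ?_ ?_ (by linarith)
  · refine (Runs.loop hB (φ := 200 * (n + m)) (fun φ u => ∃ f P,
      φ = 200 * (n - f + (m - u.reg 8)) ∧ 0 ≤ f ∧ f ≤ u.reg 6 ∧
      KahnState n m t h f f ρ L (s.mem 5) P u) rfl ?_ ?_ ?_ ?_).mono le_rfl ?_
    · rintro φ u ⟨f, P, rfl, f0, f1, hI, -⟩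
      linarith [hI.card_le hm, hI.length_le hn]
    · rintro φ u hb ⟨f, P, rfl, f0, -, hI, u11, b0, m1, m5, hL⟩ hlt
      simp only [Test.Holds, Expr.eval, u11] at hlt
      have hc := hI.card_le hm
      have hL' := hL
      obtain ⟨hlink, hnd, hmem⟩ := hL
      have hPf : ∀ e ∈ P, t e ≠ u.mem 7 f := by
        intro e he heq
        obtain ⟨i, i0, i1, hi⟩ := hI.tail e he
        have := hI.injective i0 (by omega) f0 hlt (hi.symm.trans heq)
        omega
      obtain ⟨x, hx⟩ : ∃ x, u.mem 7 f = x := ⟨_, rfl⟩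
      have hlen : u.reg 8 + (L x).length ≤ m := by
        have hdisj : Disjoint P (L x).toFinset := by
          rw [Finset.disjoint_left]
          intro e he hel
          exact hPf e he (by rw [hx]; exact ((hmem x e).mp (List.mem_toFinset.mp hel)).2.2)
        have hsub : P ∪ (L x).toFinset ⊆ Finset.Ico 0 m := by
          intro e he
          rcases Finset.mem_union.mp he with he | he
          · simpa using hI.sub e he
          · obtain ⟨e0, e1, -⟩ := (hmem x e).mp (List.mem_toFinset.mp he)
            simp [e0, e1]
        have := Finset.card_le_card hsub
        rw [Finset.card_union_of_disjoint hdisj, List.toFinset_card_of_nodup (hnd x)] at this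
        rw [hI.card]
        simp at this
        omega
      refine ⟨150 * (L x).length + 40, ?_⟩
      refine Runs.seq (T₁ := 10) (T₂ := 150 * (L x).length + 30)
        (Q := fun w => w.reg 13 = u.mem 4 x ∧ w.mem = u.mem)
        (Runs.straight hB rfl (by decide) (by simp [u11, hx])) ?_ (by linarith)
      rintro u₁ - g₁ ⟨k13, n₁⟩
      refine Runs.seq (T₁ := 150 * (L x).length + 10) (T₂ := 20) (Q := fun w => ∃ P',
        KahnState n m t h f (f + 1) ρ L (s.mem 5) P' w ∧ f < w.reg 6 ∧
        w.reg 8 = u.reg 8 + (L x).length ∧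
        ∀ e, 0 ≤ e → e < m → t e = w.mem 7 f → e ∈ P') ?_ ?_ (by linarith)
      · refine (Runs.loop hB (φ := 150 * (L x).length) (fun φ w => ∃ (l : List ℤ) (P' : Finset ℤ),
          φ = 150 * l.length ∧ KahnState n m t h f (f + 1) ρ L (s.mem 5) P' w ∧ f < w.reg 6 ∧
          w.reg 8 + l.length = u.reg 8 + (L x).length ∧ w.mem 7 f = x ∧
          Linked (s.mem 5) (w.reg 13) l ∧ l.Nodup ∧
          (∀ e ∈ l, 0 ≤ e ∧ e < m ∧ t e = x ∧ e ∉ P') ∧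
          ∀ e, 0 ≤ e → e < m → t e = x → e ∈ P' ∨ e ∈ l) rfl ?_ ?_ ?_ ?_).mono le_rfl ?_
        · rintro φ w ⟨l, P', rfl, -⟩
          positivity
        · rintro φ w hbw ⟨l, P', rfl, hk, hfw, h8, h7, hlk, hndl, hl, hl'⟩ hpos
          simp only [Test.Holds, Expr.eval] at hpos
          cases l with
          | nil =>
            have : w.reg 13 = 0 := hlk
            omega
          | cons e l =>
            obtain ⟨h13, hlk⟩ := hlk
            obtain ⟨e0, e1, e2, e3⟩ := hl e (by simp)
            rw [List.nodup_cons] at hndl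
            refine ⟨90, (runs_processEdge hB hk hn hm f0 hfw h13 e0 e1 e3 (by rw [h7, e2])
              (hhn e e0 e1) hnB hmB).mono le_rfl ?_⟩
            rintro w' - - ⟨hk', h8', h13', h7', hfw'⟩
            refine ⟨_, ?_, l, _, rfl, hk', hfw', ?_, by rw [h7', h7], by rw [h13']; exact hlk,
              hndl.2, fun e' he' => ?_, fun e' e0' e1' e2' => ?_⟩
            · simp
              linarith
            · rw [h8', ← h8]
              simp
              ring
            · obtain ⟨a1, a2, a3, a4⟩ := hl e' (by simp [he'])
              refine ⟨a1, a2, a3, ?_⟩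
              rw [Finset.mem_insert, not_or]
              exact ⟨fun h => hndl.1 (h ▸ he'), a4⟩
            · rcases hl' e' e0' e1' e2' with h | h
              · exact .inl (Finset.mem_insert_of_mem h)
              · rcases List.mem_cons.mp h with rfl | h
                · exact .inl (Finset.mem_insert_self _ _)
                · exact .inr h
        · refine ⟨L x, P, rfl, ⟨?_, (g₁.1 11 rfl).trans u11, ?_, by rw [n₁, m1], by rw [n₁, m5],
            by rw [n₁]; exact hL'⟩, ?_, by rw [g₁.1 8 rfl], by rw [n₁, hx], ?_, hnd x,
            fun e he => ?_, fun e e0 e1 e2 => .inr ((hmem x e).mpr ⟨e0, e1, e2⟩)⟩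
          · rw [g₁.1 6 rfl, g₁.1 8 rfl, n₁]
            exact hI.widen
          · rw [g₁.1 6 rfl]; exact b0
          · rw [g₁.1 6 rfl]; exact hlt
          · rw [k13]; exact hlink x
          · obtain ⟨a1, a2, a3⟩ := (hmem x e).mp he
            exact ⟨a1, a2, a3, fun h => hPf e h (by rw [hx, a3])⟩
        · simp
        · rintro w - - ⟨φ, ⟨l, P', -, hk, hfw, h8, h7, hlk, hndl, hl, hl'⟩, hnot⟩
          simp only [Test.Holds, Expr.eval, not_lt] at hnot
          cases l with
          | nil =>
            refine ⟨P', hk, hfw, by simpa using h8, fun e e0 e1 e2 => ?_⟩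
            simpa using hl' e e0 e1 (by rw [e2, h7])
          | cons e l =>
            have := hlk.1
            have := (hl e (by simp)).1
            omega
      rintro u₂ - g₂ ⟨P', ⟨hI', k11, b0', k1, k5, hL''⟩, hfb, k8, hcomp⟩
      have hbn := hI'.length_le hn
      refine Runs.straight hB rfl (by decide) ?_
      simp [incr, k11, KahnState, k1, k5, hL'', k8]
      rw [← k8]
      exact ⟨abs_le.mpr ⟨by linarith, by linarith⟩, by linarith, by linarith, hfb, ⟨P',
        hI'.next hcomp⟩, b0'⟩
    · refine ⟨0, ∅, ?_, le_rfl, ?_, ?_⟩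
      · rw [h8]; ring
      · rw [f₂.1 6 rfl, f₁.1 6 rfl]; exact hb0
      · refine ⟨?_, (f₂.1 11 rfl).trans h11, ?_, by rw [m₂, hh], by rw [m₂], by rw [m₂]; exact hL⟩
        · rw [f₂.1 6 rfl, f₁.1 6 rfl, h8, m₂]; exact hI _ _
        · rw [f₂.1 6 rfl, f₁.1 6 rfl]; exact hb0
    · simp
    · rintro u - - ⟨φ, ⟨f, P, -, f0, f1, hk⟩, hnot⟩
      simp only [Test.Holds, Expr.eval, hk.2.1, not_lt] at hnot
      obtain rfl : f = u.reg 6 := by omega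
      exact ⟨P, hk⟩
  · rintro u - - ⟨P, hI, -, b0, -⟩
    refine Runs.straight hB rfl (by decide) ?_
    simp
    exact ⟨b0, u.mem 19, ⟨P, hI⟩, rfl⟩

theorem runs_relabelHeads {B : ℕ} {mm : ℤ} {s : State} (hB : 2 ≤ B) (h8 : s.reg 8 = mm)
    (hm : 0 ≤ mm) (hmB : mm ≤ B) : Runs B relabelHeads s (100 * (mm + 1)) fun s' =>
      ∀ c, 0 ≤ c → c < mm → s'.mem 8 c = s.mem 10 (s.mem 8 c) := by
  refine Runs.seq (T₁ := 5) (T₂ := 100 * mm + 90) (Q := fun u => u.reg 11 = 0 ∧ u.mem = s.mem)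
    (Runs.straight hB rfl (by decide) (by simp)) ?_ (by linarith)
  rintro s₁ - f₁ ⟨h11, m₁⟩
  refine (Runs.loop hB (φ := 100 * mm) (fun φ u => ∃ j, φ = 100 * (mm - j) ∧ 0 ≤ j ∧ j ≤ mm ∧
    u.reg 11 = j ∧ u.reg 8 = mm ∧ u.mem 10 = s.mem 10 ∧
    (∀ c, 0 ≤ c → c < j → u.mem 8 c = s.mem 10 (s.mem 8 c)) ∧
    ∀ c, j ≤ c → u.mem 8 c = s.mem 8 c) rfl ?_ ?_ ?_ ?_).mono le_rfl ?_
  · rintro φ u ⟨j, rfl, h0, h1, -⟩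
    linarith
  · rintro φ u hb ⟨j, rfl, j0, -, u11, u8, m10, hlo, hhi⟩ hlt
    simp only [Test.Holds, Expr.eval, u11, u8] at hlt
    refine ⟨90, Runs.straight hB rfl (by decide) ?_⟩
    simp [incr, u11, u8, m10, hhi j le_rfl]
    refine ⟨abs_le.mpr ⟨by linarith, by linarith⟩, by linarith, by linarith, by linarith,
      fun c c0 c1 => ?_, fun c c0 => ?_⟩
    · rcases c1.lt_or_eq with c1 | rfl
      · rw [Function.update_of_ne (by omega)]
        exact hlo c c0 (by omega)
      · rw [Function.update_self]
    · rw [Function.update_of_ne (by omega)]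
      exact hhi c (by omega)
  · exact ⟨0, by ring, le_rfl, hm, h11, (f₁.1 8 rfl).trans h8, by rw [m₁],
      fun c c0 c1 => by omega, fun c _ => by rw [m₁]⟩
  · simp
  · rintro s' - - ⟨φ, ⟨j, -, j0, j1, u11, u8, -, hlo, -⟩, hnot⟩
    simp only [Test.Holds, Expr.eval, u11, u8, not_lt] at hnot
    obtain rfl : j = mm := by omega
    exact hlo

/-- `E` is the graph `F` on `0, …, n - 1` after a retraction of its vertices: `p` maps them to the
vertices `0, …, M - 1` of `E`, and `O` selects preimages. -/
structure IsReduction (n M : ℤ) (F E : ℤ → ℤ → Prop) (O p : ℤ → ℤ) : Prop where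
  pos : ∀ v, 0 ≤ v → v < n → 0 ≤ p v ∧ p v < M
  vertex : ∀ i, 0 ≤ i → i < M → 0 ≤ O i ∧ O i < n ∧ p (O i) = i
  adj : ∀ u v, 0 ≤ u → u < n → 0 ≤ v → v < n → (F u v ↔ E (p u) (p v))

/-- Sort the vertices topologically and list the edges in the order of their tails. -/
def prepare : Program :=
  buildLists ;; initQueue ;; processQueue ;; relabelHeads

section Reduction

variable {n m b c ρ : ℤ} {t h O p deg T H H' : ℤ → ℤ} {P : Finset ℤ}

/-- At the end, all edges of an acyclic graph are listed, and positions and vertices correspond to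
each other at the ends of edges. -/
theorem KahnInv.complete (hI : KahnInv n m t h (-1) b b b c ρ O p deg T H P)
    (hwf : WellFounded (InputEdge m t h)) (ht : ∀ e, 0 ≤ e → e < m → 0 ≤ t e ∧ t e < n)
    (hh : ∀ e, 0 ≤ e → e < m → 0 ≤ h e ∧ h e < n) {e : ℤ} (e0 : 0 ≤ e) (e1 : e < m) :
    e ∈ P ∧ 0 ≤ p (h e) ∧ p (h e) < b ∧ O (p (h e)) = h e := by
  have hd := hI.deg_eq_zero (by norm_num) hwf ht
  obtain ⟨h0, h1⟩ := hh e e0 e1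
  obtain ⟨p0, p1, hp⟩ := hI.pos (h e) h0 h1 (by omega) (hd _)
  exact ⟨hI.mem_of_deg_eq_zero e0 e1 (hd _), p0, p1,
    hp.resolve_right fun hp => (hp.1 (t e)).1 ⟨e, e0, e1, rfl, rfl⟩⟩

theorem KahnInv.isSortedEdges (hI : KahnInv n m t h (-1) b b b c ρ O p deg T H P)
    (hwf : WellFounded (InputEdge m t h)) (ht : ∀ e, 0 ≤ e → e < m → 0 ≤ t e ∧ t e < n)
    (hh : ∀ e, 0 ≤ e → e < m → 0 ≤ h e ∧ h e < n) (hH : ∀ x, 0 ≤ x → x < c → H' x = p (H x)) :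
    IsSortedEdges (fun i j => ∃ x, 0 ≤ x ∧ x < c ∧ Function.update T c b x = i ∧ H' x = j) b c
      (Function.update T c b) H' where
  topo := by
    rintro i j ⟨x, x0, x1, rfl, rfl⟩
    obtain ⟨T0, T1, e, he, hte, hhe⟩ := hI.list x x0 x1
    obtain ⟨e0, e1⟩ := hI.sub e he
    obtain ⟨-, p0, p1, hp⟩ := hI.complete hwf ht hh e0 e1
    obtain ⟨i, i0, i1, hi⟩ := hI.topo e _ e0 e1 p0 p1 hp.symm
    have := hI.injective i0 (by omega) T0 T1 (hi.symm.trans hte)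
    rw [Function.update_of_ne x1.ne, hH x x0 x1, ← hhe]
    omega
  nonneg := by rw [hI.card]; positivity
  iff _ _ := Iff.rfl
  sorted x y x0 hxy hy := by
    rcases hxy.lt_or_eq with hlt | rfl
    · rw [Function.update_of_ne (by omega)]
      rcases hy.lt_or_eq with hy | rfl
      · rw [Function.update_of_ne (by omega)]
        exact hI.sorted x y x0 hxy hy
      · rw [Function.update_self]
        exact (hI.list x x0 hlt).2.1.le
    · exact le_rfl
  sentinel := Function.update_self _ _ _

theorem KahnInv.isReduction (hI : KahnInv n m t h (-1) b b b c ρ O p deg T H P)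
    (hwf : WellFounded (InputEdge m t h)) (ht : ∀ e, 0 ≤ e → e < m → 0 ≤ t e ∧ t e < n)
    (hh : ∀ e, 0 ≤ e → e < m → 0 ≤ h e ∧ h e < n) (hH : ∀ x, 0 ≤ x → x < c → H' x = p (H x)) :
    IsReduction n b (InputEdge m t h)
      (fun i j => ∃ x, 0 ≤ x ∧ x < c ∧ Function.update T c b x = i ∧ H' x = j) O p where
  pos v v0 v1 := by
    obtain ⟨p0, p1, -⟩ := hI.pos v v0 v1 (by omega) (hI.deg_eq_zero (by norm_num) hwf ht v)
    exact ⟨p0, p1⟩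
  vertex i i0 i1 := by
    obtain ⟨h0, h1, h2, -⟩ := hI.queue i i0 i1
    exact ⟨h0, h1, h2⟩
  adj u v u0 u1 v0 v1 := by
    have hd := hI.deg_eq_zero (by norm_num) hwf ht
    constructor
    · rintro ⟨e, e0, e1, rfl, rfl⟩
      obtain ⟨x, x0, x1, hx, hx'⟩ := hI.listed e (hI.complete hwf ht hh e0 e1).1
      obtain ⟨T0, T1, -⟩ := hI.list x x0 x1
      refine ⟨x, x0, x1, ?_, by rw [hH x x0 x1, hx']⟩
      rw [Function.update_of_ne x1.ne, hx, (hI.queue _ T0 T1).2.2.1]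
    · rintro ⟨x, x0, x1, hx, hx'⟩
      rw [Function.update_of_ne x1.ne] at hx
      obtain ⟨T0, T1, e, he, hte, hhe⟩ := hI.list x x0 x1
      obtain ⟨e0, e1⟩ := hI.sub e he
      obtain ⟨-, p0, p1, hp⟩ := hI.complete hwf ht hh e0 e1
      rw [hH x x0 x1, ← hhe] at hx'
      rw [hx] at hte
      rw [hx'] at hp
      have hu := (hI.pos u u0 u1 (by omega) (hd u)).2.2.resolve_right fun hiso =>
        (hiso.2 (h e)).2 ⟨e, e0, e1, hte, rfl⟩
      have hv := (hI.pos v v0 v1 (by omega) (hd v)).2.2.resolve_right fun hiso =>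
        (hiso.2 (t e)).1 ⟨e, e0, e1, rfl, hp.symm⟩
      exact ⟨e, e0, e1, hte.trans hu, hp.symm.trans hv⟩

/-- All vertices in the queue but one are ends of edges. This is why only one isolated vertex is kept:
a layer of the table costs time proportional to the number of its vertices, and this has to be
`O(m)`. -/
theorem KahnInv.length_le_edges (hI : KahnInv n m t h (-1) b b b c ρ O p deg T H P) (hm : 0 ≤ m)
    (hb : 0 ≤ b) : b ≤ 2 * m + 1 := by
  have hsub : Finset.Ico 0 b ⊆ insert ρ ((Finset.Ico 0 m).image (fun e => p (t e)) ∪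
      (Finset.Ico 0 m).image fun e => p (h e)) := by
    intro i hi
    obtain ⟨i0, i1⟩ := Finset.mem_Ico.mp hi
    by_cases hiso : Isolated m t h (O i)
    · simp [hI.isolated i i0 i1 hiso]
    · simp only [Isolated, InputEdge, not_forall, not_and_or, not_not] at hiso
      obtain ⟨u, ⟨e, e0, e1, -, he⟩ | ⟨e, e0, e1, he, -⟩⟩ := hiso
      all_goals
        refine Finset.mem_insert_of_mem ?_
        rw [← (hI.queue i i0 i1).2.2.1, ← he]
      · exact Finset.mem_union_right _ (Finset.mem_image.mpr ⟨e, by simp [e0, e1], rfl⟩)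
      · exact Finset.mem_union_left _ (Finset.mem_image.mpr ⟨e, by simp [e0, e1], rfl⟩)
  have h1 := Finset.card_le_card hsub
  have h2 := Finset.card_insert_le ρ ((Finset.Ico 0 m).image (fun e => p (t e)) ∪
    (Finset.Ico 0 m).image fun e => p (h e))
  have h3 := Finset.card_union_le ((Finset.Ico 0 m).image fun e => p (t e))
    ((Finset.Ico 0 m).image fun e => p (h e))
  have h4 := Finset.card_image_le (s := Finset.Ico 0 m) (f := fun e => p (t e))
  have h5 := Finset.card_image_le (s := Finset.Ico 0 m) (f := fun e => p (h e))
  simp only [Int.card_Ico] at h1 h2 h3 h4 h5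
  omega

end Reduction

/-- The number `M` of remaining vertices is bounded in terms of the number of edges as well as of
vertices. -/
theorem runs_prepare {B : ℕ} {n m : ℤ} {t h : ℤ → ℤ} {s : State} (hB : 2 ≤ B)
    (h0 : s.reg 0 = n) (h1 : s.reg 1 = m) (m0 : s.mem 0 = t) (m1 : s.mem 1 = h) (hn : 0 ≤ n)
    (hm : 0 ≤ m) (m4 : ∀ x, s.mem 4 x = 0) (m6 : ∀ x, s.mem 6 x = 0)
    (hwf : WellFounded (InputEdge m t h)) (ht : ∀ e, 0 ≤ e → e < m → 0 ≤ t e ∧ t e < n)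
    (hh : ∀ e, 0 ≤ e → e < m → 0 ≤ h e ∧ h e < n) (hnB : n ≤ B) (hmB : m ≤ B) :
    Runs B prepare s (500 * (n + m + 1)) fun s' => ∃ E M mm T H,
      IsSortedEdges E M mm T H ∧ HasGraph M mm T H s' ∧
      IsReduction n M (InputEdge m t h) E (s'.mem 7) (s'.mem 10) ∧
      mm ≤ m ∧ 0 ≤ M ∧ M ≤ n ∧ M ≤ 2 * m + 1 := by
  refine Runs.seq (runs_buildLists hB h1 hm m4 m6 hmB) (T₂ := 400 * (n + m + 1)) ?_ (by linarith)
  rintro s₁ - f₁ ⟨⟨L, hL⟩, hdeg⟩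
  rw [m0] at hL
  rw [m1] at hdeg
  refine Runs.seq (runs_initQueue hB ((f₁.1 0 rfl).trans h0) hn hL hdeg hnB)
    (T₂ := 300 * (n + m + 1)) ?_ (by linarith)
  rintro s₂ - f₂ ⟨hb0, ρ, hI⟩
  refine Runs.seq (runs_processQueue hB hn hm hb0 (h := h) (L := L) (t := t) (ρ := ρ) ?_ ?_ ?_ hh hnB
    hmB) (T₂ := 100 * (n + m + 1)) ?_ (by linarith)
  · rw [f₂.2 1 rfl, f₁.2 1 rfl, m1]
  · rw [f₂.2 4 rfl, f₂.2 5 rfl]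
    exact hL
  · rw [f₂.2 6 rfl]
    exact hI
  rintro s₃ - f₃ ⟨T, P, hb, hI, hT⟩
  have hc := hI.card_le hm
  have hc0 : 0 ≤ s₃.reg 8 := by rw [hI.card]; positivity
  refine (runs_relabelHeads hB rfl hc0 (by linarith)).mono (by linarith) ?_
  rintro s₄ - f₄ hH
  refine ⟨_, s₃.reg 6, s₃.reg 8, _, s₄.mem 8, hI.isSortedEdges hwf ht hh hH,
    ⟨f₄.1 6 rfl, f₄.1 8 rfl, rfl, ?_⟩, ?_, hc, hb, hI.length_le hn, hI.length_le_edges hm hb⟩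
  · rw [f₄.2 19 rfl, hT]
  · rw [f₄.2 7 rfl, f₄.2 10 rfl]
    exact hI.isReduction hwf ht hh hH

/-! ### Forcing cycles and cycles of the constraint digraph -/

section Cycles

variable {V : Type*} {G : Digraph V}

theorem length_cyclicPairs (c : List V) : (cyclicPairs c).length = c.length := by
  simp [cyclicPairs]

theorem sum_cyclicPairs_sub (f : V → ℝ) (c : List V) :
    ((cyclicPairs c).map fun p => f p.2 - f p.1).sum = 0 := by
  have hsub : ∀ l : List (V × V), (l.map fun p => f p.2 - f p.1).sum
      = ((l.map Prod.snd).map f).sum - ((l.map Prod.fst).map f).sum := by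
    intro l
    induction l with
    | nil => simp
    | cons a l ih => simp [ih]; ring
  rw [hsub, cyclicPairs, List.map_fst_zip (by simp), List.map_snd_zip (by simp),
    ((List.rotate_perm c 1).map f).sum_eq, sub_self]

theorem cyclicPairs_reverse_perm (c : List V) :
    (cyclicPairs c.reverse).Perm ((cyclicPairs c).map Prod.swap) := by
  have h : cyclicPairs c.reverse = ((cyclicPairs c).map Prod.swap).reverse.rotate 1 := by
    rw [cyclicPairs, cyclicPairs, List.zip_swap, List.zip_eq_zipWith, List.zip_eq_zipWith,
      List.reverse_zipWith (by simp), List.zipWith_rotate_distrib _ _ _ _ (by simp),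
      List.reverse_rotate, List.rotate_rotate]
    congr 1
    rcases c with _ | ⟨a, _ | ⟨b, c⟩⟩
    · rfl
    · simp
    · rw [List.length_cons, List.length_cons, Nat.mod_eq_of_lt (by omega),
        Nat.sub_add_cancel (by omega)]
      have := List.rotate_length (a :: b :: c).reverse
      simpa using this.symm
  rw [h]
  exact (List.rotate_perm _ _).trans (List.reverse_perm _)

/-- The cyclic pairs of a list that is given by a periodic sequence. -/
theorem cyclicPairs_map_range {L : ℕ} (y : ℕ → V) (hy : y L = y 0) :
    cyclicPairs ((List.range L).map y) = (List.range L).map fun t => (y t, y (t + 1)) := by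
  refine List.ext_getElem (by simp [cyclicPairs]) fun t h1 h2 => ?_
  have ht : t < L := by simpa using h2
  simp only [cyclicPairs, List.getElem_zip, List.getElem_map, List.getElem_range,
    List.getElem_rotate, List.length_map, List.length_range]
  rcases (show t + 1 ≤ L by omega).lt_or_eq with hlt | rfl
  · rw [Nat.mod_eq_of_lt hlt]
  · rw [Nat.mod_self, hy]

open Classical in
/-- The weight of a list of pairs in terms of the number of those that reverse an edge of `G`. -/
theorem sum_constraintWeight (t₁ t₂ : ℝ) (l : List (V × V)) :
    (l.map fun p => constraintWeight G t₁ t₂ p.1 p.2).sum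
      = t₂ * (l.length - l.countP fun p => decide (G.Adj p.2 p.1) : ℝ)
        - t₁ * (l.countP fun p => decide (G.Adj p.2 p.1) : ℕ) := by
  induction l with
  | nil => simp
  | cons a l ih =>
    rw [List.map_cons, List.sum_cons, ih, List.countP_cons, List.length_cons, constraintWeight]
    by_cases h : G.Adj a.2 a.1 <;> simp [h] <;> ring

open Classical in
/-- A satisfying assignment for the thresholds `(q, p)` is a potential for the constraint digraph, so
that no cycle of it has negative weight. -/
theorem mul_countP_le {q p : ℝ} {α : V → ℝ} (hα : IsSatisfying G q p α) {c : List V}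
    (hc : IsSimpleCycle (constraintDigraph G) c) :
    q * ((cyclicPairs c).countP fun p => decide (G.Adj p.2 p.1) : ℕ) ≤
      p * (c.length - ((cyclicPairs c).countP fun p => decide (G.Adj p.2 p.1) : ℕ)) := by
  have h := sum_cyclicPairs_sub α c
  have hle : ((cyclicPairs c).map fun p => α p.2 - α p.1).sum ≤
      ((cyclicPairs c).map fun x => constraintWeight G q p x.1 x.2).sum := by
    refine List.sum_le_sum fun x hx => ?_
    rw [constraintWeight]
    split_ifs with hadj
    · linarith [hα.1 _ _ hadj]
    · exact hα.2 _ _ ((hc.2.2 x hx).resolve_left hadj).2.1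
  rw [h, sum_constraintWeight, length_cyclicPairs] at hle
  linarith

theorem IsForcingCycle.reverse {c : List V} (hc : IsForcingCycle G c) :
    IsSimpleCycle (constraintDigraph G) c.reverse := by
  refine ⟨by simpa using hc.1, by simpa using hc.2.1, fun x hx => ?_⟩
  rw [(cyclicPairs_reverse_perm c).mem_iff, List.mem_map] at hx
  obtain ⟨y, hy, rfl⟩ := hx
  exact (hc.2.2 y hy).imp id fun h => ⟨h.1.symm, h.2.2, h.2.1⟩

open Classical in
theorem countP_reverse (c : List V) :
    ((cyclicPairs c.reverse).countP fun p => decide (G.Adj p.2 p.1)) = edgeCount G c := by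
  rw [(cyclicPairs_reverse_perm c).countP_eq, List.countP_map]
  rfl

theorem IsForcingCycle.edgeCount_add_hopCount {c : List V} (hc : IsForcingCycle G c) :
    edgeCount G c + hopCount G c = c.length := by
  classical
  rw [← length_cyclicPairs c, List.length_eq_countP_add_countP (fun p => decide (G.Adj p.1 p.2)),
    edgeCount, hopCount]
  congr 1
  refine List.countP_congr fun x hx => ?_
  simp only [decide_eq_true_eq]
  exact ⟨fun h => h.2.1, fun h => (hc.2.2 x hx).resolve_left h⟩

theorem IsForcingCycle.mul_edgeCount_le {q p : ℝ} {α : V → ℝ} (hα : IsSatisfying G q p α)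
    {c : List V} (hc : IsForcingCycle G c) : q * edgeCount G c ≤ p * hopCount G c := by
  have h := mul_countP_le hα hc.reverse
  rw [countP_reverse, List.length_reverse, ← hc.edgeCount_add_hopCount] at h
  push_cast at h
  linarith

theorem IsForcingCycle.hopCount_pos {q p : ℝ} {α : V → ℝ} (hq : 0 < q) (hα : IsSatisfying G q p α)
    {c : List V} (hc : IsForcingCycle G c) : 0 < hopCount G c := by
  by_contra h
  have h0 : hopCount G c = 0 := by omega
  have h1 := hc.mul_edgeCount_le hα
  have h2 := hc.edgeCount_add_hopCount
  have h3 : 0 < c.length := List.length_pos_of_ne_nil hc.1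
  rw [h0, Nat.cast_zero, mul_zero] at h1
  have h4 : (0 : ℝ) < edgeCount G c := by exact_mod_cast (by omega : 0 < edgeCount G c)
  nlinarith

/-- A forcing cycle that is tight for a satisfying assignment is, after reversal, a cycle of minimum
mean for all thresholds. -/
theorem IsForcingCycle.isMinCycleMean {q p t₁ t₂ : ℝ} {α : V → ℝ} (hq : 0 < q) (hp : 0 ≤ p)
    (hα : IsSatisfying G q p α) (h₁ : 0 < t₁) (h₂ : 0 < t₂) {c : List V} (hc : IsForcingCycle G c)
    (heq : q * edgeCount G c = p * hopCount G c) :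
    IsMinCycleMean G t₁ t₂ ((q * t₂ - p * t₁) / (q + p)) := by
  classical
  have hmean : ∀ d : List V, meanWeight G t₁ t₂ d =
      (t₂ * (d.length - ((cyclicPairs d).countP fun p => decide (G.Adj p.2 p.1) : ℕ))
        - t₁ * ((cyclicPairs d).countP fun p => decide (G.Adj p.2 p.1) : ℕ)) / d.length := by
    intro d
    rw [meanWeight, sum_constraintWeight, length_cyclicPairs]
  have hlen : ∀ d : List V, d ≠ [] → (0 : ℝ) < d.length := fun d hd => by
    exact_mod_cast List.length_pos_of_ne_nil hd
  constructor
  · refine ⟨c.reverse, hc.reverse, ?_⟩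
    have := hlen _ hc.reverse.1
    rw [hmean, div_eq_div_iff (by linarith) this.ne', countP_reverse, List.length_reverse,
      ← hc.edgeCount_add_hopCount]
    push_cast
    linear_combination (t₁ + t₂) * heq
  · rintro _ ⟨d, hd, rfl⟩
    have h := mul_countP_le hα hd
    rw [hmean, div_le_div_iff₀ (by linarith) (hlen d hd.1)]
    nlinarith

end Cycles

/-! ### Reduced graphs -/

/-- The graph `G` is a blow-up of `E` up to a labeling of vertices: `pos` maps the vertices of `G` to
the vertices `0, …, M - 1` of `E`, and `vtx` selects preimages. -/
structure IsLabeling {V : Type*} (G : Digraph V) (E : ℤ → ℤ → Prop) (M : ℤ) (vtx : ℤ → V)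
    (pos : V → ℤ) : Prop where
  pos_mem : ∀ v, 0 ≤ pos v ∧ pos v < M
  pos_vtx : ∀ i, 0 ≤ i → i < M → pos (vtx i) = i
  adj : ∀ u v, G.Adj u v ↔ E (pos u) (pos v)

section Labeling

variable {V : Type*} {G : Digraph V} {E : ℤ → ℤ → Prop} {M : ℤ} {vtx : ℤ → V} {pos : V → ℤ}

/-- The graphs `G` and `E` have the same satisfiable ratios. For a degenerate `G` this would fail, because
`E` could be satisfied for the ratio `0`, which does not come from positive thresholds. -/
theorem IsLabeling.sat_iff (hG : IsLabeling G E M vtx pos) (hE : IsTopological E M)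
    (hdeg : ¬ IsDegenerate G) (r : ℝ) : Sat E M r ↔ r ∈ satisfiableRatios G := by
  constructor
  · rintro ⟨α, h1, h2⟩
    have hsat : IsSatisfying G 1 r fun v => α (pos v) := by
      refine ⟨fun u v huv => ?_, fun u v huv => ?_⟩
      · linarith [h1 _ _ ((hG.adj u v).mp huv)]
      · obtain ⟨u0, u1⟩ := hG.pos_mem u
        obtain ⟨v0, v1⟩ := hG.pos_mem v
        linarith [h2 _ _ u0 u1 v0 v1 fun h => huv ((hG.adj u v).mpr h)]
    refine ⟨1, r, one_pos, ?_, ⟨_, hsat⟩, (div_one r).symm⟩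
    by_contra hr
    refine hdeg ⟨fun v => α (pos v), fun u v => ⟨fun h => by linarith [hsat.1 u v h], fun h => ?_⟩⟩
    by_contra huv
    linarith [hsat.2 u v huv]
  · rintro ⟨t₁, t₂, h₁, h₂, ⟨α, hα⟩, rfl⟩
    have hadj : ∀ i j, 0 ≤ i → i < M → 0 ≤ j → j < M → (E i j ↔ G.Adj (vtx i) (vtx j)) := by
      intro i j i0 i1 j0 j1
      rw [hG.adj, hG.pos_vtx i i0 i1, hG.pos_vtx j j0 j1]
    refine ⟨fun i => α (vtx i) / t₁, fun i j hij => ?_, fun i j i0 i1 j0 j1 hij => ?_⟩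
    · obtain ⟨h0, hlt, h1⟩ := hE i j hij
      have := hα.1 _ _ ((hadj i j h0 (by omega) (by omega) h1).mp hij)
      rw [div_add_one h₁.ne', div_le_div_iff_of_pos_right h₁]
      linarith
    · have := hα.2 _ _ fun h => hij ((hadj i j i0 i1 j0 j1).mpr h)
      rw [← sub_div, div_le_div_iff_of_pos_right h₁]
      linarith

/-- The labels themselves are a satisfying assignment for the ratio `M`. -/
theorem IsTopological.sat (hE : IsTopological E M) : Sat E M M := by
  refine ⟨fun i => i, fun i j hij => ?_, fun i j i0 i1 j0 j1 hij => ?_⟩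
  · have := (hE i j hij).2.1
    simpa using (by exact_mod_cast this : (i : ℝ) + 1 ≤ j)
  · have : j - M ≤ i := by omega
    simpa using (by exact_mod_cast this : (j : ℝ) - M ≤ i)

theorem IsLabeling.isRatioInf (hG : IsLabeling G E M vtx pos) (hE : IsTopological E M)
    (hdeg : ¬ IsDegenerate G) : IsRatioInf E M (lam G) := by
  have h0 : ∀ r ∈ satisfiableRatios G, 0 ≤ r := by
    rintro r ⟨t₁, t₂, h₁, h₂, -, rfl⟩
    positivity
  refine ⟨Real.sInf_nonneg h0, fun r hr => csInf_le ⟨0, h0⟩ ((hG.sat_iff hE hdeg r).mp hr),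
    fun e l hl he => ?_⟩
  have hl' : (0 : ℝ) < l := by exact_mod_cast hl
  rw [← div_le_iff₀ hl']
  refine le_csInf ⟨_, (hG.sat_iff hE hdeg M).mp hE.sat⟩ fun r hr => ?_
  rw [div_le_iff₀ hl']
  exact he r ((hG.sat_iff hE hdeg r).mpr hr)

end Labeling

/-! ### Optimality of the slope -/

section Optimal

variable {E : ℤ → ℤ → Prop} {M K p q v : ℤ} {D : ℤ → ℤ → ℤ} {Q : ℤ → ℤ} {lam : ℝ}

/-- The test makes the walk with the best slope long enough to visit a vertex twice. -/
theorem IsBestSlope.le_walk (hb : IsBestSlope K M p q v D) (hT : IsTable E M K D Q) (hK : 0 < K)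
    (htest : M * q ≤ K * (q + p)) : M ≤ D K v + K := by
  have h := hb.lower 0 le_rfl hK
  have h0 := hT.nonneg 0 v le_rfl hK.le hb.mem.1 hb.mem.2
  have hq := hb.pos
  refine le_of_mul_le_mul_right (a := q) ?_ hq
  nlinarith

/-- A closed part of the walk with the best slope has at least this slope: without it, the remaining
walk would do better. -/
theorem IsBestSlope.mul_le (hb : IsBestSlope K M p q v D) (hT : IsTable E M K D Q) (hK : 0 < K)
    (htest : M * q ≤ K * (q + p)) {a b : ℕ} (hab : a < b) (hbM : (b : ℤ) ≤ M)
    (heq : (chain M Q K v a).2 = (chain M Q K v b).2) :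
    let x := chain M Q K v
    let e := D (x a).1 (x a).2 - D (x b).1 (x b).2
    let l := (x a).1 - (x b).1
    0 < l ∧ e + l = (b : ℤ) - a ∧ p * l ≤ e * q := by
  intro x e l
  have hM := hb.le_walk hT hK htest
  obtain ⟨h1, h2, h3, h4⟩ : 0 < l ∧ l ≤ K ∧ e + l = (b : ℤ) - a ∧ D K v - e ≤ D (K - l) v :=
    hT.cut hK.le le_rfl hb.mem.1 hb.mem.2 hab (by omega) heq
  refine ⟨h1, h3, ?_⟩
  have h := hb.lower (K - l) (by omega) (by omega)
  rw [sub_sub_cancel] at h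
  exact h.trans (mul_le_mul_of_nonneg_right (by omega) hb.pos.le)

/-- The best slope is satisfiable, and a closed part of its walk shows that no smaller ratio is. -/
theorem IsBestSlope.eq_lam (hb : IsBestSlope K M p q v D) (hT : IsTable E M K D Q) (hK : 0 < K)
    (hE : IsTopological E M) (htest : M * q ≤ K * (q + p)) (hlam : IsRatioInf E M lam) :
    lam = (p : ℝ) / q := by
  refine le_antisymm (hb.lam_le hT hE hK hlam) ?_
  have hM := hb.le_walk hT hK htest
  obtain ⟨a, b, hab, hbM, heq⟩ := hT.exists_repeat hK.le le_rfl hb.mem.1 hb.mem.2 hM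
  obtain ⟨hl, -, hpe⟩ := hb.mul_le hT hK htest hab hbM heq
  have hle := hlam.ge _ _ hl fun r hr =>
    hT.le_of_sat hK.le le_rfl hb.mem.1 hb.mem.2 hab (by omega) heq hr
  have hq : (0 : ℝ) < q := by exact_mod_cast hb.pos
  generalize D (chain M Q K v a).1 (chain M Q K v a).2 -
    D (chain M Q K v b).1 (chain M Q K v b).2 = e at *
  generalize (chain M Q K v a).1 - (chain M Q K v b).1 = l at *
  have hl' : (0 : ℝ) < l := by exact_mod_cast hl
  have hpe' : (p : ℝ) * l ≤ e * q := by exact_mod_cast hpe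
  rw [div_le_iff₀ hq]
  refine le_of_mul_le_mul_right (a := (l : ℝ)) ?_ hl'
  nlinarith

/-- The closed part of the chain, read backwards, is a forcing cycle with the best slope as ratio. -/
theorem IsBestSlope.forcing {V : Type*} {G : Digraph V} {vtx : ℤ → V} {pos : V → ℤ} {α : V → ℝ}
    (hb : IsBestSlope K M p q v D) (hT : IsTable E M K D Q) (hK : 0 < K)
    (hG : IsLabeling G E M vtx pos) (hα : IsSatisfying G q p α)
    (hp : 0 < p) (htest : M * q ≤ K * (q + p)) {a b : ℕ} (hab : a < b) (hbM : (b : ℤ) ≤ M)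
    (heq : (chain M Q K v a).2 = (chain M Q K v b).2)
    (hinj : ∀ t t', t < t' → t' < b → (chain M Q K v t).2 ≠ (chain M Q K v t').2) :
    let c := (List.range (b - a)).map fun t => vtx (chain M Q K v (b - t)).2
    IsForcingCycle G c ∧ (q : ℝ) * edgeCount G c = p * hopCount G c := by
  intro c
  classical
  have hM := hb.le_walk hT hK htest
  have hq := hb.pos
  obtain ⟨hl, hel, hpe⟩ := hb.mul_le hT hK htest hab hbM heq
  have hspec := fun t (ht : t ≤ b) =>
    hT.chain_spec hK.le le_rfl hb.mem.1 hb.mem.2 t (by omega)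
  have hne : ∀ t t', t < t' → t' < b → vtx (chain M Q K v t).2 ≠ vtx (chain M Q K v t').2 := by
    intro t t' h1 h2 h
    obtain ⟨u0, u1⟩ := (hspec t (by omega)).2.1
    obtain ⟨w0, w1⟩ := (hspec t' h2.le).2.1
    have := congrArg pos h
    rw [hG.pos_vtx _ u0 u1, hG.pos_vtx _ w0 w1] at this
    exact hinj t t' h1 h2 this
  -- A closed part of length `1` would consist of a single hop, although the slope is positive.
  have hlen : a + 2 ≤ b := by
    by_contra hlen
    have h1 := mul_pos hp hl
    have h2 := pos_of_mul_pos_left (h1.trans_le hpe) hq.le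
    omega
  have hpairs : cyclicPairs c = (List.range (b - a)).map fun t =>
      (vtx (chain M Q K v (b - t)).2, vtx (chain M Q K v (b - (t + 1))).2) :=
    cyclicPairs_map_range (fun t => vtx (chain M Q K v (b - t)).2) (by
      simp only [Nat.sub_zero, Nat.sub_sub_self hab.le, heq])
  have hstep : ∀ t, t < b - a → IsStep E M K D (chain M Q K v (b - (t + 1)))
      (chain M Q K v (b - t)) := by
    intro t ht
    have := (hspec b le_rfl).2.2.2 (b - (t + 1)) (by omega)
    rwa [show b - (t + 1) + 1 = b - t by omega] at this
  have hadj : ∀ s t, s ≤ b → t ≤ b → (G.Adj (vtx (chain M Q K v s).2) (vtx (chain M Q K v t).2) ↔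
      E (chain M Q K v s).2 (chain M Q K v t).2) := by
    intro s t hs ht
    obtain ⟨u0, u1⟩ := (hspec s hs).2.1
    obtain ⟨w0, w1⟩ := (hspec t ht).2.1
    rw [hG.adj, hG.pos_vtx _ u0 u1, hG.pos_vtx _ w0 w1]
  have hcyc : IsForcingCycle G c := by
    refine ⟨?_, ?_, fun x hx => ?_⟩
    · simp [c]; omega
    · refine List.Nodup.map_on ?_ List.nodup_range
      intro t ht t' ht' h
      rw [List.mem_range] at ht ht'
      -- The start of the closed part is its end, so position `a` may stand for position `b`.
      have key : ∀ s : ℕ, s < b - a → ∃ j, a ≤ j ∧ j < b ∧ (s = 0 ∧ j = a ∨ s ≠ 0 ∧ j + s = b) ∧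
          vtx (chain M Q K v (b - s)).2 = vtx (chain M Q K v j).2 := by
        intro s hs
        rcases Nat.eq_zero_or_pos s with rfl | h0
        · exact ⟨a, le_rfl, hab, .inl ⟨rfl, rfl⟩, by rw [Nat.sub_zero, heq]⟩
        · exact ⟨b - s, by omega, by omega, .inr ⟨by omega, by omega⟩, rfl⟩
      obtain ⟨j, j0, j1, hj, e1⟩ := key t ht
      obtain ⟨j', j0', j1', hj', e2⟩ := key t' ht'
      rw [e1, e2] at h
      have : j = j' := by
        by_contra hjj
        rcases lt_or_gt_of_ne hjj with hlt | hlt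
        · exact hne _ _ hlt j1' h
        · exact hne _ _ hlt j1 h.symm
      omega
    · rw [hpairs, List.mem_map] at hx
      obtain ⟨t, ht, rfl⟩ := hx
      rw [List.mem_range] at ht
      rcases (hstep t ht).step with ⟨-, h, -⟩ | ⟨-, h, -⟩
      · exact .inl ((hadj _ _ (by omega) (by omega)).mpr h)
      · refine or_iff_not_imp_left.mpr fun h' => ⟨?_, h', fun h'' =>
          h ((hadj _ _ (by omega) (by omega)).mp h'')⟩
        rcases Nat.eq_zero_or_pos t with rfl | ht0
        · rw [Nat.sub_zero, ← heq]
          exact hne a (b - 1) (by omega) (by omega)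
        · exact (hne (b - (t + 1)) (b - t) (by omega) (by omega)).symm
  have hcount : ∀ t, t ≤ b - a → D (chain M Q K v (b - t)).1 (chain M Q K v (b - t)).2 -
      D (chain M Q K v b).1 (chain M Q K v b).2 ≤ ((List.range t).map fun t =>
        (vtx (chain M Q K v (b - t)).2, vtx (chain M Q K v (b - (t + 1))).2)).countP
          fun p => decide (G.Adj p.1 p.2) := by
    intro t
    induction t with
    | zero => simp
    | succ t ih =>
      intro ht
      have ih := ih (by omega)
      rw [List.range_succ, List.map_append, List.countP_append]
      rcases (hstep t ht).step with ⟨-, h, h'⟩ | ⟨-, h, h'⟩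
      · rw [← hadj _ _ (by omega) (by omega)] at h
        simp only [List.map_cons, List.map_nil, List.countP_singleton, h, decide_true, if_true]
        push_cast
        omega
      · push_cast
        omega
  refine ⟨hcyc, le_antisymm (hcyc.mul_edgeCount_le hα) ?_⟩
  have h1 := hcount (b - a) le_rfl
  rw [← hpairs, Nat.sub_sub_self hab.le] at h1
  change _ ≤ ((edgeCount G c : ℕ) : ℤ) at h1
  have h2 := hcyc.edgeCount_add_hopCount
  have hcl : c.length = b - a := by simp [c]
  have h3 : (hopCount G c : ℤ) ≤ (chain M Q K v a).1 - (chain M Q K v b).1 := by omega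
  have h4 : p * (hopCount G c : ℤ) ≤ (edgeCount G c : ℤ) * q :=
    (mul_le_mul_of_nonneg_left h3 hp.le).trans (hpe.trans (mul_le_mul_of_nonneg_right h1 hq.le))
  rw [mul_comm (q : ℝ)]
  exact_mod_cast h4

end Optimal

/-! ### The certified output -/

theorem IsMaxBelow.unique {f : ℤ → ℤ} {j x y : ℤ} (hx : IsMaxBelow f j x) (hy : IsMaxBelow f j y) :
    x = y := by
  obtain ⟨⟨k, k0, k1, rfl⟩, h⟩ := hx
  obtain ⟨⟨l, l0, l1, rfl⟩, h'⟩ := hy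
  exact le_antisymm (h' k k0 k1) (h l l0 l1)

/-- Find the ratio of the prepared graph and write the certificates. -/
def solve : Program :=
  findRatio ;; writeAssignment ;; writeCycle

section Solve

variable {n : ℕ} {G : Digraph (Fin n)} {E : ℤ → ℤ → Prop} {M mm : ℤ} {T H : ℤ → ℤ}
  {vtx : ℤ → Fin n} {pos : Fin n → ℤ} {s : State}

/-- The best slope, the assignment by the maxima, and the closed part of the chain are a certified
output. -/
theorem isCertifiedOutput_of_slope {K p q v : ℤ} {D : ℤ → ℤ → ℤ} {Q : ℤ → ℤ} {a b : ℕ}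
    (hb : IsBestSlope K M p q v D) (hT : IsTable E M K D Q) (hK : 0 < K) (hE : IsTopological E M)
    (htest : M * q ≤ K * (q + p)) (hG : IsLabeling G E M vtx pos) (hdeg : ¬ IsDegenerate G)
    (h2 : s.reg 2 = p) (h3 : s.reg 3 = q)
    (hmax : ∀ w : Fin n, IsMaxBelow (fun k => q * D k (pos w) - p * k) K (s.mem 2 ((w : ℕ) : ℤ)))
    (hab : a < b) (hbM : (b : ℤ) ≤ M) (heq : (chain M Q K v a).2 = (chain M Q K v b).2)
    (hinj : ∀ t t', t < t' → t' < b → (chain M Q K v t).2 ≠ (chain M Q K v t').2)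
    (h4 : s.reg 4 = (b : ℤ) - a) (hcyc : ∀ t, t < b - a →
      s.mem 3 (t : ℤ) = ((vtx (chain M Q K v (b - t)).2 : ℕ) : ℤ)) : IsCertifiedOutput G s := by
  have hlam := hb.eq_lam hT hK hE htest (hG.isRatioInf hE hdeg)
  have hmem := (hG.sat_iff hE hdeg _).mp (hT.sat hE hb.pos hb.upper hK)
  have hq : (0 : ℝ) < q := by exact_mod_cast hb.pos
  have hpq : (0 : ℝ) < p / q := by
    obtain ⟨t₁, t₂, h₁, h₂, -, h⟩ := hmem
    rw [h]
    positivity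
  have hp : (0 : ℝ) < p := by
    have := mul_pos hpq hq
    rwa [div_mul_cancel₀ _ hq.ne'] at this
  have hsat : IsSatisfying G (q : ℝ) (p : ℝ) fun w : Fin n => (s.mem 2 ((w : ℕ) : ℤ) : ℝ) := by
    have hval : ∀ w, s.mem 2 ((vtx (pos w) : ℕ) : ℤ) = s.mem 2 ((w : ℕ) : ℤ) := by
      intro w
      have h := hmax (vtx (pos w))
      rw [hG.pos_vtx _ (hG.pos_mem w).1 (hG.pos_mem w).2] at h
      exact h.unique (hmax w)
    obtain ⟨s1, s2⟩ := hT.satisfying hE hb.pos.le hb.upper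
      (α := fun i => s.mem 2 ((vtx i : ℕ) : ℤ)) (by
        intro i i0 i1
        have h := hmax (vtx i)
        rwa [hG.pos_vtx i i0 i1] at h)
    refine ⟨fun u w huw => ?_, fun u w huw => ?_⟩
    · have := s1 _ _ ((hG.adj u w).mp huw)
      simp only [hval] at this
      have : (s.mem 2 ((u : ℕ) : ℤ) : ℝ) + q ≤ s.mem 2 ((w : ℕ) : ℤ) := by exact_mod_cast this
      linarith
    · have := s2 _ _ (hG.pos_mem u).1 (hG.pos_mem u).2 (hG.pos_mem w).1 (hG.pos_mem w).2
        fun h => huw ((hG.adj u w).mpr h)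
      simp only [hval] at this
      have : (s.mem 2 ((w : ℕ) : ℤ) : ℝ) - p ≤ s.mem 2 ((u : ℕ) : ℤ) := by exact_mod_cast this
      linarith
  obtain ⟨hc, hce⟩ := hb.forcing hT hK hG hsat (by exact_mod_cast hp) htest hab hbM heq hinj
  have hhop := hc.hopCount_pos hq hsat
  have hr : ((s.reg 2 : ℝ) / (s.reg 3 : ℝ)) = p / q := by rw [h2, h3]
  refine ⟨by rw [h3]; exact hb.pos, by rw [hr, hlam], ?_, fun t₁ t₂ h₁ h₂ => ?_, ?_, ?_⟩
  · rw [hr]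
    refine ⟨hmem, fun r hrm => ?_⟩
    rw [← hlam]
    exact (hG.isRatioInf hE hdeg).le r ((hG.sat_iff hE hdeg r).mpr hrm)
  · rw [h2, h3]
    exact hc.isMinCycleMean hq hp.le hsat h₁ h₂ hce
  · rw [h2, h3]
    exact hsat
  · refine ⟨(List.range (b - a)).map fun t => vtx (chain M Q K v (b - t)).2, hc, ?_, ?_,
      fun k hk => ?_⟩
    · rw [hlam, cycleRatio, div_eq_div_iff (by exact_mod_cast hhop.ne') hq.ne']
      linarith
    · rw [h4]
      simp
      omega
    · simp only [List.length_map, List.length_range] at hk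
      simp [hcyc k hk]

/-- All stored numbers are polynomial in `n`: there are at most `2 * M + 1` layers, and the entries are at
most `(2 * M + 1) * M`, so that the numbers in the assignment are at most
`2 * M * ((2 * M + 1) * M) ≤ n ^ 6`. -/
theorem runs_solve {N₀ : ℤ} (hn : 2 ≤ n) (hG : IsSortedEdges E M mm T H) (hs : HasGraph M mm T H s)
    (hL : IsLabeling G E M vtx pos) (hdeg : ¬ IsDegenerate G) (hM : 0 < M) (hMn : M ≤ n)
    (hmm : mm ≤ (n : ℤ) ^ 6) (h0 : s.reg 0 = n) (h9 : s.reg 9 = 0)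
    (h7 : ∀ i, 0 ≤ i → i < M → s.mem 7 i = ((vtx i : ℕ) : ℤ))
    (h10 : ∀ w : Fin n, s.mem 10 ((w : ℕ) : ℤ) = pos w)
    (h11 : ∀ x, s.mem 11 x = 0) (h13 : ∀ x, s.mem 13 x = 0)
    (h16 : ∀ x, s.mem 16 x = 0) (h18 : ∀ x, s.mem 18 x = 0) (hN1 : 1 ≤ N₀)
    (hN₀ : ∀ N : ℤ, (N : ℝ) * (1 + lam G) < 2 * M → N ≤ N₀) (hN₀M : N₀ ≤ 2 * M) :
    Runs (n ^ 6) solve s (3000 * (N₀ * (4 * M + mm + 1)) + 300 * (n * N₀ + 1) + 400 * (M + 1))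
      (IsCertifiedOutput G) := by
  have hB : 2 ≤ n ^ 6 := hn.trans (Nat.le_self_pow (by norm_num) n)
  have hn2 : (2 : ℤ) ≤ n := by exact_mod_cast hn
  have hlam := hL.isRatioInf hG.topo hdeg
  have hlamM : lam G ≤ M := hlam.le _ hG.topo.sat
  have hn3 : 8 * (n : ℤ) ^ 3 ≤ n ^ 6 := by
    have : (2 : ℤ) ^ 3 ≤ n ^ 3 := pow_le_pow_left₀ (by norm_num) hn2 3
    nlinarith
  have hMM : (2 * M + 1) * M ≤ (2 * n + 1) * n := by nlinarith
  have hn22 : 2 * (n : ℤ) ≤ n ^ 2 := by nlinarith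
  have hn23 : 2 * (n : ℤ) ^ 2 ≤ n ^ 3 := by nlinarith
  have hsq : (2 * n + 1) * n ≤ 8 * (n : ℤ) ^ 3 := by nlinarith
  have hcube : 2 * n * ((2 * n + 1) * n) ≤ 8 * (n : ℤ) ^ 3 := by nlinarith
  have hn1 : 4 * (n : ℤ) ≤ 8 * (n : ℤ) ^ 3 := by nlinarith
  have hBc : ((n ^ 6 : ℕ) : ℤ) = (n : ℤ) ^ 6 := by push_cast; rfl
  refine Runs.seq (runs_findRatio hB hG hs hM h9 h11 h13 h16 hlam hN1 hN₀ hN₀M (by linarith)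
    (by linarith) (by linarith)) (T₂ := 300 * (n * N₀ + 1) + 400 * (M + 1)) ?_ (by linarith)
  rintro s₁ - f₁ ⟨K, hKN, hopt⟩
  have hK := hopt.pos
  have hsl := hopt.slope
  have hT := hopt.table.table
  have hK0 : (0 : ℝ) ≤ K := by exact_mod_cast hK.le
  have hD : ∀ k i, 0 ≤ k → k ≤ K → 0 ≤ i → i < M → s₁.mem 11 (k * M + i) ≤ (2 * M + 1) * M := by
    intro k i k0 k1 i0 i1
    have h := hT.le_mul_add hlam k0 k1 i0 i1
    have hk : (k : ℝ) ≤ 2 * M := by exact_mod_cast (by omega : k ≤ 2 * M)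
    have hk0 : (0 : ℝ) ≤ k := by exact_mod_cast k0
    have hM' : (0 : ℝ) ≤ M := by exact_mod_cast hM.le
    have : (s₁.mem 11 (k * M + i) : ℝ) ≤ ((2 * M + 1) * M : ℤ) := by
      push_cast
      nlinarith
    exact_mod_cast this
  have hKb : K * ((2 * M + 1) * M) ≤ 2 * n * ((2 * n + 1) * n) :=
    mul_le_mul (by omega) hMM (by positivity) (by positivity)
  have h10' : s₁.mem 10 = s.mem 10 := f₁.2 10 rfl
  obtain ⟨v0, v1⟩ := hsl.mem
  have hposmem : ∀ v : ℤ, 0 ≤ v → v < n → ∃ w : Fin n, ((w : ℕ) : ℤ) = v := fun v w0 w1 =>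
    ⟨⟨v.toNat, by omega⟩, by simp [w0]⟩
  refine Runs.seq (runs_writeAssignment hB (b₀ := (2 * M + 1) * M) ((f₁.1 0 rfl).trans h0)
    hopt.table.graph.reg6 hopt.table.reg9 rfl rfl (by positivity) hK hsl.nonneg ?_ hsl.pos.le hsl.le
    ?_ (fun k i k0 k1 i0 i1 => ⟨hT.nonneg k i k0 k1.le i0 i1, hD k i k0 k1.le i0 i1⟩)
    (by linarith) (by linarith) (by linarith)) (T₂ := 400 * (M + 1)) ?_ ?_
  · obtain ⟨k, k0, k1, hk⟩ := hsl.attained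
    have h1 := hD K _ hK.le le_rfl v0 v1
    have h2 := hT.nonneg k _ k0 k1.le v0 v1
    rw [hk]
    linarith
  · intro v w0 w1
    obtain ⟨w, rfl⟩ := hposmem v w0 w1
    rw [h10', h10]
    exact hL.pos_mem w
  swap
  · have : (n : ℤ) * K ≤ n * N₀ := mul_le_mul_of_nonneg_left hKN (by positivity)
    linarith
  rintro s₂ - f₂ hmax
  have hwalk := hsl.le_walk hT hK hopt.test
  have hT₂ := hopt.table.of_frame f₂
  refine (runs_writeCycle hB hT₂.graph.reg6 hT₂.reg9 (f₂.1 12 rfl) rfl ?_ hK.le v0 v1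
    (by rw [f₂.2 12 rfl]; exact hT) hwalk ?_).mono le_rfl ?_
  · intro x
    rw [f₂.2 18 rfl, f₁.2 18 rfl, h18]
  · have : (K + 1) * M ≤ (2 * M + 1) * M := mul_le_mul_of_nonneg_right (by omega) hM.le
    linarith
  rintro s₃ - f₃ ⟨a, b, hab, hbM, heq, hinj, h4, hcyc⟩
  rw [f₂.2 12 rfl] at heq hinj hcyc
  refine isCertifiedOutput_of_slope hsl hT hK hG.topo hopt.test hL hdeg
    (by rw [f₃.1 2 rfl, f₂.1 2 rfl]) (by rw [f₃.1 3 rfl, f₂.1 3 rfl]) (fun w => ?_) hab hbM heq hinj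
    h4 fun t ht => ?_
  · have h := hmax w (by positivity) (by exact_mod_cast w.2)
    rw [h10', h10] at h
    rw [f₃.2 2 rfl]
    exact h
  · obtain ⟨c0, c1⟩ := (hT.chain_spec hK.le le_rfl v0 v1 (b - t) (by omega)).2.1
    rw [hcyc t ht, f₂.2 7 rfl, f₁.2 7 rfl, h7 _ c0 c1]

end Solve

/-! ### The input -/

section Input

variable {n : ℕ} {G : Digraph (Fin n)} {es : List (Fin n × Fin n)}

theorem inputState_mem {i : ℕ} (hi : i < es.length) :
    (inputState n es).mem 0 i = ((es[i].1 : ℕ) : ℤ) ∧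
      (inputState n es).mem 1 i = ((es[i].2 : ℕ) : ℤ) := by
  simp [inputState, hi]

theorem inputState_mem_eq_zero {A : ℕ} (hA : 2 ≤ A) (x : ℤ) : (inputState n es).mem A x = 0 := by
  have h0 : A ≠ 0 := by omega
  have h1 : A ≠ 1 := by omega
  simp only [inputState, h0, h1, if_false]
  split_ifs
  · split <;> rfl
  · rfl

theorem inputEdge_iff (hes : IsEdgeList G es) (u v : ℤ) :
    InputEdge es.length ((inputState n es).mem 0) ((inputState n es).mem 1) u v ↔
      ∃ a b : Fin n, G.Adj a b ∧ ((a : ℕ) : ℤ) = u ∧ ((b : ℕ) : ℤ) = v := by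
  constructor
  · rintro ⟨e, e0, e1, rfl, rfl⟩
    obtain ⟨i, rfl⟩ := Int.eq_ofNat_of_zero_le e0
    have hi : i < es.length := by exact_mod_cast e1
    exact ⟨es[i].1, es[i].2, (hes.2 _).mp (List.getElem_mem hi), (inputState_mem hi).1.symm,
      (inputState_mem hi).2.symm⟩
  · rintro ⟨a, b, hab, rfl, rfl⟩
    obtain ⟨i, hi, h⟩ := List.getElem_of_mem ((hes.2 (a, b)).mpr hab)
    refine ⟨i, by positivity, by exact_mod_cast hi, ?_, ?_⟩
    · rw [(inputState_mem hi).1, h]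
    · rw [(inputState_mem hi).2, h]

theorem IsDag.wellFounded {V : Type*} [Finite V] {G : Digraph V} (hG : IsDag G) :
    WellFounded G.Adj := by
  have : IsTrans V (Relation.TransGen G.Adj) := ⟨fun _ _ _ => Relation.TransGen.trans⟩
  have : Std.Irrefl (Relation.TransGen G.Adj) := ⟨hG⟩
  exact Subrelation.wf (fun h => Relation.TransGen.single h)
    (Finite.wellFounded_of_trans_of_irrefl (Relation.TransGen G.Adj))

theorem wellFounded_inputEdge (hG : IsDag G) (hes : IsEdgeList G es) :
    WellFounded (InputEdge es.length ((inputState n es).mem 0) ((inputState n es).mem 1)) := by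
  refine ⟨fun w => ⟨w, fun u hu => ?_⟩⟩
  obtain ⟨a, -, -, rfl, -⟩ := (inputEdge_iff hes u w).mp hu
  clear hu
  induction a using hG.wellFounded.induction with
  | _ a ih =>
    refine ⟨_, fun u hu => ?_⟩
    obtain ⟨a', b', hab, rfl, hb⟩ := (inputEdge_iff hes u _).mp hu
    obtain rfl : b' = a := Fin.ext (by exact_mod_cast hb)
    exact ih a' hab

theorem bounded_inputState (hes : IsEdgeList G es) (hn : 2 ≤ n) :
    Bounded (n ^ 6) (inputState n es) ∧ es.length ≤ n ^ 6 := by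
  have hlen : es.length ≤ n ^ 6 := by
    have h := hes.1.length_le_card
    rw [Fintype.card_prod, Fintype.card_fin, ← sq] at h
    exact h.trans (Nat.pow_le_pow_right (by omega) (by norm_num))
  have hnB : n ≤ n ^ 6 := Nat.le_self_pow (by norm_num) n
  have hfin : ∀ a : Fin n, |((a : ℕ) : ℤ)| ≤ ((n ^ 6 : ℕ) : ℤ) := fun a => by
    rw [Nat.abs_cast]
    exact_mod_cast a.2.le.trans hnB
  refine ⟨⟨fun x => ?_, fun A x => ?_⟩, hlen⟩
  · simp only [inputState]
    split_ifs
    · rw [Nat.abs_cast]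
      exact_mod_cast hnB
    · rw [Nat.abs_cast]
      exact_mod_cast hlen
    · simp
  · simp only [inputState]
    split_ifs <;> try split
    all_goals first | exact hfin _ | simp

theorem IsReduction.exists_isLabeling {M : ℤ} {F E : ℤ → ℤ → Prop} {O p : ℤ → ℤ}
    (h : IsReduction n M F E O p) (hn : 0 < n)
    (hF : ∀ u v, F u v ↔ ∃ a b : Fin n, G.Adj a b ∧ ((a : ℕ) : ℤ) = u ∧ ((b : ℕ) : ℤ) = v) :
    ∃ vtx : ℤ → Fin n, (∀ i, 0 ≤ i → i < M → O i = ((vtx i : ℕ) : ℤ)) ∧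
      IsLabeling G E M vtx fun w => p ((w : ℕ) : ℤ) := by
  have hex : ∀ i, ∃ w : Fin n, 0 ≤ i → i < M → O i = ((w : ℕ) : ℤ) := by
    intro i
    by_cases hi : 0 ≤ i ∧ i < M
    · obtain ⟨h0, h1, -⟩ := h.vertex i hi.1 hi.2
      exact ⟨⟨(O i).toNat, by omega⟩, fun _ _ => by simp [h0]⟩
    · exact ⟨⟨0, hn⟩, fun h0 h1 => absurd ⟨h0, h1⟩ hi⟩
  choose vtx hvtx using hex
  have hw : ∀ w : Fin n, (0 : ℤ) ≤ ((w : ℕ) : ℤ) ∧ ((w : ℕ) : ℤ) < n := fun w =>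
    ⟨by positivity, by exact_mod_cast w.2⟩
  refine ⟨vtx, hvtx, fun w => h.pos _ (hw w).1 (hw w).2, fun i i0 i1 => ?_, fun u v => ?_⟩
  · simp only [← hvtx i i0 i1, (h.vertex i i0 i1).2.2]
  · rw [← h.adj _ _ (hw u).1 (hw u).2 (hw v).1 (hw v).2, hF]
    constructor
    · exact fun huv => ⟨u, v, huv, rfl, rfl⟩
    · rintro ⟨a, b, hab, ha, hb⟩
      obtain rfl : a = u := Fin.ext (by exact_mod_cast ha)
      obtain rfl : b = v := Fin.ext (by exact_mod_cast hb)
      exact hab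

theorem numEdges_eq (hes : IsEdgeList G es) : numEdges G = es.length := by
  have h : {p : Fin n × Fin n | G.Adj p.1 p.2} = (es.toFinset : Set (Fin n × Fin n)) := by
    ext p
    simp [hes.2 p]
  rw [numEdges, h, Set.ncard_coe_finset, List.toFinset_card_of_nodup hes.1]

end Input

/-! ### Running time -/

/-- A dag without three vertices `u`, `v`, `w` such that `(u, w)` is an edge, but neither `(u, v)` nor
`(v, w)` is one, models a weak order: the numbers of predecessors of the vertices represent it. -/
theorem IsDag.isDegenerate {V : Type*} [Finite V] {G : Digraph V} (hG : IsDag G)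
    (h : ∀ u v w, G.Adj u w → G.Adj u v ∨ G.Adj v w) : IsDegenerate G := by
  refine ⟨fun v => ({u | G.Adj u v} : Set V).ncard, fun u v => ⟨fun huv => ?_, fun hlt => ?_⟩⟩
  · refine Nat.cast_lt.mpr (Set.ncard_lt_ncard ⟨fun w hw => ?_, fun hsub => ?_⟩ (Set.toFinite _))
    · exact (h w v u hw).resolve_right fun hvu => hG u (.tail (.single huv) hvu)
    · exact hG u (.single (hsub huv))
  · by_contra huv
    refine absurd hlt (not_lt.mpr (Nat.cast_le.mpr (Set.ncard_le_ncard (fun w hw => ?_)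
      (Set.toFinite _))))
    exact (h w u v hw).resolve_right huv

/-- The numbers of ancestors are a satisfying assignment for large `t₂`. -/
theorem IsDag.satisfiableRatios_nonempty {V : Type*} [Finite V] {G : Digraph V} (hG : IsDag G) :
    (satisfiableRatios G).Nonempty := by
  have hle : ∀ s : Set V, s.ncard ≤ Nat.card V := fun s => by
    rw [← Set.ncard_univ]
    exact Set.ncard_le_ncard (Set.subset_univ _) Set.finite_univ
  refine ⟨_, 1, Nat.card V + 1, one_pos, by positivity,
    ⟨fun v => ({u | Relation.TransGen G.Adj u v} : Set V).ncard, fun u v huv => ?_,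
      fun u v _ => ?_⟩, rfl⟩
  · have hlt := Set.ncard_lt_ncard (s := {w | Relation.TransGen G.Adj w u})
      (t := {w | Relation.TransGen G.Adj w v})
      ⟨fun w hw => Relation.TransGen.tail hw huv, fun hsub => hG u (hsub (.single huv))⟩
      (Set.toFinite _)
    have : (({w | Relation.TransGen G.Adj w u} : Set V).ncard : ℝ) + 1
        ≤ ({w | Relation.TransGen G.Adj w v} : Set V).ncard := by exact_mod_cast hlt
    linarith
  · have : (({w | Relation.TransGen G.Adj w v} : Set V).ncard : ℝ) ≤ Nat.card V := by
      exact_mod_cast hle _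
    have h0 : (0 : ℝ) ≤ ({w | Relation.TransGen G.Adj w u} : Set V).ncard := by positivity
    linarith

/-- Two hops from `u` over `v` to `w`, closed by an edge from `u` to `w`, make every satisfiable ratio
at least `1 / 2`. -/
theorem lam_pos {V : Type*} [Finite V] {G : Digraph V} (hG : IsDag G) (hdeg : ¬ IsDegenerate G) :
    0 < lam G := by
  obtain ⟨u, v, w, huw, huv, hvw⟩ : ∃ u v w, G.Adj u w ∧ ¬ G.Adj u v ∧ ¬ G.Adj v w := by
    by_contra h
    push Not at h
    exact hdeg (hG.isDegenerate fun u v w huw => or_iff_not_imp_left.mpr (h u v w huw))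
  refine lt_of_lt_of_le one_half_pos (le_csInf hG.satisfiableRatios_nonempty ?_)
  rintro _ ⟨t₁, t₂, h₁, -, ⟨α, hα⟩, rfl⟩
  rw [div_le_div_iff₀ two_pos h₁]
  linarith [hα.1 _ _ huw, hα.2 _ _ huv, hα.2 _ _ hvw]

/-- The time for the preparation is bounded separately: that it is `O(n * m / lam G)` follows from bounds
on `lam G`, which the prepared graph supplies. The number of layers is at most `2 * M / (1 + lam G)`. -/
theorem runs_prepare_solve {n : ℕ} {G : Digraph (Fin n)} {es : List (Fin n × Fin n)} (hdag : IsDag G)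
    (hdeg : ¬ IsDegenerate G) (hes : IsEdgeList G es) (hn : 2 ≤ n) (hm : 1 ≤ es.length)
    (hlam0 : 0 < lam G) :
    Runs (n ^ 6) (prepare ;; solve) (inputState n es)
      (500 * (n + es.length + 1) + ⌊95000 * ((n : ℝ) * es.length / lam G)⌋) fun s' =>
        IsCertifiedOutput G s' ∧ lam G ≤ n ∧ lam G ≤ 2 * es.length + 1 := by
  obtain ⟨-, hmB⟩ := bounded_inputState hes hn
  have hB : 2 ≤ n ^ 6 := hn.trans (Nat.le_self_pow (by norm_num) n)
  have hnB : n ≤ n ^ 6 := Nat.le_self_pow (by norm_num) n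
  have hrange : ∀ e : ℤ, 0 ≤ e → e < es.length →
      (0 ≤ (inputState n es).mem 0 e ∧ (inputState n es).mem 0 e < n) ∧
        0 ≤ (inputState n es).mem 1 e ∧ (inputState n es).mem 1 e < n := by
    intro e e0 e1
    obtain ⟨i, rfl⟩ := Int.eq_ofNat_of_zero_le e0
    have hi : i < es.length := by exact_mod_cast e1
    have := inputState_mem hi
    simp only [this.1, this.2]
    exact ⟨⟨by positivity, by exact_mod_cast es[i].1.2⟩, by positivity,
      by exact_mod_cast es[i].2.2⟩
  refine Runs.seq (runs_prepare hB (n := n) (m := es.length) rfl rfl rfl rfl (by positivity)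
    (by positivity) (inputState_mem_eq_zero (by norm_num)) (inputState_mem_eq_zero (by norm_num))
    (wellFounded_inputEdge hdag hes) (fun e e0 e1 => (hrange e e0 e1).1)
    (fun e e0 e1 => (hrange e e0 e1).2) (by exact_mod_cast hnB) (by exact_mod_cast hmB)) ?_ le_rfl
  rintro s - f ⟨E, M, mm, T, H, hG, hs, hred, hmm, hM0, hMn, hMm⟩
  obtain ⟨vtx, hvtx, hL⟩ := hred.exists_isLabeling (G := G) (by omega) (inputEdge_iff hes)
  have hM : 0 < M := by
    have := hL.pos_mem ⟨0, by omega⟩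
    omega
  have hlamM : lam G ≤ M := (hL.isRatioInf hG.topo hdeg).le _ hG.topo.sat
  have hM' : (1 : ℝ) ≤ M := by exact_mod_cast hM
  have hMn' : (M : ℝ) ≤ n := by exact_mod_cast hMn
  have hMm' : (M : ℝ) ≤ 2 * es.length + 1 := by exact_mod_cast hMm
  have hmm' : (mm : ℝ) ≤ es.length := by exact_mod_cast hmm
  have hm' : (1 : ℝ) ≤ es.length := by exact_mod_cast hm
  have hmm0 : (0 : ℝ) ≤ mm := by exact_mod_cast hG.nonneg
  -- The bound `M` on `lam G` makes the first admissible number of layers at least `1`.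
  obtain ⟨N₀, hN₀⟩ : ∃ N₀ : ℤ, N₀ = ⌊2 * (M : ℝ) / (1 + lam G)⌋ := ⟨_, rfl⟩
  have hpos : 0 < 1 + lam G := by linarith
  have hN1 : 1 ≤ N₀ := by
    rw [hN₀, Int.le_floor, le_div_iff₀ hpos]
    push_cast
    linarith
  have hNle : (N₀ : ℝ) * (1 + lam G) ≤ 2 * M := by
    rw [← le_div_iff₀ hpos, hN₀]
    exact Int.floor_le _
  have hN1' : (1 : ℝ) ≤ N₀ := by exact_mod_cast hN1
  refine (runs_solve hn hG hs hL hdeg hM hMn (hmm.trans (by exact_mod_cast hmB)) (f.1 0 rfl)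
    (f.1 9 rfl) hvtx (fun w => rfl) ?_ ?_ ?_ ?_ hN1 (fun N hN => ?_) ?_).mono ?_ ?_
  · exact fun x => by rw [f.2 11 rfl]; exact inputState_mem_eq_zero (by norm_num) x
  · exact fun x => by rw [f.2 13 rfl]; exact inputState_mem_eq_zero (by norm_num) x
  · exact fun x => by rw [f.2 16 rfl]; exact inputState_mem_eq_zero (by norm_num) x
  · exact fun x => by rw [f.2 18 rfl]; exact inputState_mem_eq_zero (by norm_num) x
  · rw [hN₀, Int.le_floor, le_div_iff₀ hpos]
    exact hN.le
  · have : (N₀ : ℝ) ≤ 2 * M := by nlinarith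
    exact_mod_cast this
  · rw [Int.le_floor, ← mul_div_assoc, le_div_iff₀ hlam0]
    push_cast
    have hNl : (N₀ : ℝ) * lam G ≤ 2 * M := by linarith
    have hln : lam G ≤ n := hlamM.trans hMn'
    have hn' : (1 : ℝ) ≤ n := hM'.trans hMn'
    have hnm : (n : ℝ) ≤ n * es.length := le_mul_of_one_le_right (by linarith) hm'
    have hsum : 4 * (M : ℝ) + mm + 1 ≤ 14 * es.length := by linarith
    have h1 : (N₀ : ℝ) * lam G * (4 * M + mm + 1) ≤ 2 * n * (14 * es.length) :=
      mul_le_mul (by linarith) hsum (by linarith) (by linarith)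
    have h2 : (n : ℝ) * (N₀ * lam G) ≤ n * (6 * es.length) :=
      mul_le_mul_of_nonneg_left (by linarith) (by linarith)
    have h3 : (M : ℝ) * lam G ≤ 3 * es.length * n :=
      mul_le_mul (by linarith) hln hlam0.le (by linarith)
    nlinarith
  · exact fun s' _ _ h => ⟨h, hlamM.trans hMn', hlamM.trans hMm'⟩

end DoubleThreshold

theorem mainTheorem4 :
    ∃ (P : WordRAM.Program) (C k : ℕ),
      ∀ (n : ℕ) (G : Digraph (Fin n)) (es : List (Fin n × Fin n)),
        DoubleThreshold.IsDag G → ¬ DoubleThreshold.IsDegenerate G →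
        DoubleThreshold.IsEdgeList G es →
        ∃ (s : WordRAM.State) (t : ℕ),
          WordRAM.Exec (n ^ k) P (DoubleThreshold.inputState n es) s t ∧
          DoubleThreshold.IsCertifiedOutput G s ∧
          (t : ℝ) ≤ (C : ℝ) *
            ((n : ℝ) * (DoubleThreshold.numEdges G : ℝ) / DoubleThreshold.lam G) := by
  refine ⟨DoubleThreshold.prepare ;; DoubleThreshold.solve, 100000, 60, ?_⟩
  intro n G es hdag hdeg hes
  have hlam0 := DoubleThreshold.lam_pos hdag hdeg
  obtain ⟨u, v, huv⟩ : ∃ u v, G.Adj u v := by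
    by_contra h
    push Not at h
    exact hdeg ⟨fun _ => 0, fun u v => by simp [h u v]⟩
  have hm : 1 ≤ es.length := List.length_pos_of_mem ((hes.2 (u, v)).mpr huv)
  have hn : 2 ≤ n := by
    have hne : u ≠ v := fun h => hdag u (.single (by rwa [← h] at huv))
    have h : (u : ℕ) ≠ v := fun h => hne (Fin.ext h)
    omega
  obtain ⟨s, t, hex, ht, -, hout, hln, hlm⟩ :=
    DoubleThreshold.runs_prepare_solve hdag hdeg hes hn hm hlam0
      (DoubleThreshold.bounded_inputState hes hn).1
  -- Stored numbers are at most `n ^ 6`, and intermediate results at most `(n ^ 6) ^ 10`.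
  rw [← pow_mul] at hex
  refine ⟨s, t, hex, hout, ?_⟩
  rw [DoubleThreshold.numEdges_eq hes]
  have hm' : (1 : ℝ) ≤ es.length := by exact_mod_cast hm
  have hn' : (1 : ℝ) ≤ n := by exact_mod_cast (by omega : 1 ≤ n)
  have ht' : (t : ℝ) ≤ 500 * (n + es.length + 1) +
      (⌊95000 * ((n : ℝ) * es.length / DoubleThreshold.lam G)⌋ : ℝ) := by exact_mod_cast ht
  have hfl := Int.floor_le (95000 * ((n : ℝ) * es.length / DoubleThreshold.lam G))
  have hprep : 500 * ((n : ℝ) + es.length + 1) ≤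
      5000 * ((n : ℝ) * es.length / DoubleThreshold.lam G) := by
    rw [← mul_div_assoc, le_div_iff₀ hlam0]
    have h1 : (n : ℝ) * DoubleThreshold.lam G ≤ n * (3 * es.length) :=
      mul_le_mul_of_nonneg_left (by linarith) (by linarith)
    have h2 : (es.length : ℝ) * DoubleThreshold.lam G ≤ es.length * n :=
      mul_le_mul_of_nonneg_left hln (by linarith)
    have h3 : (n : ℝ) ≤ n * es.length := le_mul_of_one_le_right (by linarith) hm'
    nlinarith
  push_cast
  linarith
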